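/- Fix $\beta>0$ and $\omega\in(0,\frac{\pi}{3})\cup[\frac{\pi}{2},\pi)$, put $\alpha=\omega/2$ and $E_\alpha=-\beta^2/\sin^2\alpha$. For $L>0$ let $$\Sigma_1=\{(x_1,x_2)\in\mathbb R^2:\ \arg\big((x_1+L)+ix_2\big)\in(0,\omega)\},\qquad \Sigma_2=\{(x_1,x_2):\ (-x_1,x_2)\in\Sigma_1\},\qquad \Omega_L=\Sigma_1\cap\Sigma_2,$$ and let $H_L$ be the Robin Laplacian on $\Omega_L$, i.e. the self-adjoint operator in $L^2(\Omega_L;\mathbb R)$ associated with the bilinear form $$h(u,v)=\iint_{\Omega_L}\nabla u\cdot\nabla v\,dx-\beta\int_{\partial\Omega_L}uv\,ds,\qquad u,v\in H^1(\Omega_L).$$ Denote by $E_1(L)\le E_2(L)\le\dots$ the eigenvalues of $H_L$ in non-decreasing order, counted with multiplicity. Then: 1. For all sufficiently large $L$ the operator $H_L$ has at least two eigenvalues below its essential spectrum, and $E_1(L)<E_2(L)<\inf\operatorname{spec}_{\mathrm{ess}}H_L$. 2. $\lim_{L\to+\infty}E_j(L)=E_\alpha$ for $j=1,2$. 3. $\displaystyle\liminf_{L\to+\infty}\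 \inf\big(\operatorname{spec}H_L\setminus\{E_1(L),E_2(L)\}\big)>E_\alpha$. 4. There exist $\delta>0$ and $L_0>0$ such that for every $L\ge L_0$ the spectrum of $H_L$ in $(E_\alpha-\delta,E_\alpha+\delta)$ consists of exactly the two eigenvalues $E_1(L)$ and $E_2(L)$, both of multiplicity one. (Here $\inf\varnothing=+\infty$.) -/

import Mathlib

open Real Set Filter Topology MeasureTheory
open scoped RealInnerProductSpace

/-! ### Spectral notions for (unbounded) operators in a real Hilbert space -/

section Spectral

variable {H : Type*} [NormedAddCommGroup H] [InnerProductSpace ℝ H]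

/-- `z` belongs to the resolvent set of `A` when `A - z : D(A) → H` is bijective with bounded
inverse (injectivity is contained in the bound). -/
def IsResolventPoint (A : H →ₗ.[ℝ] H) (z : ℝ) : Prop :=
  (∀ f : H, ∃ u : A.domain, A u - z • (u : H) = f) ∧
    ∃ C : ℝ, ∀ u : A.domain, ‖(u : H)‖ ≤ C * ‖A u - z • (u : H)‖

/-- The (real) spectrum; for a self-adjoint operator this is the whole spectrum. -/
def opSpectrum (A : H →ₗ.[ℝ] H) : Set ℝ := {z | ¬ IsResolventPoint A z}

/-- The space `{u ∈ D(A) : A u = z u}`. -/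
def opEigenspace (A : H →ₗ.[ℝ] H) (z : ℝ) : Submodule ℝ H :=
  (LinearMap.ker (A.toFun - z • A.domain.subtype)).map A.domain.subtype

def IsOpEigenvalue (A : H →ₗ.[ℝ] H) (z : ℝ) : Prop := opEigenspace A z ≠ ⊥

/-- The discrete spectrum: isolated points of the spectrum that are eigenvalues of finite
multiplicity. -/
def discreteSpectrum (A : H →ₗ.[ℝ] H) : Set ℝ :=
  {z | (∃ ε > 0, opSpectrum A ∩ Ioo (z - ε) (z + ε) = {z}) ∧
    IsOpEigenvalue A z ∧ FiniteDimensional ℝ (opEigenspace A z)}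

def essentialSpectrum (A : H →ₗ.[ℝ] H) : Set ℝ := opSpectrum A \ discreteSpectrum A

/-- The `n`-th eigenvalue (`n ≥ 1`), in non-decreasing order and counted with multiplicity: the
least `t` such that the eigenvalues in `(-∞, t]` have total multiplicity at least `n`. -/
noncomputable def nthEigenvalue (A : H →ₗ.[ℝ] H) (n : ℕ) : ℝ :=
  sInf {t : ℝ | (n : Cardinal) ≤ Module.rank ℝ ↥(⨆ z ∈ Iic t, opEigenspace A z)}

end Spectral

/-! ### Sobolev functions with their traces, and the Robin Laplacian -/

section Robin

open scoped ContDiff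

/-- The Euclidean plane. -/
abbrev Plane : Type := EuclideanSpace ℝ (Fin 2)

/-- `L²(Ω; ℝ)`. -/
abbrev L2Dom (Ω : Set Plane) : Type := Lp ℝ 2 (volume.restrict Ω)

/-- `L²(∂Ω; ℝ)` with respect to arc length. -/
abbrev L2Bdry (Ω : Set Plane) : Type := Lp ℝ 2 ((μH[1] : Measure Plane).restrict (frontier Ω))

/-- The partial derivative `∂ᵢφ`. -/
noncomputable def pderivAt (i : Fin 2) (φ : Plane → ℝ) (x : Plane) : ℝ :=
  fderiv ℝ φ x (EuclideanSpace.single i 1)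

/-- `g` is the weak gradient of `u` in `Ω`. -/
def IsWeakGrad (Ω : Set Plane) (u : L2Dom Ω) (g : Fin 2 → L2Dom Ω) : Prop :=
  ∀ φ : Plane → ℝ, ContDiff ℝ ∞ φ → HasCompactSupport φ → tsupport φ ⊆ Ω → ∀ i : Fin 2,
    ∫ x in Ω, u x * pderivAt i φ x = - ∫ x in Ω, g i x * φ x

lemma continuous_pderivAt {φ : Plane → ℝ} (h : ContDiff ℝ ∞ φ) (i : Fin 2) :
    Continuous (pderivAt i φ) :=
  (h.continuous_fderiv (by simp)).clm_apply continuous_const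

lemma hasCompactSupport_pderivAt {φ : Plane → ℝ} (h : HasCompactSupport φ) (i : Fin 2) :
    HasCompactSupport (pderivAt i φ) :=
  h.fderiv_apply (𝕜 := ℝ) (EuclideanSpace.single i (1 : ℝ))

lemma memLp_test (Ω : Set Plane) {φ : Plane → ℝ} (h : Continuous φ) (hc : HasCompactSupport φ) :
    MemLp φ 2 (volume.restrict Ω) :=
  (h.memLp_of_hasCompactSupport (μ := volume) hc).restrict Ω

lemma integrable_mul_test (Ω : Set Plane) (u : L2Dom Ω) {φ : Plane → ℝ} (h : Continuous φ)
    (hc : HasCompactSupport φ) : Integrable (fun x => u x * φ x) (volume.restrict Ω) :=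
  (Lp.memLp u).integrable_mul (memLp_test Ω h hc)

lemma IsWeakGrad.add {Ω : Set Plane} {u v : L2Dom Ω} {g k : Fin 2 → L2Dom Ω}
    (hu : IsWeakGrad Ω u g) (hv : IsWeakGrad Ω v k) : IsWeakGrad Ω (u + v) (g + k) := by
  intro φ h1 h2 h3 i
  have e1 : ∫ x in Ω, (u + v : L2Dom Ω) x * pderivAt i φ x
      = ∫ x in Ω, (u x * pderivAt i φ x + v x * pderivAt i φ x) := by
    apply integral_congr_ae
    filter_upwards [Lp.coeFn_add u v] with x hx
    rw [hx, Pi.add_apply]; ring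
  have e2 : ∫ x in Ω, ((g + k) i : L2Dom Ω) x * φ x
      = ∫ x in Ω, (g i x * φ x + k i x * φ x) := by
    apply integral_congr_ae
    filter_upwards [Lp.coeFn_add (g i) (k i)] with x hx
    rw [Pi.add_apply, hx, Pi.add_apply]; ring
  have c1 := continuous_pderivAt h1 i
  have c2 := hasCompactSupport_pderivAt h2 i
  rw [e1, e2, integral_add (integrable_mul_test Ω u c1 c2) (integrable_mul_test Ω v c1 c2),
    integral_add (integrable_mul_test Ω (g i) h1.continuous h2)
      (integrable_mul_test Ω (k i) h1.continuous h2), hu φ h1 h2 h3 i, hv φ h1 h2 h3 i]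
  ring

lemma IsWeakGrad.smul {Ω : Set Plane} {u : L2Dom Ω} {g : Fin 2 → L2Dom Ω} (c : ℝ)
    (hu : IsWeakGrad Ω u g) : IsWeakGrad Ω (c • u) (c • g) := by
  intro φ h1 h2 h3 i
  have e1 : ∫ x in Ω, (c • u : L2Dom Ω) x * pderivAt i φ x
      = ∫ x in Ω, c * (u x * pderivAt i φ x) := by
    apply integral_congr_ae
    filter_upwards [Lp.coeFn_smul c u] with x hx
    rw [hx, Pi.smul_apply, smul_eq_mul]; ring
  have e2 : ∫ x in Ω, ((c • g) i : L2Dom Ω) x * φ x = ∫ x in Ω, c * (g i x * φ x) := by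
    apply integral_congr_ae
    filter_upwards [Lp.coeFn_smul c (g i)] with x hx
    rw [Pi.smul_apply, hx, Pi.smul_apply, smul_eq_mul]; ring
  rw [e1, e2, integral_const_mul, integral_const_mul, hu φ h1 h2 h3 i]
  ring

lemma IsWeakGrad.zero (Ω : Set Plane) : IsWeakGrad Ω 0 0 := by
  intro φ _ _ _ i
  have e1 : ∫ x in Ω, (0 : L2Dom Ω) x * pderivAt i φ x = 0 := by
    apply integral_eq_zero_of_ae
    filter_upwards [Lp.coeFn_zero ℝ 2 (volume.restrict Ω)] with x hx
    rw [hx]; simp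
  have e2 : ∫ x in Ω, ((0 : Fin 2 → L2Dom Ω) i) x * φ x = 0 := by
    apply integral_eq_zero_of_ae
    filter_upwards [Lp.coeFn_zero ℝ 2 (volume.restrict Ω)] with x hx
    rw [Pi.zero_apply, hx]; simp
  rw [e1, e2, neg_zero]

/-- The triples `(φ|_Ω, ∇φ|_Ω, φ|_∂Ω)` for `φ ∈ C_c^∞(ℝ²)`. -/
def smoothTriples (Ω : Set Plane) :
    Submodule ℝ (L2Dom Ω × (Fin 2 → L2Dom Ω) × L2Bdry Ω) where
  carrier := {p | ∃ φ : Plane → ℝ, ContDiff ℝ ∞ φ ∧ HasCompactSupport φ ∧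
    p.1 =ᵐ[volume.restrict Ω] φ ∧
    (∀ i, p.2.1 i =ᵐ[volume.restrict Ω] pderivAt i φ) ∧
    p.2.2 =ᵐ[(μH[1] : Measure Plane).restrict (frontier Ω)] φ}
  zero_mem' := by
    refine ⟨0, contDiff_const, HasCompactSupport.zero, Lp.coeFn_zero _ _ _, fun i => ?_,
      Lp.coeFn_zero _ _ _⟩
    have : pderivAt i (0 : Plane → ℝ) = 0 := by
      ext x; simp [pderivAt]
    rw [this]
    exact Lp.coeFn_zero _ _ _
  add_mem' := by
    rintro p q ⟨φ, a1, a2, a3, a4, a5⟩ ⟨ψ, b1, b2, b3, b4, b5⟩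
    refine ⟨φ + ψ, a1.add b1, a2.add b2, (Lp.coeFn_add _ _).trans (a3.add b3), fun i => ?_,
      (Lp.coeFn_add _ _).trans (a5.add b5)⟩
    have : pderivAt i (φ + ψ) = pderivAt i φ + pderivAt i ψ := by
      ext x
      simp only [pderivAt, Pi.add_apply]
      rw [fderiv_add (a1.differentiable (by simp) x) (b1.differentiable (by simp) x)]
      rfl
    rw [this]
    exact (Lp.coeFn_add _ _).trans ((a4 i).add (b4 i))
  smul_mem' := by
    rintro c p ⟨φ, a1, a2, a3, a4, a5⟩
    refine ⟨c • φ, a1.const_smul c, a2.smul_left (f := fun _ => c),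
      (Lp.coeFn_smul _ _).trans (a3.const_smul c), fun i => ?_,
      (Lp.coeFn_smul _ _).trans (a5.const_smul c)⟩
    have : pderivAt i (c • φ) = c • pderivAt i φ := by
      ext x
      simp only [pderivAt, Pi.smul_apply]
      rw [fderiv_const_smul (a1.differentiable (by simp) x)]
      rfl
    rw [this]
    exact (Lp.coeFn_smul _ _).trans ((a4 i).const_smul c)

/-- The Sobolev functions on `Ω` together with their weak gradients and boundary traces: the
triples `(u, ∇u, u|_∂Ω)`, where `u ∈ L²(Ω)` has the weak gradient `∇u ∈ L²(Ω)²` and the trace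
`u|_∂Ω ∈ L²(∂Ω)` is the limit of `φₙ|_∂Ω` for some `φₙ ∈ C_c^∞(ℝ²)` with `φₙ → u` in `H¹(Ω)`.
On a domain with uniformly Lipschitz boundary every `u ∈ H¹(Ω)` occurs in exactly one triple. -/
def sobolevH1 (Ω : Set Plane) : Submodule ℝ (L2Dom Ω × (Fin 2 → L2Dom Ω) × L2Bdry Ω) where
  carrier := {p | IsWeakGrad Ω p.1 p.2.1 ∧ p ∈ (smoothTriples Ω).topologicalClosure}
  zero_mem' := ⟨IsWeakGrad.zero Ω, Submodule.zero_mem _⟩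
  add_mem' := fun hp hq => ⟨hp.1.add hq.1, Submodule.add_mem _ hp.2 hq.2⟩
  smul_mem' := fun c _ hp => ⟨hp.1.smul c, Submodule.smul_mem _ c hp.2⟩

/-- The Robin form `h(u, v) = ∫_Ω ∇u·∇v dx - β ∫_∂Ω u v ds`. -/
noncomputable def robinForm (Ω : Set Plane) (β : ℝ)
    (p q : L2Dom Ω × (Fin 2 → L2Dom Ω) × L2Bdry Ω) : ℝ :=
  ∑ i, ⟪p.2.1 i, q.2.1 i⟫ - β * ⟪p.2.2, q.2.2⟫

lemma robinForm_add (Ω : Set Plane) (β : ℝ)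
    (p p' q : L2Dom Ω × (Fin 2 → L2Dom Ω) × L2Bdry Ω) :
    robinForm Ω β (p + p') q = robinForm Ω β p q + robinForm Ω β p' q := by
  simp only [robinForm, Prod.fst_add, Prod.snd_add, Pi.add_apply, inner_add_left,
    Finset.sum_add_distrib]
  ring

lemma robinForm_smul (Ω : Set Plane) (β c : ℝ)
    (p q : L2Dom Ω × (Fin 2 → L2Dom Ω) × L2Bdry Ω) :
    robinForm Ω β (c • p) q = c * robinForm Ω β p q := by
  simp only [robinForm, Prod.smul_fst, Prod.smul_snd, Pi.smul_apply, real_inner_smul_left,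
    ← Finset.mul_sum]
  ring

/-- The graph of the operator associated with the Robin form: the pairs `(u, f)` with
`u ∈ H¹(Ω)`, `f ∈ L²(Ω)` and `h(u, v) = ⟨f, v⟩` for all `v ∈ H¹(Ω)`. -/
def robinGraph (Ω : Set Plane) (β : ℝ) : Submodule ℝ (L2Dom Ω × L2Dom Ω) where
  carrier := {w | ∃ p ∈ sobolevH1 Ω, p.1 = w.1 ∧
    ∀ q ∈ sobolevH1 Ω, robinForm Ω β p q = ⟪w.2, q.1⟫}
  zero_mem' := ⟨0, Submodule.zero_mem _, rfl, fun q _ => by simp [robinForm]⟩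
  add_mem' := by
    rintro w w' ⟨p, hp, h1, h2⟩ ⟨p', hp', h1', h2'⟩
    refine ⟨p + p', Submodule.add_mem _ hp hp', by rw [Prod.fst_add, h1, h1', Prod.fst_add],
      fun q hq => ?_⟩
    rw [robinForm_add, h2 q hq, h2' q hq, Prod.snd_add, inner_add_left]
  smul_mem' := by
    rintro c w ⟨p, hp, h1, h2⟩
    refine ⟨c • p, Submodule.smul_mem _ c hp, by rw [Prod.smul_fst, h1, Prod.smul_fst],
      fun q hq => ?_⟩
    rw [robinForm_smul, h2 q hq, Prod.smul_snd, real_inner_smul_left]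

/-- The Robin Laplacian `H(Ω, β)` in `L²(Ω; ℝ)`: the operator associated with the Robin form. -/
noncomputable def robinLaplacian (Ω : Set Plane) (β : ℝ) : L2Dom Ω →ₗ.[ℝ] L2Dom Ω :=
  (robinGraph Ω β).toLinearPMap

lemma eq_zero_of_test {Ω : Set Plane} (hΩ : IsOpen Ω) (f : L2Dom Ω)
    (h : ∀ φ : Plane → ℝ, ContDiff ℝ ∞ φ → HasCompactSupport φ → tsupport φ ⊆ Ω →
      ∫ x in Ω, f x * φ x = 0) : f = 0 := by
  have hloc : LocallyIntegrableOn f Ω volume := by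
    have h1 : LocallyIntegrable f (volume.restrict Ω) :=
      (Lp.memLp f).locallyIntegrable (by norm_num)
    exact locallyIntegrableOn_of_locallyIntegrable_restrict h1
  have key := hΩ.ae_eq_zero_of_integral_contDiff_smul_eq_zero hloc (fun φ h1 h2 h3 => by
    rw [← h φ h1 h2 h3, ← setIntegral_eq_integral_of_forall_compl_eq_zero (s := Ω)]
    · simp only [smul_eq_mul, mul_comm]
    · intro x hx
      have : φ x = 0 := image_eq_zero_of_notMem_tsupport (fun hh => hx (h3 hh))
      simp [this])
  refine Lp.ext ?_
  have : ∀ᵐ x ∂(volume.restrict Ω), f x = 0 :=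
    (ae_restrict_iff' hΩ.measurableSet).2 key
  filter_upwards [this, Lp.coeFn_zero ℝ 2 (volume.restrict Ω)] with x h1 h2
  rw [h1, h2]; rfl

/-- Functions in `C_c^∞(Ω)` belong to `H¹(Ω)`, with zero trace. -/
lemma test_mem_sobolevH1 {Ω : Set Plane} (hΩ : IsOpen Ω) {φ : Plane → ℝ} (h1 : ContDiff ℝ ∞ φ)
    (h2 : HasCompactSupport φ) (h3 : tsupport φ ⊆ Ω) :
    (((memLp_test Ω h1.continuous h2).toLp φ,
      (fun i => (memLp_test Ω (continuous_pderivAt h1 i)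
        (hasCompactSupport_pderivAt h2 i)).toLp _), 0) :
      L2Dom Ω × (Fin 2 → L2Dom Ω) × L2Bdry Ω) ∈ sobolevH1 Ω := by
  refine ⟨?_, Submodule.le_topologicalClosure _ ?_⟩
  · intro ψ k1 k2 k3 i
    have e1 : ∫ x in Ω, ((memLp_test Ω h1.continuous h2).toLp φ) x * pderivAt i ψ x
        = ∫ x in Ω, φ x * pderivAt i ψ x := by
      apply integral_congr_ae
      filter_upwards [(memLp_test Ω h1.continuous h2).coeFn_toLp] with x hx
      rw [hx]
    have e2 : ∫ x in Ω, ((memLp_test Ω (continuous_pderivAt h1 i)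
        (hasCompactSupport_pderivAt h2 i)).toLp _) x * ψ x
        = ∫ x in Ω, pderivAt i φ x * ψ x := by
      apply integral_congr_ae
      filter_upwards [(memLp_test Ω (continuous_pderivAt h1 i)
        (hasCompactSupport_pderivAt h2 i)).coeFn_toLp] with x hx
      rw [hx]
    have z : ∀ x, x ∉ Ω → φ x = 0 := fun x hx =>
      image_eq_zero_of_notMem_tsupport (fun hh => hx (h3 hh))
    have z' : ∀ x, x ∉ Ω → ψ x = 0 := fun x hx =>
      image_eq_zero_of_notMem_tsupport (fun hh => hx (k3 hh))
    change ∫ x in Ω, ((memLp_test Ω h1.continuous h2).toLp φ) x * pderivAt i ψ x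
      = - ∫ x in Ω, ((memLp_test Ω (continuous_pderivAt h1 i)
        (hasCompactSupport_pderivAt h2 i)).toLp _) x * ψ x
    rw [e1, e2, setIntegral_eq_integral_of_forall_compl_eq_zero (fun x hx => by simp [z x hx]),
      setIntegral_eq_integral_of_forall_compl_eq_zero (fun x hx => by simp [z' x hx])]
    refine integral_mul_fderiv_eq_neg_fderiv_mul_of_integrable (μ := volume) ?_ ?_ ?_
      (fun x _ => h1.differentiable (by simp) x) (fun x _ => k1.differentiable (by simp) x)
    · exact ((continuous_pderivAt h1 i).mul k1.continuous).integrable_of_hasCompactSupport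
        k2.mul_left
    · exact (h1.continuous.mul (continuous_pderivAt k1 i)).integrable_of_hasCompactSupport
        h2.mul_right
    · exact (h1.continuous.mul k1.continuous).integrable_of_hasCompactSupport h2.mul_right
  · refine ⟨φ, h1, h2, (memLp_test Ω h1.continuous h2).coeFn_toLp, fun i =>
      (memLp_test Ω (continuous_pderivAt h1 i) (hasCompactSupport_pderivAt h2 i)).coeFn_toLp, ?_⟩
    have hz : ∀ᵐ x ∂((μH[1] : Measure Plane).restrict (frontier Ω)), φ x = 0 := by
      refine (ae_restrict_iff' isClosed_frontier.measurableSet).2 (Eventually.of_forall ?_)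
      intro x hx
      refine image_eq_zero_of_notMem_tsupport (fun hh => ?_)
      rw [hΩ.frontier_eq] at hx
      exact hx.2 (h3 hh)
    filter_upwards [hz, Lp.coeFn_zero ℝ 2 ((μH[1] : Measure Plane).restrict (frontier Ω))]
      with x a b
    rw [a]; exact b

/-- On an open set the Robin form does define an operator: `f` is determined by `u`. -/
lemma robinGraph_single_valued {Ω : Set Plane} (hΩ : IsOpen Ω) (β : ℝ)
    (w : L2Dom Ω × L2Dom Ω) (hw : w ∈ robinGraph Ω β) (h0 : w.1 = 0) : w.2 = 0 := by
  obtain ⟨p, hp, h1, h2⟩ := hw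
  have hg : ∀ i, p.2.1 i = 0 := fun i => by
    refine eq_zero_of_test hΩ _ (fun φ k1 k2 k3 => ?_)
    have := hp.1 φ k1 k2 k3 i
    rw [h1, h0] at this
    have e1 : ∫ x in Ω, (0 : L2Dom Ω) x * pderivAt i φ x = 0 := by
      apply integral_eq_zero_of_ae
      filter_upwards [Lp.coeFn_zero ℝ 2 (volume.restrict Ω)] with x hx
      rw [hx]; simp
    rw [e1] at this
    linarith
  refine eq_zero_of_test hΩ _ (fun φ k1 k2 k3 => ?_)
  have := h2 _ (test_mem_sobolevH1 hΩ k1 k2 k3)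
  simp only [robinForm, hg, inner_zero_left, inner_zero_right, Finset.sum_const_zero, mul_zero,
    sub_zero] at this
  rw [L2.inner_def] at this
  rw [this]
  apply integral_congr_ae
  filter_upwards [(memLp_test Ω k1.continuous k2).coeFn_toLp] with x hx
  rw [hx]; simp [mul_comm]

lemma robinLaplacian_graph {Ω : Set Plane} (hΩ : IsOpen Ω) (β : ℝ) :
    (robinLaplacian Ω β).graph = robinGraph Ω β :=
  Submodule.toLinearPMap_graph_eq _ (robinGraph_single_valued hΩ β)

end Robin

/-! ### The domain -/

/-- The sector `Σ₁` with opening `ω` and vertex `(-L, 0)`. -/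
def sectorLeft (ω L : ℝ) : Set Plane :=
  {x | Complex.arg (⟨x 0 + L, x 1⟩ : ℂ) ∈ Ioo 0 ω}

/-- The sector `Σ₂`, the reflection of `Σ₁` in the second coordinate axis. -/
def sectorRight (ω L : ℝ) : Set Plane := {x | !₂[-x 0, x 1] ∈ sectorLeft ω L}

/-- `Ω_L = Σ₁ ∩ Σ₂`: a triangle for `ω < π/2`, an infinite biangle for `ω ≥ π/2`. -/
def twoCornerDomain (ω L : ℝ) : Set Plane := sectorLeft ω L ∩ sectorRight ω L

lemma isOpen_twoCornerDomain {ω : ℝ} (hω : ω ≤ π) (L : ℝ) : IsOpen (twoCornerDomain ω L) := by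
  have key : IsOpen {z : ℂ | z.arg ∈ Ioo 0 ω} := by
    rw [isOpen_iff_mem_nhds]
    intro z hz
    have hs : z ∈ Complex.slitPlane :=
      Complex.mem_slitPlane_iff_arg.2 ⟨(hz.2.trans_le hω).ne, fun h => by
        subst h; simp at hz⟩
    exact (Complex.continuousAt_arg hs).preimage_mem_nhds (isOpen_Ioo.mem_nhds hz)
  have c0 : ∀ i : Fin 2, Continuous (fun x : Plane => x i) := fun i =>
    (continuous_apply i).comp (PiLp.continuous_ofLp 2 _)
  have hL : IsOpen (sectorLeft ω L) := by
    have : Continuous (fun x : Plane => (⟨x 0 + L, x 1⟩ : ℂ)) :=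
      Complex.equivRealProdCLM.symm.continuous.comp
        (((c0 0).add continuous_const).prodMk (c0 1))
    exact key.preimage this
  refine hL.inter ?_
  have : Continuous (fun x : Plane => (!₂[-x 0, x 1] : Plane)) := by
    refine (PiLp.continuous_toLp 2 _).comp (continuous_pi fun i => ?_)
    fin_cases i
    · exact (c0 0).neg
    · exact c0 1
  exact hL.preimage this

/-- `H_L = H(Ω_L, β)`. -/
noncomputable def twoCornerRobin (β ω L : ℝ) :
    L2Dom (twoCornerDomain ω L) →ₗ.[ℝ] L2Dom (twoCornerDomain ω L) :=
  robinLaplacian (twoCornerDomain ω L) β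

/-- `E_n(L)`: the `n`-th eigenvalue of `H_L`. -/
noncomputable def twoCornerEigenvalue (β ω : ℝ) (n : ℕ) (L : ℝ) : ℝ :=
  nthEigenvalue (twoCornerRobin β ω L) n

/-- `E_α = -β² / sin² α`. -/
noncomputable def sectorEnergy (β α : ℝ) : ℝ := -(β ^ 2 / sin α ^ 2)

/-! Near each of its two base corners the domain looks like an infinite sector of opening ω. The
Robin Laplacian of that sector has the explicit ground state `cornerState`, an exponential with
energy E_α, and every state orthogonal to it costs more by an amount independent of L. Two distant
corners therefore produce exactly two eigenvalues near E_α. The proof works with quadratic forms on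
test functions and passes to closures, so it needs neither a compact embedding (the domain is
unbounded for ω ≥ π/2) nor the spectral theory of the sector operator.

Lower bound. If a vector field F has normal component β on the boundary, the divergence theorem
rewrites the Robin energy of v as ∫ |∇v - F v|² - ∫ (div F + |F|²) v² (`robinEnergy_eq_of_field`).
At a corner F is constant with |F|² = -E_α, and in sheared coordinates the remaining squares split
into two half-line problems whose first-order factorization gives a gap off the exponential
(`corner_gap`). Away from the corners F interpolates slowly between the bottom and the sides, with
|F|² ≤ ν < -E_α and divergence O(1/L) (`middle_lower`). Only the choice of ν in `exists_field` uses
the restriction on ω: for ω < π/3 the third corner of the triangle has opening π - 2ω > ω and is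
less attractive than the other two; for ω ≥ π/2 there is no third corner. The IMS formula glues the
pieces (`robinEnergy_lower`): up to a penalty in the directions of the two cut-off corner states,
the energy is at least E_α + g - C/L.

Upper bound. The cut-off corner states have energy at most E_α + C/L (`exists_trial_energy_bound`).

Eigenvalues. The reflection in the vertical axis splits the form domain into even and odd parts. In
each part the two penalties reduce to a single rank-one penalty, and then a minimizing sequence has
a convergent subsequence, because only one scalar product is left to control (`exists_minimizer`).
This yields one even and one odd eigenvector, with the form at least E_α + g/2 on their orthogonal
complement, and the spectrum below that level can be read off (`twoLowEigenvalues_of_form`).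

Simplicity. If the odd level were not above the even one, the odd minimizer would minimize over the
whole form domain. Its modulus, restricted to the right half, would then be a nonnegative weak
solution of the eigenvalue equation that vanishes on the left half
(`weak_equation_of_odd_minimizer`), and the strong maximum principle (`null_of_null_ball`) would
make it zero. -/

/-! ### Symmetric forms on closed subspaces -/

section Forms

/-- The inner product of a real space as a bounded bilinear map. -/
noncomputable def realInnerCLM (H : Type*) [NormedAddCommGroup H] [InnerProductSpace ℝ H] :
    H →L[ℝ] H →L[ℝ] ℝ :=
  LinearMap.mkContinuous₂ (innerₗ H) 1 fun x y => by
    rw [one_mul]; exact norm_inner_le_norm x y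

lemma realInnerCLM_apply {H : Type*} [NormedAddCommGroup H] [InnerProductSpace ℝ H] (x y : H) :
    realInnerCLM H x y = ⟪x, y⟫ := rfl

/-- For small t of sign opposite to B the linear term beats the quadratic one. This is the
Euler–Lagrange step of the minimizations below. -/
lemma eq_zero_of_forall_quadratic_nonneg {A B : ℝ} (h : ∀ t : ℝ, 0 ≤ t ^ 2 * A + 2 * t * B) :
    B = 0 := by
  by_contra hB
  have hA : 0 < |A| + 1 := by positivity
  have h1 := h (-B / (|A| + 1))
  have h2 : (-B / (|A| + 1)) ^ 2 * A + 2 * (-B / (|A| + 1)) * B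
      = B ^ 2 / (|A| + 1) ^ 2 * (A - 2 * (|A| + 1)) := by
    field_simp
    ring
  rw [h2] at h1
  have h3 : 0 < B ^ 2 / (|A| + 1) ^ 2 := by positivity
  have h4 : A - 2 * (|A| + 1) < 0 := by linarith [le_abs_self A, abs_nonneg A]
  nlinarith [mul_neg_of_pos_of_neg h3 h4]

variable {X : Type*} [NormedAddCommGroup X] [NormedSpace ℝ X]
  {H : Type*} [NormedAddCommGroup H] [InnerProductSpace ℝ H]

lemma form_add_smul (b : X →L[ℝ] X →L[ℝ] ℝ) (hs : ∀ p q, b p q = b q p) (p q : X) (s t : ℝ) :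
    b (s • p + t • q) (s • p + t • q) = s ^ 2 * b p p + 2 * s * t * b p q + t ^ 2 * b q q := by
  simp only [map_add, map_smul, add_apply, smul_apply,
    smul_eq_mul, hs q p]
  ring

lemma form_sub (b : X →L[ℝ] X →L[ℝ] ℝ) (hs : ∀ p q, b p q = b q p) (p q : X) :
    b (p - q) (p - q) = b p p - 2 * b p q + b q q := by
  have := form_add_smul b hs p q 1 (-1)
  simp only [one_smul, neg_smul, ← sub_eq_add_neg] at this
  rw [this]; ring

lemma form_add (b : X →L[ℝ] X →L[ℝ] ℝ) (hs : ∀ p q, b p q = b q p) (p q : X) :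
    b (p + q) (p + q) = b p p + 2 * b p q + b q q := by
  have := form_add_smul b hs p q 1 1
  simp only [one_smul] at this
  rw [this]; ring

lemma continuous_form (b : X →L[ℝ] X →L[ℝ] ℝ) : Continuous fun p => b p p :=
  b.continuous.clm_apply continuous_id

omit [NormedSpace ℝ X] in
lemma cauchySeq_of_sq_le {c : ℝ} (hc : 0 < c) {p : ℕ → X}
    (h : ∀ ε > 0, ∃ N, ∀ n ≥ N, ∀ m ≥ N, c * ‖p n - p m‖ ^ 2 ≤ ε) : CauchySeq p := by
  refine Metric.cauchySeq_iff.2 fun ε hε => ?_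
  obtain ⟨N, hN⟩ := h (c * (ε / 2) ^ 2) (by positivity)
  refine ⟨N, fun n hn m hm => ?_⟩
  rw [dist_eq_norm]
  have h1 := le_of_mul_le_mul_left (hN n hn m hm) hc
  have := abs_le_of_sq_le_sq' h1 (by positivity)
  linarith [this.2]

/-- A coercive symmetric form represents every functional on a closed subspace. -/
theorem exists_form_representer [CompleteSpace X] (b : X →L[ℝ] X →L[ℝ] ℝ)
    (hs : ∀ p q, b p q = b q p) (W : Submodule ℝ X) (hW : IsClosed (W : Set X)) {c : ℝ}
    (hc : 0 < c) (hb : ∀ p ∈ W, c * ‖p‖ ^ 2 ≤ b p p) (ℓ : X →L[ℝ] ℝ) :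
    ∃ p ∈ W, ∀ q ∈ W, b p q = ℓ q := by
  -- The representer is the minimizer of Q, whose Euler–Lagrange equation is b(p, q) = ℓ(q). Since X
  -- carries no inner product, the direct method replaces Riesz representation.
  set Q : X → ℝ := fun p => b p p - 2 * ℓ p with hQ
  have hQc : Continuous Q := (continuous_form b).sub (continuous_const.mul ℓ.continuous)
  set S := Q '' (W : Set X) with hS
  have hne : S.Nonempty := ⟨Q 0, 0, W.zero_mem, rfl⟩
  have hbd : BddBelow S := by
    refine ⟨-(‖ℓ‖ ^ 2 / c), ?_⟩
    rintro _ ⟨p, hp, rfl⟩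
    have h1 := hb p hp
    have h2 : ℓ p ≤ ‖ℓ‖ * ‖p‖ := (le_abs_self _).trans (ℓ.le_opNorm p)
    have h3 : 0 ≤ (c * ‖p‖ - ‖ℓ‖) ^ 2 / c := by positivity
    have h4 : (c * ‖p‖ - ‖ℓ‖) ^ 2 / c = c * ‖p‖ ^ 2 - 2 * (‖ℓ‖ * ‖p‖) + ‖ℓ‖ ^ 2 / c := by
      field_simp
      ring
    simp only [hQ]
    linarith
  have hseq : ∀ n : ℕ, ∃ p ∈ W, Q p < sInf S + 1 / ((n : ℝ) + 1) := fun n => by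
    obtain ⟨_, ⟨p, hp, rfl⟩, h⟩ := exists_lt_of_csInf_lt hne
      (show sInf S < sInf S + 1 / ((n : ℝ) + 1) by
        have : (0 : ℝ) < 1 / ((n : ℝ) + 1) := by positivity
        linarith)
    exact ⟨p, hp, h⟩
  choose p hpW hpQ using hseq
  -- Parallelogram identity of the form: the midpoint of two almost minimizers cannot lie below the
  -- infimum, so their difference has small energy.
  have hpar : ∀ n m, c * ‖p n - p m‖ ^ 2 ≤ 2 * (1 / ((n : ℝ) + 1)) + 2 * (1 / ((m : ℝ) + 1)) := by
    intro n m
    have h1 := hb _ (W.sub_mem (hpW n) (hpW m))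
    have h2 : sInf S ≤ Q ((1 / 2 : ℝ) • p n + (1 / 2 : ℝ) • p m) :=
      csInf_le hbd ⟨_, W.add_mem (W.smul_mem _ (hpW n)) (W.smul_mem _ (hpW m)), rfl⟩
    have h3 := hpQ n
    have h4 := hpQ m
    simp only [hQ] at h2 h3 h4
    rw [form_add_smul b hs, map_add, map_smul, map_smul, smul_eq_mul, smul_eq_mul] at h2
    rw [form_sub b hs] at h1
    linarith
  have hcau : CauchySeq p := by
    refine cauchySeq_of_sq_le hc fun ε hε => ?_
    obtain ⟨N, hN⟩ := exists_nat_one_div_lt (show 0 < ε / 4 by positivity)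
    refine ⟨N, fun n hn m hm => (hpar n m).trans ?_⟩
    have h1 := one_div_le_one_div_of_le (show (0 : ℝ) < N + 1 by positivity)
      (show (N : ℝ) + 1 ≤ n + 1 by gcongr)
    have h2 := one_div_le_one_div_of_le (show (0 : ℝ) < N + 1 by positivity)
      (show (N : ℝ) + 1 ≤ m + 1 by gcongr)
    linarith
  obtain ⟨x, hx⟩ := cauchySeq_tendsto_of_complete hcau
  have hxW : x ∈ W := hW.mem_of_tendsto hx (Eventually.of_forall hpW)
  have hmin : Q x ≤ sInf S := by
    have h1 : Tendsto (fun n : ℕ => sInf S + 1 / ((n : ℝ) + 1)) atTop (𝓝 (sInf S + 0)) :=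
      tendsto_const_nhds.add tendsto_one_div_add_atTop_nhds_zero_nat
    rw [add_zero] at h1
    exact le_of_tendsto_of_tendsto' ((hQc.tendsto x).comp hx) h1 fun n => (hpQ n).le
  refine ⟨x, hxW, fun q hq => ?_⟩
  have : b x q - ℓ q = 0 := by
    refine eq_zero_of_forall_quadratic_nonneg (A := b q q) fun t => ?_
    have h1 : sInf S ≤ Q ((1 : ℝ) • x + t • q) :=
      csInf_le hbd ⟨_, W.add_mem (W.smul_mem _ hxW) (W.smul_mem _ hq), rfl⟩
    simp only [hQ] at h1 hmin
    rw [form_add_smul b hs, map_add, map_smul, map_smul, smul_eq_mul, smul_eq_mul] at h1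
    linarith
  linarith

/-- If a symmetric nonnegative form vanishes on `e`, then `e` is in its kernel. -/
lemma form_eq_of_minimal (a : X →L[ℝ] X →L[ℝ] ℝ) (hs : ∀ p q, a p q = a q p) (J : X →L[ℝ] H)
    (W : Submodule ℝ X) {lam : ℝ} (hmin : ∀ p ∈ W, lam * ‖J p‖ ^ 2 ≤ a p p) {e : X} (he : e ∈ W)
    (hle : a e e ≤ lam * ‖J e‖ ^ 2) : ∀ q ∈ W, a e q = lam * ⟪J e, J q⟫ := by
  intro q hq
  have : a e q - lam * ⟪J e, J q⟫ = 0 := by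
    refine eq_zero_of_forall_quadratic_nonneg (A := a q q - lam * ‖J q‖ ^ 2) fun t => ?_
    have h1 := hmin ((1 : ℝ) • e + t • q) (W.add_mem (W.smul_mem _ he) (W.smul_mem _ hq))
    rw [form_add_smul a hs, map_add, map_smul, map_smul, norm_add_sq_real, norm_smul, norm_smul,
      real_inner_smul_left, real_inner_smul_right, mul_pow, mul_pow, Real.norm_eq_abs,
      Real.norm_eq_abs, sq_abs, sq_abs] at h1
    linarith
  linarith

/-- A symmetric coercive form which is at least `μ` up to one direction, and takes a value
below `μ`, has a minimizer on a closed subspace, and is at least `μ` on its complement. -/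
theorem exists_minimizer [CompleteSpace X] (a : X →L[ℝ] X →L[ℝ] ℝ) (hs : ∀ p q, a p q = a q p)
    (J : X →L[ℝ] H) (W : Submodule ℝ X) (hW : IsClosed (W : Set X)) (ψ : H) {c C D μ : ℝ}
    (hc : 0 < c) (hD : 0 ≤ D) (hcoer : ∀ p ∈ W, c * ‖p‖ ^ 2 ≤ a p p + C * ‖J p‖ ^ 2)
    (hgap : ∀ p ∈ W, μ * ‖J p‖ ^ 2 - D * ⟪J p, ψ⟫ ^ 2 ≤ a p p)
    (hex : ∃ p ∈ W, a p p < μ * ‖J p‖ ^ 2) :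
    ∃ e ∈ W, ∃ lam < μ, ‖J e‖ = 1 ∧ (∀ q ∈ W, a e q = lam * ⟪J e, J q⟫) ∧
      (∀ p ∈ W, lam * ‖J p‖ ^ 2 ≤ a p p) ∧
      ∀ p ∈ W, ⟪J p, J e⟫ = 0 → μ * ‖J p‖ ^ 2 ≤ a p p := by
  set S : Set ℝ := {r | ∃ p ∈ W, ‖J p‖ = 1 ∧ a p p = r} with hS
  have hscale : ∀ (p : X) (t : ℝ), a (t • p) (t • p) = t ^ 2 * a p p := fun p t => by
    simp only [map_smul, smul_apply, smul_eq_mul]; ring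
  have hnorm : ∀ p ∈ W, J p ≠ 0 → ‖J p‖⁻¹ ^ 2 * a p p ∈ S := fun p hp h0 => by
    refine ⟨‖J p‖⁻¹ • p, W.smul_mem _ hp, ?_, hscale _ _⟩
    rw [map_smul, norm_smul, norm_inv, norm_norm, inv_mul_cancel₀ (norm_ne_zero_iff.2 h0)]
  obtain ⟨p₀, hp₀, hp₀μ⟩ := hex
  have hJp₀ : J p₀ ≠ 0 := fun h0 => by
    have := hcoer p₀ hp₀
    rw [h0, norm_zero] at this hp₀μ
    nlinarith [sq_nonneg ‖p₀‖]
  have hne : S.Nonempty := ⟨_, hnorm p₀ hp₀ hJp₀⟩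
  have hbd : BddBelow S := by
    refine ⟨-C, ?_⟩
    rintro _ ⟨p, hp, h1, rfl⟩
    have := hcoer p hp
    rw [h1] at this
    nlinarith [sq_nonneg ‖p‖]
  set lam := sInf S with hlam
  have hmin : ∀ p ∈ W, lam * ‖J p‖ ^ 2 ≤ a p p := by
    intro p hp
    by_cases h0 : J p = 0
    · have := hcoer p hp
      rw [h0, norm_zero] at this ⊢
      nlinarith [sq_nonneg ‖p‖]
    · have h1 := csInf_le hbd (hnorm p hp h0)
      have h2 : 0 < ‖J p‖ := norm_pos_iff.2 h0
      rw [inv_pow, inv_mul_eq_div, le_div_iff₀ (by positivity)] at h1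
      exact h1
  have hlt : lam < μ := by
    have h2 : 0 < ‖J p₀‖ := norm_pos_iff.2 hJp₀
    have := hmin p₀ hp₀
    nlinarith [sq_pos_of_pos h2]
  have hseq : ∀ n : ℕ, ∃ p ∈ W, ‖J p‖ = 1 ∧ a p p < lam + 1 / ((n : ℝ) + 1) := fun n => by
    obtain ⟨_, ⟨p, hp, h1, rfl⟩, h⟩ := exists_lt_of_csInf_lt hne
      (show sInf S < lam + 1 / ((n : ℝ) + 1) by
        have : (0 : ℝ) < 1 / ((n : ℝ) + 1) := by positivity
        linarith)
    exact ⟨p, hp, h1, h⟩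
  choose p hpW hp1 hpa using hseq
  -- `J` is not compact. The gap estimate fails only in the direction ψ, so it is enough to make
  -- this one bounded scalar converge along a subsequence.
  have hsmem : ∀ n, ⟪J (p n), ψ⟫ ∈ Icc (-‖ψ‖) ‖ψ‖ := fun n => by
    have := abs_real_inner_le_norm (J (p n)) ψ
    rw [hp1, one_mul] at this
    exact abs_le.1 this
  obtain ⟨s, -, k, hk, hks⟩ := isCompact_Icc.tendsto_subseq hsmem
  have hcau' : CauchySeq ((fun n => ⟪J (p n), ψ⟫) ∘ k) := hks.cauchySeq
  have hk_le : ∀ n, n ≤ k n := hk.id_le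
  -- M trades the term (lam + C)‖J d‖² left over by coercivity for the quantity (μ - lam)‖J d‖² that
  -- the gap controls.
  set M := (|lam| + |C|) / (μ - lam) with hM
  have hM0 : 0 ≤ M := div_nonneg (by positivity) (by linarith)
  -- The parallelogram law bounds a(d, d) - lam ‖J d‖² for the difference d of two almost
  -- minimizers. The gap turns this into a bound on ‖J d‖² up to the ψ-component of d, and
  -- coercivity then bounds ‖d‖².
  have hest : ∀ n m, c * ‖p (k n) - p (k m)‖ ^ 2 ≤
      (1 + M) * (2 * (1 / ((n : ℝ) + 1)) + 2 * (1 / ((m : ℝ) + 1))) +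
        M * D * (⟪J (p (k n)), ψ⟫ - ⟪J (p (k m)), ψ⟫) ^ 2 := by
    intro n m
    have hdW := W.sub_mem (hpW (k n)) (hpW (k m))
    set d := p (k n) - p (k m) with hd
    have hk1 : ∀ n, a (p (k n)) (p (k n)) ≤ lam + 1 / ((n : ℝ) + 1) := fun n => by
      have h1 := (hpa (k n)).le
      have h2 := one_div_le_one_div_of_le (show (0 : ℝ) < n + 1 by positivity)
        (show (n : ℝ) + 1 ≤ k n + 1 by gcongr; exact hk_le n)
      linarith
    have h1 := hcoer d hdW
    have h2 := hgap d hdW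
    have h3 := hmin _ (W.add_mem (hpW (k n)) (hpW (k m)))
    have h4 := form_add a hs (p (k n)) (p (k m))
    have h5 := form_sub a hs (p (k n)) (p (k m))
    have h6 : ‖J (p (k n) + p (k m))‖ ^ 2 + ‖J d‖ ^ 2 = 4 := by
      have := parallelogram_law_with_norm ℝ (J (p (k n))) (J (p (k m)))
      rw [hp1, hp1] at this
      rw [hd, map_add, map_sub]
      nlinarith
    have h7 : ⟪J d, ψ⟫ = ⟪J (p (k n)), ψ⟫ - ⟪J (p (k m)), ψ⟫ := by
      rw [hd, map_sub, inner_sub_left]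
    rw [← h7]
    have h8 : a d d - lam * ‖J d‖ ^ 2 ≤ 2 * (1 / ((n : ℝ) + 1)) + 2 * (1 / ((m : ℝ) + 1)) := by
      have := hk1 n
      have := hk1 m
      have : lam * ‖J (p (k n) + p (k m))‖ ^ 2 + lam * ‖J d‖ ^ 2 = lam * 4 := by
        rw [← h6]; ring
      linarith
    set ε := 2 * (1 / ((n : ℝ) + 1)) + 2 * (1 / ((m : ℝ) + 1)) with hε
    have h9 : (μ - lam) * ‖J d‖ ^ 2 ≤ ε + D * ⟪J d, ψ⟫ ^ 2 := by linarith
    have h10 : (|lam| + |C|) * ‖J d‖ ^ 2 ≤ M * (ε + D * ⟪J d, ψ⟫ ^ 2) := by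
      have : (|lam| + |C|) * ‖J d‖ ^ 2 = M * ((μ - lam) * ‖J d‖ ^ 2) := by
        rw [hM]
        field_simp [show μ - lam ≠ 0 by linarith]
      rw [this]
      exact mul_le_mul_of_nonneg_left h9 hM0
    have h11 : (lam + C) * ‖J d‖ ^ 2 ≤ (|lam| + |C|) * ‖J d‖ ^ 2 :=
      mul_le_mul_of_nonneg_right (add_le_add (le_abs_self _) (le_abs_self _)) (sq_nonneg _)
    nlinarith
  have hcau : CauchySeq (p ∘ k) := by
    refine cauchySeq_of_sq_le hc fun ε hε => ?_
    obtain ⟨N₁, hN₁⟩ := exists_nat_one_div_lt (show 0 < ε / (8 * (1 + M)) by positivity)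
    obtain ⟨N₂, hN₂⟩ := Metric.cauchySeq_iff.1 hcau' (√(ε / (2 * (M * D + 1)))) (by positivity)
    refine ⟨max N₁ N₂, fun n hn m hm => (hest n m).trans ?_⟩
    have hb : ∀ n : ℕ, max N₁ N₂ ≤ n → 1 / ((n : ℝ) + 1) ≤ ε / (8 * (1 + M)) := fun n hn => by
      have h1 := one_div_le_one_div_of_le (show (0 : ℝ) < N₁ + 1 by positivity)
        (show (N₁ : ℝ) + 1 ≤ n + 1 by gcongr; exact (le_max_left _ _).trans hn)
      linarith
    have h1 := hb n hn
    have h2 := hb m hm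
    have h3 := hN₂ n ((le_max_right _ _).trans hn) m ((le_max_right _ _).trans hm)
    rw [Real.dist_eq] at h3
    have h4 : (⟪J (p (k n)), ψ⟫ - ⟪J (p (k m)), ψ⟫) ^ 2 ≤ ε / (2 * (M * D + 1)) := by
      rw [← sq_abs]
      exact (Real.lt_sqrt (abs_nonneg _)).1 h3 |>.le
    have h5 : (1 + M) * (2 * (1 / ((n : ℝ) + 1)) + 2 * (1 / ((m : ℝ) + 1)))
        ≤ (1 + M) * (4 * (ε / (8 * (1 + M)))) := by
      apply mul_le_mul_of_nonneg_left _ (by positivity)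
      linarith
    have h6 : (1 + M) * (4 * (ε / (8 * (1 + M)))) = ε / 2 := by field_simp; norm_num
    have h7 : M * D * (⟪J (p (k n)), ψ⟫ - ⟪J (p (k m)), ψ⟫) ^ 2
        ≤ (M * D + 1) * (ε / (2 * (M * D + 1))) := by
      apply mul_le_mul (by linarith) h4 (sq_nonneg _) (by positivity)
    have h8 : (M * D + 1) * (ε / (2 * (M * D + 1))) = ε / 2 := by
      have : M * D + 1 ≠ 0 := by positivity
      field_simp
    linarith
  obtain ⟨e, he⟩ := cauchySeq_tendsto_of_complete hcau
  have heW : e ∈ W := hW.mem_of_tendsto he (Eventually.of_forall fun n => hpW (k n))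
  have he1 : ‖J e‖ = 1 := by
    refine tendsto_nhds_unique ((J.continuous.norm.tendsto e).comp he) ?_
    simp only [Function.comp_def, hp1]
    exact tendsto_const_nhds
  have hea : a e e ≤ lam * ‖J e‖ ^ 2 := by
    have h1 : Tendsto (fun n : ℕ => lam + 1 / ((n : ℝ) + 1)) atTop (𝓝 (lam + 0)) :=
      tendsto_const_nhds.add tendsto_one_div_add_atTop_nhds_zero_nat
    rw [he1, one_pow, mul_one]
    rw [add_zero] at h1
    exact le_of_tendsto_of_tendsto' (((continuous_form a).tendsto e).comp he)
      (h1.comp hk.tendsto_atTop) fun n => (hpa (k n)).le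
  have heig := form_eq_of_minimal a hs J W hmin heW hea
  refine ⟨e, heW, lam, hlt, he1, heig, hmin, fun q hq hqe => ?_⟩
  have hee : a e e = lam := by rw [heig e heW, real_inner_self_eq_norm_sq, he1]; ring
  have hqe' : ⟪J e, J q⟫ = 0 := by rw [real_inner_comm, hqe]
  have heq : a e q = 0 := by rw [heig q hq, hqe', mul_zero]
  -- This combination is orthogonal to ψ, so the gap applies without penalty. The form and the norm
  -- are both diagonal in e and q, and the e-part lies below the level μ, so q alone must reach it.
  have h1 := hgap (⟪J q, ψ⟫ • e + (-⟪J e, ψ⟫) • q)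
    (W.add_mem (W.smul_mem _ heW) (W.smul_mem _ hq))
  have h2 : ⟪J (⟪J q, ψ⟫ • e + (-⟪J e, ψ⟫) • q), ψ⟫ = 0 := by
    rw [map_add, map_smul, map_smul, inner_add_left, real_inner_smul_left, real_inner_smul_left]
    ring
  have h3 : ‖J (⟪J q, ψ⟫ • e + (-⟪J e, ψ⟫) • q)‖ ^ 2
      = ⟪J q, ψ⟫ ^ 2 + ⟪J e, ψ⟫ ^ 2 * ‖J q‖ ^ 2 := by
    rw [map_add, map_smul, map_smul, norm_add_sq_real, norm_smul, norm_smul,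
      real_inner_smul_left, real_inner_smul_right, hqe', he1, mul_pow, mul_pow,
      Real.norm_eq_abs, Real.norm_eq_abs, sq_abs, sq_abs]
    ring
  rw [h2, h3, form_add_smul a hs, hee, heq] at h1
  -- If e were orthogonal to ψ, the gap at e would read μ ≤ lam.
  have ht : 0 < ⟪J e, ψ⟫ ^ 2 := by
    rcases eq_or_ne ⟪J e, ψ⟫ 0 with h | h
    · have := hgap e heW
      rw [h, hee, he1] at this
      linarith
    · positivity
  have h4 : ⟪J e, ψ⟫ ^ 2 * (μ * ‖J q‖ ^ 2) ≤ ⟪J e, ψ⟫ ^ 2 * a q q := by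
    nlinarith [mul_nonneg (sub_nonneg.2 hlt.le) (sq_nonneg ⟪J q, ψ⟫)]
  exact le_of_mul_le_mul_left h4 ht

end Forms

/-! ### Operators with exactly two simple eigenvalues below a threshold -/

section LowSpectrum

variable {H : Type*} [NormedAddCommGroup H] [InnerProductSpace ℝ H]

/-- Below `μ` the operator `A` is diagonal in `u₁, u₂` with eigenvalues `l₁ < l₂ < μ`. -/
structure TwoLowEigenvalues (A : H →ₗ.[ℝ] H) (μ l₁ l₂ : ℝ) (u₁ u₂ : H) : Prop where
  lt₁₂ : l₁ < l₂
  lt₂ : l₂ < μ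
  norm₁ : ‖u₁‖ = 1
  norm₂ : ‖u₂‖ = 1
  ortho : ⟪u₁, u₂⟫ = 0
  mem₁ : (u₁, l₁ • u₁) ∈ A.graph
  mem₂ : (u₂, l₂ • u₂) ∈ A.graph
  symm₁ : ∀ u f, (u, f) ∈ A.graph → ⟪f, u₁⟫ = l₁ * ⟪u, u₁⟫
  symm₂ : ∀ u f, (u, f) ∈ A.graph → ⟪f, u₂⟫ = l₂ * ⟪u, u₂⟫
  lower : ∀ u f, (u, f) ∈ A.graph → ⟪u, u₁⟫ = 0 → ⟪u, u₂⟫ = 0 → μ * ‖u‖ ^ 2 ≤ ⟪f, u⟫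
  solve : ∀ z < μ, ∀ f, ⟪f, u₁⟫ = 0 → ⟪f, u₂⟫ = 0 → ∃ u, (u, f + z • u) ∈ A.graph

variable {A : H →ₗ.[ℝ] H} {μ l₁ l₂ : ℝ} {u₁ u₂ : H}

lemma mem_opEigenspace_iff {z : ℝ} {u : H} : u ∈ opEigenspace A z ↔ (u, z • u) ∈ A.graph := by
  rw [opEigenspace, Submodule.mem_map, LinearPMap.mem_graph_iff]
  constructor
  · rintro ⟨x, hx, rfl⟩
    refine ⟨x, rfl, ?_⟩
    have : A.toFun x - z • (x : H) = 0 := hx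
    exact sub_eq_zero.1 this
  · rintro ⟨x, hx, h⟩
    refine ⟨x, ?_, hx⟩
    change A.toFun x - z • (x : H) = 0
    have h2 : (x : H) = u := hx
    have h3 : A x = z • u := h
    rw [sub_eq_zero, h2, ← h3]
    rfl

namespace TwoLowEigenvalues

variable (h : TwoLowEigenvalues A μ l₁ l₂ u₁ u₂)
include h

lemma lt₁ : l₁ < μ := h.lt₁₂.trans h.lt₂

/-- Resolvent estimate, one spectral component at a time. Symmetry pairs f - z u with each
eigenvector; for the remaining component v, pairing with v and applying `lower` bounds (μ - z)‖v‖²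
by ‖f - z u‖‖v‖. -/
lemma graph_bound {z : ℝ} {u f : H} (hu : (u, f) ∈ A.graph) :
    (μ - z) * ‖u - ⟪u, u₁⟫ • u₁ - ⟪u, u₂⟫ • u₂‖ ≤ ‖f - z • u‖ ∧
      (l₁ - z) * ⟪u, u₁⟫ = ⟪f - z • u, u₁⟫ ∧ (l₂ - z) * ⟪u, u₂⟫ = ⟪f - z • u, u₂⟫ := by
  have i1 : ⟪u₁, u₁⟫ = 1 := by rw [real_inner_self_eq_norm_sq, h.norm₁]; norm_num
  have i2 : ⟪u₂, u₂⟫ = 1 := by rw [real_inner_self_eq_norm_sq, h.norm₂]; norm_num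
  have i3 : ⟪u₂, u₁⟫ = 0 := by rw [real_inner_comm, h.ortho]
  have hmem : (u - ⟪u, u₁⟫ • u₁ - ⟪u, u₂⟫ • u₂,
      f - ⟪u, u₁⟫ • (l₁ • u₁) - ⟪u, u₂⟫ • (l₂ • u₂)) ∈ A.graph :=
    A.graph.sub_mem (A.graph.sub_mem hu (A.graph.smul_mem ⟪u, u₁⟫ h.mem₁))
      (A.graph.smul_mem ⟪u, u₂⟫ h.mem₂)
  have s1 := h.symm₁ u f hu
  have s2 := h.symm₂ u f hu
  have o1 : ⟪u - ⟪u, u₁⟫ • u₁ - ⟪u, u₂⟫ • u₂, u₁⟫ = 0 := by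
    simp only [inner_sub_left, real_inner_smul_left, i1, i3]; ring
  have o2 : ⟪u - ⟪u, u₁⟫ • u₁ - ⟪u, u₂⟫ • u₂, u₂⟫ = 0 := by
    simp only [inner_sub_left, real_inner_smul_left, i2, h.ortho]; ring
  refine ⟨?_, ?_, ?_⟩
  · have hl := h.lower _ _ hmem o1 o2
    set v := u - ⟪u, u₁⟫ • u₁ - ⟪u, u₂⟫ • u₂ with hv
    have e0 : ⟪u₁, v⟫ = 0 := by rw [real_inner_comm, o1]
    have e0' : ⟪u₂, v⟫ = 0 := by rw [real_inner_comm, o2]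
    have e1 : ⟪f - ⟪u, u₁⟫ • (l₁ • u₁) - ⟪u, u₂⟫ • (l₂ • u₂), v⟫ = ⟪f, v⟫ := by
      simp only [inner_sub_left, real_inner_smul_left, e0, e0']; ring
    have e2 : ⟪u, v⟫ = ‖v‖ ^ 2 := by
      have : ⟪v, v⟫ = ⟪u, v⟫ := by
        nth_rewrite 1 [hv]
        simp only [inner_sub_left, real_inner_smul_left, e0, e0']; ring
      rw [← this, real_inner_self_eq_norm_sq]
    have e3 : (μ - z) * ‖v‖ ^ 2 ≤ ⟪f - z • u, v⟫ := by
      rw [inner_sub_left, real_inner_smul_left, e2, ← e1]; linarith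
    have e4 := (e3.trans (real_inner_le_norm _ _))
    rcases eq_or_ne ‖v‖ 0 with h0 | h0
    · rw [h0, mul_zero]; positivity
    · have : 0 < ‖v‖ := lt_of_le_of_ne (norm_nonneg _) h0.symm
      refine le_of_mul_le_mul_right ?_ this
      linarith
  · rw [inner_sub_left, real_inner_smul_left, s1]; ring
  · rw [inner_sub_left, real_inner_smul_left, s2]; ring

/-- The equation is solved by `solve` on the orthogonal complement of the two eigenvectors and by
division by l₁ - z and l₂ - z along them. The bound on the inverse is the sum of the three bounds
from `graph_bound`. -/
lemma isResolventPoint {z : ℝ} (hz : z < μ) (h1 : z ≠ l₁) (h2 : z ≠ l₂) :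
    IsResolventPoint A z := by
  have i1 : ⟪u₁, u₁⟫ = 1 := by rw [real_inner_self_eq_norm_sq, h.norm₁]; norm_num
  have i2 : ⟪u₂, u₂⟫ = 1 := by rw [real_inner_self_eq_norm_sq, h.norm₂]; norm_num
  have i3 : ⟪u₂, u₁⟫ = 0 := by rw [real_inner_comm, h.ortho]
  have d1 : l₁ - z ≠ 0 := sub_ne_zero.2 h1.symm
  have d2 : l₂ - z ≠ 0 := sub_ne_zero.2 h2.symm
  constructor
  · intro f
    obtain ⟨v, hv⟩ := h.solve z hz (f - ⟪f, u₁⟫ • u₁ - ⟪f, u₂⟫ • u₂)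
      (by simp only [inner_sub_left, real_inner_smul_left, i1, i3]; ring)
      (by simp only [inner_sub_left, real_inner_smul_left, i2, h.ortho]; ring)
    have hmem := A.graph.add_mem (A.graph.add_mem hv
      (A.graph.smul_mem (⟪f, u₁⟫ / (l₁ - z)) h.mem₁)) (A.graph.smul_mem (⟪f, u₂⟫ / (l₂ - z)) h.mem₂)
    obtain ⟨x, hx, hx'⟩ := A.mem_graph_iff.1 hmem
    refine ⟨x, ?_⟩
    rw [hx', hx]
    simp only [Prod.fst_add, Prod.snd_add, Prod.smul_mk, smul_add, smul_smul]
    have k1 : (⟪f, u₁⟫ / (l₁ - z)) * l₁ = ⟪f, u₁⟫ + z * (⟪f, u₁⟫ / (l₁ - z)) := by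
      field_simp; ring
    have k2 : (⟪f, u₂⟫ / (l₂ - z)) * l₂ = ⟪f, u₂⟫ + z * (⟪f, u₂⟫ / (l₂ - z)) := by
      field_simp; ring
    rw [k1, k2]
    module
  · refine ⟨1 / (μ - z) + 1 / |l₁ - z| + 1 / |l₂ - z|, fun u => ?_⟩
    obtain ⟨b1, b2, b3⟩ := h.graph_bound (A.mem_graph u)
    set F := ‖A u - z • (u : H)‖ with hF
    have c1 : ‖(u : H) - ⟪(u : H), u₁⟫ • u₁ - ⟪(u : H), u₂⟫ • u₂‖ ≤ 1 / (μ - z) * F := by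
      rw [one_div_mul_eq_div, le_div_iff₀ (by linarith), mul_comm]; exact b1
    have gen : ∀ (l : ℝ) (w : H), l - z ≠ 0 → ‖w‖ = 1 →
        (l - z) * ⟪(u : H), w⟫ = ⟪A u - z • (u : H), w⟫ → ‖⟪(u : H), w⟫ • w‖ ≤ 1 / |l - z| * F := by
      intro l w hl hw he
      rw [norm_smul, hw, mul_one, Real.norm_eq_abs, one_div_mul_eq_div,
        le_div_iff₀ (abs_pos.2 hl), ← abs_mul, mul_comm, he]
      have := abs_real_inner_le_norm (A u - z • (u : H)) w
      rwa [hw, mul_one] at this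
    have c2 := gen l₁ u₁ d1 h.norm₁ b2
    have c3 := gen l₂ u₂ d2 h.norm₂ b3
    calc ‖(u : H)‖ = ‖((u : H) - ⟪(u : H), u₁⟫ • u₁ - ⟪(u : H), u₂⟫ • u₂) + ⟪(u : H), u₁⟫ • u₁
          + ⟪(u : H), u₂⟫ • u₂‖ := by congr 1; abel
      _ ≤ _ := norm_add₃_le
      _ ≤ _ := by rw [add_mul, add_mul]; linarith

/-- At z = l₁ the right-hand sides in `graph_bound` vanish, which kills every component except the
one along u₁. -/
lemma eigenspace₁ : opEigenspace A l₁ = Submodule.span ℝ {u₁} := by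
  refine le_antisymm (fun u hu => ?_) ?_
  · obtain ⟨b1, -, b3⟩ := h.graph_bound (z := l₁) (mem_opEigenspace_iff.1 hu)
    rw [sub_self, norm_zero] at b1
    rw [sub_self, inner_zero_left] at b3
    have e2 : ⟪u, u₂⟫ = 0 := by
      rcases mul_eq_zero.1 b3 with h0 | h0
      · linarith [h.lt₁₂]
      · exact h0
    have e1 : ‖u - ⟪u, u₁⟫ • u₁ - ⟪u, u₂⟫ • u₂‖ = 0 :=
      le_antisymm (by nlinarith [h.lt₁, norm_nonneg (u - ⟪u, u₁⟫ • u₁ - ⟪u, u₂⟫ • u₂)])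
        (norm_nonneg _)
    rw [norm_eq_zero, e2, zero_smul, sub_zero, sub_eq_zero] at e1
    rw [e1]
    exact Submodule.smul_mem _ _ (Submodule.mem_span_singleton_self _)
  · rw [Submodule.span_singleton_le_iff_mem]
    exact mem_opEigenspace_iff.2 h.mem₁

lemma eigenspace₂ : opEigenspace A l₂ = Submodule.span ℝ {u₂} := by
  refine le_antisymm (fun u hu => ?_) ?_
  · obtain ⟨b1, b3, -⟩ := h.graph_bound (z := l₂) (mem_opEigenspace_iff.1 hu)
    rw [sub_self, norm_zero] at b1
    rw [sub_self, inner_zero_left] at b3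
    have e2 : ⟪u, u₁⟫ = 0 := by
      rcases mul_eq_zero.1 b3 with h0 | h0
      · linarith [h.lt₁₂]
      · exact h0
    have e1 : ‖u - ⟪u, u₁⟫ • u₁ - ⟪u, u₂⟫ • u₂‖ = 0 :=
      le_antisymm (by nlinarith [h.lt₂, norm_nonneg (u - ⟪u, u₁⟫ • u₁ - ⟪u, u₂⟫ • u₂)])
        (norm_nonneg _)
    rw [norm_eq_zero, e2, zero_smul, sub_zero, sub_eq_zero] at e1
    rw [e1]
    exact Submodule.smul_mem _ _ (Submodule.mem_span_singleton_self _)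
  · rw [Submodule.span_singleton_le_iff_mem]
    exact mem_opEigenspace_iff.2 h.mem₂

lemma eigenspace_eq_bot {z : ℝ} (hz : z < μ) (h1 : z ≠ l₁) (h2 : z ≠ l₂) :
    opEigenspace A z = ⊥ := by
  refine (Submodule.eq_bot_iff _).2 fun u hu => ?_
  obtain ⟨x, hx, hx'⟩ := A.mem_graph_iff.1 (mem_opEigenspace_iff.1 hu)
  obtain ⟨-, C, hC⟩ := h.isResolventPoint hz h1 h2
  have hxu : (x : H) = u := hx
  have hAx : A x = z • u := hx'
  have := hC x
  rw [hxu, hAx, sub_self, norm_zero, mul_zero] at this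
  exact norm_le_zero_iff.1 this

lemma ne_zero₁ : u₁ ≠ 0 := fun h0 => by have := h.norm₁; rw [h0, norm_zero] at this; norm_num at this

lemma ne_zero₂ : u₂ ≠ 0 := fun h0 => by have := h.norm₂; rw [h0, norm_zero] at this; norm_num at this

lemma isOpEigenvalue₁ : IsOpEigenvalue A l₁ := by
  rw [IsOpEigenvalue, h.eigenspace₁, Ne, Submodule.span_singleton_eq_bot]
  exact h.ne_zero₁

lemma isOpEigenvalue₂ : IsOpEigenvalue A l₂ := by
  rw [IsOpEigenvalue, h.eigenspace₂, Ne, Submodule.span_singleton_eq_bot]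
  exact h.ne_zero₂

lemma finrank₁ : Module.finrank ℝ (opEigenspace A l₁) = 1 := by
  rw [h.eigenspace₁]; exact finrank_span_singleton h.ne_zero₁

lemma finrank₂ : Module.finrank ℝ (opEigenspace A l₂) = 1 := by
  rw [h.eigenspace₂]; exact finrank_span_singleton h.ne_zero₂

omit h in
lemma mem_spectrum_of_eigenvalue {z : ℝ} (hz : IsOpEigenvalue A z) : z ∈ opSpectrum A := by
  rintro ⟨-, C, hC⟩
  obtain ⟨u, hu, hu0⟩ := (Submodule.ne_bot_iff _).1 hz
  obtain ⟨x, hx, hx'⟩ := A.mem_graph_iff.1 (mem_opEigenspace_iff.1 hu)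
  have hxu : (x : H) = u := hx
  have hAx : A x = z • u := hx'
  have := hC x
  rw [hxu, hAx, sub_self, norm_zero, mul_zero] at this
  exact hu0 (norm_le_zero_iff.1 this)

lemma spectrum_inter : opSpectrum A ∩ Iio μ = {l₁, l₂} := by
  ext z
  simp only [mem_inter_iff, mem_Iio, mem_insert_iff, mem_singleton_iff]
  constructor
  · rintro ⟨h1, h2⟩
    by_contra! h3
    exact h1 (h.isResolventPoint h2 h3.1 h3.2)
  · rintro (rfl | rfl)
    · exact ⟨mem_spectrum_of_eigenvalue h.isOpEigenvalue₁, h.lt₁⟩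
    · exact ⟨mem_spectrum_of_eigenvalue h.isOpEigenvalue₂, h.lt₂⟩

/-- The only spectral points below μ are l₁ and l₂. Both are isolated and have one-dimensional
eigenspaces, hence belong to the discrete spectrum. -/
lemma le_of_mem_essentialSpectrum {z : ℝ} (hz : z ∈ essentialSpectrum A) : μ ≤ z := by
  by_contra! hlt
  have hz' : z ∈ ({l₁, l₂} : Set ℝ) := h.spectrum_inter ▸ ⟨hz.1, hlt⟩
  refine hz.2 ⟨?_, ?_, ?_⟩
  · have hmem : ∀ y, y ∈ opSpectrum A → y < μ → y = l₁ ∨ y = l₂ := fun y h1 h2 => by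
      have : y ∈ ({l₁, l₂} : Set ℝ) := h.spectrum_inter ▸ ⟨h1, h2⟩
      simpa using this
    have := h.lt₁₂
    have := h.lt₂
    rcases hz' with rfl | rfl
    · refine ⟨l₂ - z, by linarith, Subset.antisymm ?_ (singleton_subset_iff.2 ?_)⟩
      · rintro y ⟨y1, y2, y3⟩
        rcases hmem y y1 (by linarith) with e | e
        · exact e
        · linarith
      · exact ⟨hz.1, by linarith, by linarith⟩
    · refine ⟨min (z - l₁) (μ - z), lt_min (by linarith) (by linarith),
        Subset.antisymm ?_ (singleton_subset_iff.2 ?_)⟩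
      · rintro y ⟨y1, y2, y3⟩
        have := min_le_left (z - l₁) (μ - z)
        have := min_le_right (z - l₁) (μ - z)
        rcases hmem y y1 (by linarith) with e | e
        · linarith
        · exact e
      · have : 0 < min (z - l₁) (μ - z) := lt_min (by linarith) (by linarith)
        exact ⟨hz.1, by linarith, by linarith⟩
  · rcases hz' with rfl | rfl
    · exact h.isOpEigenvalue₁
    · exact h.isOpEigenvalue₂
  · rcases hz' with rfl | rfl
    · rw [h.eigenspace₁]; infer_instance
    · rw [h.eigenspace₂]; infer_instance

lemma iSup_eigenspace_le {t : ℝ} (ht : t < l₂) :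
    (⨆ z ∈ Iic t, opEigenspace A z) ≤ Submodule.span ℝ {u₁} := by
  refine iSup₂_le fun z hz => ?_
  have hz' : z ≤ t := hz
  by_cases h1 : z = l₁
  · rw [h1, h.eigenspace₁]
  · rw [h.eigenspace_eq_bot (by linarith [h.lt₂]) h1 (by linarith)]
    exact bot_le

/-- The counted multiplicity is zero for t < l₁ and at least one from l₁ on, so the defining set is
a closed half-line. For the second eigenvalue the same happens at l₂. -/
lemma nthEigenvalue_one : nthEigenvalue A 1 = l₁ := by
  have : {t : ℝ | ((1 : ℕ) : Cardinal) ≤ Module.rank ℝ ↥(⨆ z ∈ Iic t, opEigenspace A z)}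
      = Ici l₁ := by
    ext t
    simp only [mem_ofPred_eq, mem_Ici]
    constructor
    · intro ht
      by_contra! hlt
      have hbot : (⨆ z ∈ Iic t, opEigenspace A z) = ⊥ := by
        refine iSup₂_eq_bot.2 fun z hz => ?_
        have hz' : z ≤ t := hz
        exact h.eigenspace_eq_bot (by linarith [h.lt₁]) (by linarith) (by linarith [h.lt₁₂])
      rw [hbot, rank_bot] at ht
      norm_num at ht
    · intro ht
      have hle : Submodule.span ℝ {u₁} ≤ ⨆ z ∈ Iic t, opEigenspace A z := by
        rw [← h.eigenspace₁]
        exact le_iSup₂_of_le l₁ ht le_rfl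
      refine le_trans ?_ (Submodule.rank_mono hle)
      rw [← Module.finrank_eq_rank, finrank_span_singleton h.ne_zero₁]
  rw [nthEigenvalue, this, csInf_Ici]

lemma nthEigenvalue_two : nthEigenvalue A 2 = l₂ := by
  have : {t : ℝ | ((2 : ℕ) : Cardinal) ≤ Module.rank ℝ ↥(⨆ z ∈ Iic t, opEigenspace A z)}
      = Ici l₂ := by
    ext t
    simp only [mem_ofPred_eq, mem_Ici]
    constructor
    · intro ht
      by_contra! hlt
      have h1 := ht.trans (Submodule.rank_mono (h.iSup_eigenspace_le hlt))
      rw [← Module.finrank_eq_rank, finrank_span_singleton h.ne_zero₁] at h1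
      norm_num at h1
    · intro ht
      have hm1 : u₁ ∈ ⨆ z ∈ Iic t, opEigenspace A z := by
        refine (le_iSup₂_of_le (f := fun z (_ : z ∈ Iic t) => opEigenspace A z) l₁
          (show l₁ ≤ t from h.lt₁₂.le.trans ht) le_rfl) ?_
        exact mem_opEigenspace_iff.2 h.mem₁
      have hm2 : u₂ ∈ ⨆ z ∈ Iic t, opEigenspace A z := by
        refine (le_iSup₂_of_le (f := fun z (_ : z ∈ Iic t) => opEigenspace A z) l₂
          (show l₂ ≤ t from ht) le_rfl) ?_
        exact mem_opEigenspace_iff.2 h.mem₂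
      have hort : Orthonormal ℝ ![u₁, u₂] := by
        constructor
        · intro i
          fin_cases i
          · exact h.norm₁
          · exact h.norm₂
        · intro i j hij
          fin_cases i <;> fin_cases j
          · exact absurd rfl hij
          · exact h.ortho
          · change ⟪u₂, u₁⟫ = 0
            rw [real_inner_comm]; exact h.ortho
          · exact absurd rfl hij
      have hli := hort.linearIndependent
      have hle : Submodule.span ℝ (Set.range ![u₁, u₂]) ≤ ⨆ z ∈ Iic t, opEigenspace A z := by
        rw [Submodule.span_le]
        rintro _ ⟨i, rfl⟩
        fin_cases i
        · exact hm1
        · exact hm2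
      refine le_trans ?_ (Submodule.rank_mono hle)
      have := FiniteDimensional.span_of_finite ℝ (Set.finite_range ![u₁, u₂])
      rw [← Module.finrank_eq_rank, finrank_span_eq_card hli]
      simp
  rw [nthEigenvalue, this, csInf_Ici]

end TwoLowEigenvalues

/-- The form criterion for `TwoLowEigenvalues`. -/
theorem twoLowEigenvalues_of_form {X : Type*} [NormedAddCommGroup X] [NormedSpace ℝ X]
    [CompleteSpace X] (a : X →L[ℝ] X →L[ℝ] ℝ) (hs : ∀ p q, a p q = a q p) (J : X →L[ℝ] H)
    (V : Submodule ℝ X) (hV : IsClosed (V : Set X)) {c C : ℝ} (hc : 0 < c)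
    (hcoer : ∀ p ∈ V, c * ‖p‖ ^ 2 ≤ a p p + C * ‖J p‖ ^ 2)
    (hA : ∀ u f, (u, f) ∈ A.graph ↔ ∃ p ∈ V, J p = u ∧ ∀ q ∈ V, a p q = ⟪f, J q⟫)
    {e₁ e₂ : X} (h₁ : e₁ ∈ V) (h₂ : e₂ ∈ V) (hlt : l₁ < l₂) (hlt₂ : l₂ < μ)
    (n₁ : ‖J e₁‖ = 1) (n₂ : ‖J e₂‖ = 1) (ho : ⟪J e₁, J e₂⟫ = 0)
    (eq₁ : ∀ q ∈ V, a e₁ q = l₁ * ⟪J e₁, J q⟫) (eq₂ : ∀ q ∈ V, a e₂ q = l₂ * ⟪J e₂, J q⟫)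
    (hlow : ∀ p ∈ V, ⟪J p, J e₁⟫ = 0 → ⟪J p, J e₂⟫ = 0 → μ * ‖J p‖ ^ 2 ≤ a p p) :
    TwoLowEigenvalues A μ l₁ l₂ (J e₁) (J e₂) := by
  have i1 : ⟪J e₁, J e₁⟫ = 1 := by rw [real_inner_self_eq_norm_sq, n₁]; norm_num
  have i2 : ⟪J e₂, J e₂⟫ = 1 := by rw [real_inner_self_eq_norm_sq, n₂]; norm_num
  have i3 : ⟪J e₂, J e₁⟫ = 0 := by rw [real_inner_comm, ho]
  refine ⟨hlt, hlt₂, n₁, n₂, ho, ?_, ?_, ?_, ?_, ?_, ?_⟩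
  · exact (hA _ _).2 ⟨e₁, h₁, rfl, fun q hq => by rw [eq₁ q hq, real_inner_smul_left]⟩
  · exact (hA _ _).2 ⟨e₂, h₂, rfl, fun q hq => by rw [eq₂ q hq, real_inner_smul_left]⟩
  · intro u f huf
    obtain ⟨p, hp, rfl, hpq⟩ := (hA _ _).1 huf
    rw [← hpq e₁ h₁, hs, eq₁ p hp, real_inner_comm]
  · intro u f huf
    obtain ⟨p, hp, rfl, hpq⟩ := (hA _ _).1 huf
    rw [← hpq e₂ h₂, hs, eq₂ p hp, real_inner_comm]
  · intro u f huf o1 o2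
    obtain ⟨p, hp, rfl, hpq⟩ := (hA _ _).1 huf
    rw [← hpq p hp]
    exact hlow p hp o1 o2
  · intro z hz f hf1 hf2
    -- On the complement W of the two eigenvectors the form is at least μ > z, so the shifted form b
    -- is coercive there and f can be represented on W.
    set W : Submodule ℝ X := V ⊓ (LinearMap.ker ((innerSL ℝ (J e₁)).comp J).toLinearMap ⊓
      LinearMap.ker ((innerSL ℝ (J e₂)).comp J).toLinearMap) with hWdef
    have hWmem : ∀ p, p ∈ W ↔ p ∈ V ∧ ⟪J p, J e₁⟫ = 0 ∧ ⟪J p, J e₂⟫ = 0 := by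
      intro p
      rw [real_inner_comm, real_inner_comm (J e₂)]
      rfl
    have hWc : IsClosed (W : Set X) := by
      refine hV.inter (IsClosed.inter ?_ ?_)
      · exact ((innerSL ℝ (J e₁)).comp J).isClosed_ker
      · exact ((innerSL ℝ (J e₂)).comp J).isClosed_ker
    set b : X →L[ℝ] X →L[ℝ] ℝ := a - z • (realInnerCLM H).bilinearComp J J with hb
    have hbpq : ∀ p q, b p q = a p q - z * ⟪J p, J q⟫ := fun p q => by
      simp [hb, realInnerCLM_apply]
    set M := (|z| + |C|) / (μ - z) with hM
    have hM0 : 0 ≤ M := div_nonneg (by positivity) (by linarith)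
    have hbc : ∀ p ∈ W, c / (1 + M) * ‖p‖ ^ 2 ≤ b p p := by
      intro p hp
      obtain ⟨hpV, o1, o2⟩ := (hWmem p).1 hp
      have h1 := hcoer p hpV
      have h2 := hlow p hpV o1 o2
      rw [hbpq, real_inner_self_eq_norm_sq, div_mul_eq_mul_div, div_le_iff₀ (by positivity)]
      have h3 : (|z| + |C|) * ‖J p‖ ^ 2 ≤ M * (a p p - z * ‖J p‖ ^ 2) := by
        have : (|z| + |C|) * ‖J p‖ ^ 2 = M * ((μ - z) * ‖J p‖ ^ 2) := by
          rw [hM]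
          field_simp [show μ - z ≠ 0 by linarith]
        rw [this]
        exact mul_le_mul_of_nonneg_left (by linarith) hM0
      have h4 : (z + C) * ‖J p‖ ^ 2 ≤ (|z| + |C|) * ‖J p‖ ^ 2 :=
        mul_le_mul_of_nonneg_right (add_le_add (le_abs_self _) (le_abs_self _)) (sq_nonneg _)
      linarith
    obtain ⟨p, hpW, hp⟩ := exists_form_representer b
      (fun p q => by rw [hbpq, hbpq, hs, real_inner_comm]) W hWc (c := c / (1 + M))
      (by positivity) hbc ((innerSL ℝ f).comp J)
    obtain ⟨hpV, o1, o2⟩ := (hWmem p).1 hpW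
    refine ⟨J p, (hA _ _).2 ⟨p, hpV, rfl, fun q hq => ?_⟩⟩
    -- The equation is known only for test vectors in W. It extends to all of V because both sides
    -- vanish on e₁ and e₂: p and f are orthogonal to their images, and these are eigenvectors.
    have hq' : q - ⟪J q, J e₁⟫ • e₁ - ⟪J q, J e₂⟫ • e₂ ∈ W := by
      refine (hWmem _).2 ⟨V.sub_mem (V.sub_mem hq (V.smul_mem _ h₁)) (V.smul_mem _ h₂), ?_, ?_⟩
      · simp only [map_sub, map_smul, inner_sub_left, real_inner_smul_left, i1, i3]; ring
      · simp only [map_sub, map_smul, inner_sub_left, real_inner_smul_left, i2, ho]; ring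
    have h1 := hp _ hq'
    have a1 : a p e₁ = 0 := by rw [hs, eq₁ p hpV, real_inner_comm, o1, mul_zero]
    have a2 : a p e₂ = 0 := by rw [hs, eq₂ p hpV, real_inner_comm, o2, mul_zero]
    simp only [hbpq, map_sub, map_smul, inner_sub_right, real_inner_smul_right, a1, a2, o1, o2,
      ContinuousLinearMap.comp_apply, innerSL_apply_apply, hf1, hf2, smul_eq_mul, mul_zero,
      sub_zero] at h1
    rw [inner_add_left, real_inner_smul_left]
    linarith

end LowSpectrum

/-! ### Geometry of the two-corner domain -/

section Geometry

/-- Half of the width of `Ω_L` at height `y`. -/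
noncomputable def halfWidth (ω L y : ℝ) : ℝ := L - y * (cos ω / sin ω)

/-- The point with coordinates `x, y`. -/
noncomputable def pt (x y : ℝ) : Plane := !₂[x, y]

lemma pt_zero (x y : ℝ) : pt x y 0 = x := rfl
lemma pt_one (x y : ℝ) : pt x y 1 = y := rfl

lemma pt_eta (x : Plane) : pt (x 0) (x 1) = x := by
  ext i; fin_cases i <;> rfl

lemma continuous_halfWidth (ω L : ℝ) : Continuous (halfWidth ω L) := by
  unfold halfWidth; fun_prop

lemma continuous_coord (i : Fin 2) : Continuous fun x : Plane => x i :=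
  (continuous_apply i).comp (PiLp.continuous_ofLp 2 _)

lemma Continuous.pt {Z : Type*} [TopologicalSpace Z] {f g : Z → ℝ} (hf : Continuous f)
    (hg : Continuous g) : Continuous fun z => _root_.pt (f z) (g z) := by
  refine (PiLp.continuous_toLp 2 _).comp (continuous_pi fun i => ?_)
  fin_cases i
  · exact hf
  · exact hg

variable {ω : ℝ} (h0 : 0 < ω) (hπ : ω < π) (L : ℝ)

/-- For z = (x₀ + L) + i x₁ the two inequalities say that |z| sin(arg z) and |z| sin(ω - arg z) are
positive. As arg z lies in (-π, π], this means 0 < arg z < ω. -/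
lemma mem_sectorLeft_iff (h0 : 0 < ω) (hπ : ω < π) {L : ℝ} {x : Plane} :
    x ∈ sectorLeft ω L ↔ 0 < x 1 ∧ -halfWidth ω L (x 1) < x 0 := by
  have hs : 0 < sin ω := sin_pos_of_pos_of_lt_pi h0 hπ
  set z : ℂ := ⟨x 0 + L, x 1⟩ with hz
  have hre : ‖z‖ * cos z.arg = x 0 + L := Complex.norm_mul_cos_arg z
  have him : ‖z‖ * sin z.arg = x 1 := Complex.norm_mul_sin_arg z
  have key : ‖z‖ * sin (ω - z.arg) = sin ω * (x 0 + halfWidth ω L (x 1)) := by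
    rw [sin_sub, halfWidth]
    have : sin ω * (x 0 + (L - x 1 * (cos ω / sin ω))) = sin ω * (x 0 + L) - cos ω * x 1 := by
      field_simp; ring
    rw [this, ← hre, ← him]; ring
  change z.arg ∈ Ioo 0 ω ↔ _
  constructor
  · rintro ⟨h1, h2⟩
    have hz0 : 0 < ‖z‖ := by
      rw [norm_pos_iff]
      intro h
      rw [h, Complex.arg_zero] at h1
      exact lt_irrefl _ h1
    constructor
    · rw [← him]
      exact mul_pos hz0 (sin_pos_of_pos_of_lt_pi h1 (h2.trans hπ))
    · have h3 : 0 < ‖z‖ * sin (ω - z.arg) :=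
        mul_pos hz0 (sin_pos_of_pos_of_lt_pi (by linarith) (by linarith))
      rw [key] at h3
      have := pos_of_mul_pos_right h3 hs.le
      linarith
  · rintro ⟨h1, h2⟩
    have h3 : 0 < ‖z‖ * sin z.arg := by rw [him]; exact h1
    have h4 : 0 < sin z.arg := pos_of_mul_pos_right h3 (norm_nonneg _)
    have h5 : 0 < z.arg := by
      by_contra! hneg
      linarith [sin_nonpos_of_nonpos_of_neg_pi_le hneg (Complex.neg_pi_lt_arg z).le]
    refine ⟨h5, ?_⟩
    have h6 : 0 < ‖z‖ * sin (ω - z.arg) := by rw [key]; exact mul_pos hs (by linarith)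
    have h7 : 0 < sin (ω - z.arg) := pos_of_mul_pos_right h6 (norm_nonneg _)
    by_contra! hneg
    linarith [sin_nonpos_of_nonpos_of_neg_pi_le (show ω - z.arg ≤ 0 by linarith)
      (by linarith [Complex.arg_le_pi z])]

lemma mem_twoCornerDomain_iff (h0 : 0 < ω) (hπ : ω < π) {L : ℝ} {x : Plane} :
    x ∈ twoCornerDomain ω L ↔ 0 < x 1 ∧ |x 0| < halfWidth ω L (x 1) := by
  have : x ∈ twoCornerDomain ω L ↔ x ∈ sectorLeft ω L ∧ pt (-x 0) (x 1) ∈ sectorLeft ω L := Iff.rfl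
  rw [this, mem_sectorLeft_iff h0 hπ, mem_sectorLeft_iff h0 hπ, abs_lt, pt_zero, pt_one]
  constructor
  · rintro ⟨⟨h1, h2⟩, -, h3⟩
    exact ⟨h1, h2, by linarith⟩
  · rintro ⟨h1, h2, h3⟩
    exact ⟨⟨h1, h2⟩, h1, by linarith⟩

lemma halfWidth_combo (ω L y z s t : ℝ) (hst : s + t = 1) :
    halfWidth ω L (s * y + t * z) = s * halfWidth ω L y + t * halfWidth ω L z := by
  unfold halfWidth
  have : L = s * L + t * L := by rw [← add_mul, hst, one_mul]
  nth_rewrite 1 [this]; ring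

lemma convex_twoCornerDomain (h0 : 0 < ω) (hπ : ω < π) (L : ℝ) :
    Convex ℝ (twoCornerDomain ω L) := by
  intro x hx y hy s t hs ht hst
  rw [mem_twoCornerDomain_iff h0 hπ] at hx hy ⊢
  simp only [PiLp.add_apply, PiLp.smul_apply, smul_eq_mul]
  rw [halfWidth_combo ω L _ _ s t hst]
  obtain ⟨hx1, hx2⟩ := hx
  obtain ⟨hy1, hy2⟩ := hy
  rw [abs_lt] at hx2 hy2 ⊢
  rcases hs.eq_or_lt with rfl | hs
  · obtain rfl : t = 1 := by linarith
    simp only [zero_mul, one_mul, zero_add]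
    exact ⟨hy1, hy2⟩
  · have := mul_pos hs hx1
    have := mul_nonneg ht hy1.le
    have := mul_lt_mul_of_pos_left hx2.1 hs
    have := mul_lt_mul_of_pos_left hx2.2 hs
    have := mul_le_mul_of_nonneg_left hy2.1.le ht
    have := mul_le_mul_of_nonneg_left hy2.2.le ht
    exact ⟨by linarith, by linarith, by linarith⟩

lemma exists_halfWidth_pos (ω : ℝ) {L : ℝ} (hL : 0 < L) : ∃ ε > 0, 0 < halfWidth ω L ε := by
  have h1 : Tendsto (halfWidth ω L) (𝓝[>] 0) (𝓝 (halfWidth ω L 0)) :=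
    ((continuous_halfWidth ω L).tendsto 0).mono_left nhdsWithin_le_nhds
  have h2 : 0 < halfWidth ω L 0 := by simp [halfWidth, hL]
  obtain ⟨ε, h3, h4⟩ := ((h1.eventually (lt_mem_nhds h2)).and self_mem_nhdsWithin).exists
  exact ⟨ε, h4, h3⟩

/-- The point that needs care is that the closed inequalities describe the closure: such a point is
joined by a segment to a point of the domain low on the axis, and all later points of the segment
are interior. -/
lemma mem_frontier_twoCornerDomain_iff (h0 : 0 < ω) (hπ : ω < π) {L : ℝ} (hL : 0 < L)
    {x : Plane} : x ∈ frontier (twoCornerDomain ω L) ↔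
      0 ≤ x 1 ∧ |x 0| ≤ halfWidth ω L (x 1) ∧ (x 1 = 0 ∨ |x 0| = halfWidth ω L (x 1)) := by
  rw [(isOpen_twoCornerDomain hπ.le L).frontier_eq, Set.mem_sdiff, mem_twoCornerDomain_iff h0 hπ]
  have hcl : x ∈ closure (twoCornerDomain ω L) ↔ 0 ≤ x 1 ∧ |x 0| ≤ halfWidth ω L (x 1) := by
    constructor
    · have hc : IsClosed {x : Plane | 0 ≤ x 1 ∧ |x 0| ≤ halfWidth ω L (x 1)} :=
        (isClosed_le continuous_const (continuous_coord 1)).inter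
          (isClosed_le (continuous_coord 0).abs
            ((continuous_halfWidth ω L).comp (continuous_coord 1)))
      refine fun hx => closure_minimal (fun y hy => ?_) hc hx
      rw [mem_twoCornerDomain_iff h0 hπ] at hy
      exact ⟨hy.1.le, hy.2.le⟩
    · rintro ⟨h1, h2⟩
      obtain ⟨ε, hε, hm⟩ := exists_halfWidth_pos ω hL
      have hc : Tendsto (fun t : ℝ => (1 - t) • x + t • pt 0 ε) (𝓝[>] 0)
          (𝓝 ((1 - 0 : ℝ) • x + (0 : ℝ) • pt 0 ε)) := by
        have : Continuous fun t : ℝ => (1 - t) • x + t • pt 0 ε := by fun_prop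
        exact (this.tendsto 0).mono_left nhdsWithin_le_nhds
      rw [sub_zero, one_smul, zero_smul, add_zero] at hc
      refine mem_closure_of_tendsto hc ?_
      have hI : Ioo (0 : ℝ) 1 ∈ 𝓝[>] (0 : ℝ) := Ioo_mem_nhdsGT one_pos
      filter_upwards [hI] with t ht
      rw [mem_twoCornerDomain_iff h0 hπ]
      simp only [PiLp.add_apply, PiLp.smul_apply, smul_eq_mul, pt_zero, pt_one, mul_zero,
        add_zero]
      rw [halfWidth_combo ω L _ _ (1 - t) t (by ring), abs_mul, abs_of_pos (by linarith [ht.2])]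
      have h3 : 0 < 1 - t := by linarith [ht.2]
      exact ⟨by nlinarith [mul_nonneg h3.le h1, mul_pos ht.1 hε],
        by nlinarith [mul_le_mul_of_nonneg_left h2 h3.le, mul_pos ht.1 hm]⟩
  rw [hcl]
  constructor
  · rintro ⟨⟨h1, h2⟩, h3⟩
    refine ⟨h1, h2, ?_⟩
    by_contra! h4
    exact h3 ⟨lt_of_le_of_ne h1 h4.1.symm, lt_of_le_of_ne h2 h4.2⟩
  · rintro ⟨h1, h2, h3⟩
    refine ⟨⟨h1, h2⟩, fun h4 => ?_⟩
    rcases h3 with h3 | h3 <;> linarith [h4.1, h4.2]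

end Geometry

/-! ### Iterated integrals -/

section Slices

/-- The plane as a product. -/
noncomputable def planeEquiv : Plane ≃ᵐ ℝ × ℝ :=
  (MeasurableEquiv.toLp 2 (Fin 2 → ℝ)).symm.trans MeasurableEquiv.finTwoArrow

lemma planeEquiv_symm_apply (p : ℝ × ℝ) : planeEquiv.symm p = pt p.1 p.2 := by
  ext i; fin_cases i <;> rfl

lemma measurePreserving_planeEquiv : MeasurePreserving planeEquiv :=
  (EuclideanSpace.volume_preserving_symm_measurableEquiv_toLp (Fin 2)).trans
    (volume_preserving_finTwoArrow ℝ)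

lemma integral_plane (F : Plane → ℝ) : ∫ x, F x = ∫ p : ℝ × ℝ, F (pt p.1 p.2) := by
  rw [← measurePreserving_planeEquiv.symm.integral_comp planeEquiv.symm.measurableEmbedding]
  simp only [planeEquiv_symm_apply]

lemma integrable_plane {F : Plane → ℝ} (hF : Integrable F) :
    Integrable (fun p : ℝ × ℝ => F (pt p.1 p.2)) := by
  have := (measurePreserving_planeEquiv.symm.integrable_comp_emb
    planeEquiv.symm.measurableEmbedding).2 hF
  simpa only [Function.comp_def, planeEquiv_symm_apply] using this

lemma integral_plane_iterated {F : Plane → ℝ} (hF : Integrable F) :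
    ∫ x, F x = ∫ y, ∫ x, F (pt x y) := by
  rw [integral_plane]
  exact integral_prod_symm _ (integrable_plane hF)

lemma integral_twoCornerDomain {ω : ℝ} (h0 : 0 < ω) (hπ : ω < π) (L : ℝ) {f : Plane → ℝ}
    (hf : IntegrableOn f (twoCornerDomain ω L)) :
    ∫ x in twoCornerDomain ω L, f x = ∫ y in Ioi 0,
      ∫ x in Ioo (-halfWidth ω L y) (halfWidth ω L y), f (pt x y) := by
  have hm := (isOpen_twoCornerDomain hπ.le L).measurableSet
  rw [← integral_indicator hm, integral_plane_iterated ((integrable_indicator_iff hm).2 hf),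
    ← integral_indicator measurableSet_Ioi]
  congr 1
  ext y
  by_cases hy : 0 < y
  · rw [indicator_of_mem (show y ∈ Ioi 0 from hy), ← integral_indicator measurableSet_Ioo]
    congr 1
    ext x
    simp only [indicator, mem_twoCornerDomain_iff h0 hπ, pt_zero, pt_one, hy, true_and, abs_lt,
      mem_Ioo]
  · rw [indicator_of_notMem (show y ∉ Ioi 0 from hy)]
    simp only [indicator, mem_twoCornerDomain_iff h0 hπ, pt_one, hy, false_and, if_false,
      integral_zero]

end Slices

/-! ### Arc length on the boundary -/

section Boundary

/-- Isometries preserve Hausdorff measure, and on the line the one-dimensional one is Lebesgue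
measure. -/
lemma restrict_hausdorff_image {γ : ℝ → Plane} (hγ : Isometry γ) {S : Set ℝ}
    (hS : MeasurableSet S) :
    (μH[1] : Measure Plane).restrict (γ '' S) = (volume.restrict S).map γ := by
  have hemb : MeasurableEmbedding γ := hγ.isClosedEmbedding.measurableEmbedding
  have h1 := hγ.map_hausdorffMeasure (d := 1) (Or.inl zero_le_one)
  rw [hausdorffMeasure_real] at h1
  have h2 : ((volume : Measure ℝ).map γ).restrict (γ '' S)
      = (volume.restrict (γ ⁻¹' (γ '' S))).map γ := hemb.restrict_map _ _
  rw [hγ.injective.preimage_image, h1, Measure.restrict_restrict (hemb.measurableSet_image.2 hS),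
    inter_eq_left.2 (image_subset_range γ S)] at h2
  exact h2

lemma isometry_line {a b c d : ℝ} (h : b ^ 2 + d ^ 2 = 1) :
    Isometry fun t : ℝ => pt (a + t * b) (c + t * d) := by
  refine Isometry.of_dist_eq fun s t => ?_
  rw [EuclideanSpace.dist_eq, Fin.sum_univ_two, Real.dist_eq (pt _ _ 0), Real.dist_eq (pt _ _ 1),
    pt_zero, pt_zero, pt_one, pt_one, sq_abs, sq_abs, Real.dist_eq, ← Real.sqrt_sq_eq_abs]
  congr 1
  linear_combination (s - t) ^ 2 * h

/-- The parameters of the lateral boundary. -/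
def sideParams (ω L : ℝ) : Set ℝ := {t | 0 < t ∧ 0 < halfWidth ω L (t * sin ω)}

lemma measurableSet_sideParams (ω L : ℝ) : MeasurableSet (sideParams ω L) :=
  (measurableSet_lt measurable_const measurable_id).inter (measurableSet_lt measurable_const
    ((continuous_halfWidth ω L).comp (continuous_id.mul continuous_const)).measurable)

/-- The left side of the domain, parametrized by arc length. -/
noncomputable def leftSide (ω L t : ℝ) : Plane := pt (-L + t * cos ω) (0 + t * sin ω)

/-- The right side of the domain, parametrized by arc length. -/
noncomputable def rightSide (ω L t : ℝ) : Plane := pt (L + t * -cos ω) (0 + t * sin ω)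

lemma isometry_leftSide (ω L : ℝ) : Isometry (leftSide ω L) :=
  isometry_line (by rw [add_comm]; exact sin_sq_add_cos_sq ω)

lemma isometry_rightSide (ω L : ℝ) : Isometry (rightSide ω L) :=
  isometry_line (by rw [neg_sq, add_comm]; exact sin_sq_add_cos_sq ω)

lemma isometry_bottom : Isometry fun t : ℝ => pt t 0 := by
  simpa using isometry_line (a := 0) (b := 1) (c := 0) (d := 0) (by norm_num)

lemma halfWidth_mul_sin {ω : ℝ} (hs : sin ω ≠ 0) (L t : ℝ) :
    halfWidth ω L (t * sin ω) = L - t * cos ω := by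
  unfold halfWidth; field_simp

/-- Arc length on the boundary is the sum of the arc lengths of the three sides. -/
theorem hausdorff_restrict_frontier {ω : ℝ} (h0 : 0 < ω) (hπ : ω < π) {L : ℝ} (hL : 0 < L) :
    (μH[1] : Measure Plane).restrict (frontier (twoCornerDomain ω L)) =
      (volume.restrict (Ioo (-L) L)).map (fun t : ℝ => pt t 0) +
        (volume.restrict (sideParams ω L)).map (leftSide ω L) +
        (volume.restrict (sideParams ω L)).map (rightSide ω L) := by
  have hs : 0 < sin ω := sin_pos_of_pos_of_lt_pi h0 hπ
  have hm := measurableSet_sideParams ω L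
  rw [← restrict_hausdorff_image isometry_bottom measurableSet_Ioo,
    ← restrict_hausdorff_image (isometry_leftSide ω L) hm,
    ← restrict_hausdorff_image (isometry_rightSide ω L) hm]
  have m2 : MeasurableSet (leftSide ω L '' sideParams ω L) :=
    ((isometry_leftSide ω L).isClosedEmbedding.measurableEmbedding).measurableSet_image.2 hm
  have m3 : MeasurableSet (rightSide ω L '' sideParams ω L) :=
    ((isometry_rightSide ω L).isClosedEmbedding.measurableEmbedding).measurableSet_image.2 hm
  have d12 : Disjoint ((fun t : ℝ => pt t 0) '' Ioo (-L) L) (leftSide ω L '' sideParams ω L) := by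
    rw [Set.disjoint_left]
    rintro _ ⟨s, -, rfl⟩ ⟨t, ht, hst⟩
    have := congrArg (fun x : Plane => x 1) hst
    simp only [leftSide, pt_one, zero_add] at this
    exact (mul_pos ht.1 hs).ne' this
  have d3 : Disjoint ((fun t : ℝ => pt t 0) '' Ioo (-L) L ∪ leftSide ω L '' sideParams ω L)
      (rightSide ω L '' sideParams ω L) := by
    rw [Set.disjoint_left]
    rintro _ (⟨s, -, rfl⟩ | ⟨s, hs', rfl⟩) ⟨t, ht, hst⟩
    · have := congrArg (fun x : Plane => x 1) hst
      simp only [rightSide, pt_one, zero_add] at this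
      exact (mul_pos ht.1 hs).ne' this
    · have e1 := congrArg (fun x : Plane => x 1) hst
      have e0 := congrArg (fun x : Plane => x 0) hst
      simp only [rightSide, leftSide, pt_one, pt_zero, zero_add] at e0 e1
      obtain rfl := mul_right_cancel₀ hs.ne' e1
      have := ht.2
      rw [halfWidth_mul_sin hs.ne'] at this
      linarith
  rw [← Measure.restrict_union d12 m2, ← Measure.restrict_union d3 m3]
  refine Measure.restrict_congr_set ?_
  -- The two base corners and the apex are missed by the open sides. The third point is the apex
  -- only when cos ω > 0; otherwise it is an arbitrary point (the origin when cos ω = 0), which is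
  -- harmless since points are null.
  have hfin : ({pt (-L) 0, pt L 0, pt 0 (L * (sin ω / cos ω))} : Set Plane).Finite := by
    simp
  have hnull : (μH[1] : Measure Plane) {pt (-L) 0, pt L 0, pt 0 (L * (sin ω / cos ω))} = 0 := by
    have := Measure.nullSingletonClass_hausdorff Plane (d := 1) one_pos
    exact hfin.measure_zero _
  have hsub : (fun t : ℝ => pt t 0) '' Ioo (-L) L ∪ leftSide ω L '' sideParams ω L ∪
      rightSide ω L '' sideParams ω L ⊆ frontier (twoCornerDomain ω L) := by
    rintro _ ((⟨t, ht, rfl⟩ | ⟨t, ht, rfl⟩) | ⟨t, ht, rfl⟩)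
    · rw [mem_frontier_twoCornerDomain_iff h0 hπ hL]
      simp only [pt_zero, pt_one, halfWidth, zero_mul, sub_zero]
      exact ⟨le_rfl, (abs_lt.2 ht).le, Or.inl trivial⟩
    · rw [mem_frontier_twoCornerDomain_iff h0 hπ hL]
      have h2 := ht.2
      simp only [leftSide, pt_zero, pt_one, zero_add]
      rw [halfWidth_mul_sin hs.ne'] at h2 ⊢
      rw [show -L + t * cos ω = -(L - t * cos ω) by ring, abs_neg, abs_of_pos h2]
      exact ⟨(mul_pos ht.1 hs).le, le_rfl, Or.inr rfl⟩
    · rw [mem_frontier_twoCornerDomain_iff h0 hπ hL]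
      have h2 := ht.2
      simp only [rightSide, pt_zero, pt_one, zero_add]
      rw [halfWidth_mul_sin hs.ne'] at h2 ⊢
      rw [show L + t * -cos ω = L - t * cos ω by ring, abs_of_pos h2]
      exact ⟨(mul_pos ht.1 hs).le, le_rfl, Or.inr rfl⟩
  refine (ae_eq_set.2 ⟨measure_mono_null (fun x hx => ?_) hnull, ?_⟩)
  · obtain ⟨hx1, hx2⟩ := hx
    rw [mem_frontier_twoCornerDomain_iff h0 hπ hL] at hx1
    obtain ⟨y0, y1, y2⟩ := hx1
    rw [← pt_eta x] at hx2 ⊢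
    by_contra hne
    simp only [mem_insert_iff, mem_singleton_iff, not_or] at hne
    refine hx2 ?_
    by_cases hy : x 1 = 0
    · rw [hy] at hne y1 ⊢
      have hL' : halfWidth ω L 0 = L := by simp [halfWidth]
      rw [hL', abs_le] at y1
      refine Or.inl (Or.inl ⟨x 0, ⟨lt_of_le_of_ne y1.1 fun h => ?_, lt_of_le_of_ne y1.2 fun h => ?_⟩,
        rfl⟩)
      · exact hne.1 (by rw [← h])
      · exact hne.2.1 (by rw [h])
    · have hpos : 0 < x 1 := lt_of_le_of_ne y0 (Ne.symm hy)
      have habs := y2.resolve_left hy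
      have ht : x 1 / sin ω * sin ω = x 1 := by field_simp
      have ht' : halfWidth ω L (x 1) = L - x 1 / sin ω * cos ω := by
        rw [← halfWidth_mul_sin hs.ne', ht]
      -- The width vanishes only at the apex, which has been excluded.
      have hw : 0 < halfWidth ω L (x 1) := by
        rw [← habs, abs_pos]
        intro hx0
        refine hne.2.2 ?_
        rw [hx0, abs_zero, halfWidth] at habs
        have hc : cos ω ≠ 0 := fun hc => by rw [hc] at habs; simp at habs; linarith
        rw [hx0]
        congr 1
        have : x 1 * cos ω = L * sin ω := by
          field_simp at habs
          linarith
        field_simp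
        linarith
      have hmem : x 1 / sin ω ∈ sideParams ω L := ⟨div_pos hpos hs, by rw [ht]; exact hw⟩
      rcases abs_choice (x 0) with hc | hc
      · refine Or.inr ⟨x 1 / sin ω, hmem, ?_⟩
        simp only [rightSide]
        rw [zero_add, ht]
        congr 1
        rw [← hc, habs, ht']; ring
      · refine Or.inl (Or.inr ⟨x 1 / sin ω, hmem, ?_⟩)
        simp only [leftSide]
        rw [zero_add, ht]
        congr 1
        have : x 0 = -halfWidth ω L (x 1) := by rw [← habs, hc]; ring
        rw [this, ht']; ring
  · rw [sdiff_eq_empty.2 hsub]; exact measure_empty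

lemma isFiniteMeasureOnCompacts_map {γ : ℝ → Plane} (hγ : Isometry γ) (S : Set ℝ) :
    IsFiniteMeasureOnCompacts ((volume.restrict S).map γ) := by
  refine ⟨fun K hK => ?_⟩
  rw [hγ.isClosedEmbedding.measurableEmbedding.map_apply]
  exact (hγ.isClosedEmbedding.isCompact_preimage hK).measure_lt_top

lemma isFiniteMeasureOnCompacts_frontier {ω : ℝ} (h0 : 0 < ω) (hπ : ω < π) {L : ℝ}
    (hL : 0 < L) : IsFiniteMeasureOnCompacts
      ((μH[1] : Measure Plane).restrict (frontier (twoCornerDomain ω L))) := by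
  rw [hausdorff_restrict_frontier h0 hπ hL]
  have := isFiniteMeasureOnCompacts_map isometry_bottom (Ioo (-L) L)
  have := isFiniteMeasureOnCompacts_map (isometry_leftSide ω L) (sideParams ω L)
  have := isFiniteMeasureOnCompacts_map (isometry_rightSide ω L) (sideParams ω L)
  refine ⟨fun K hK => ?_⟩
  simp only [Measure.add_apply]
  exact ENNReal.add_lt_top.2 ⟨ENNReal.add_lt_top.2 ⟨hK.measure_lt_top, hK.measure_lt_top⟩,
    hK.measure_lt_top⟩

/-- The heights at which the domain is present. -/
def sideHeights (ω L : ℝ) : Set ℝ := {y | 0 < y ∧ 0 < halfWidth ω L y}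

lemma measurableSet_sideHeights (ω L : ℝ) : MeasurableSet (sideHeights ω L) :=
  (measurableSet_lt measurable_const measurable_id).inter (measurableSet_lt measurable_const
    (continuous_halfWidth ω L).measurable)

lemma integral_sideParams {ω : ℝ} (h0 : 0 < ω) (hπ : ω < π) (L : ℝ) (g : ℝ → ℝ) :
    ∫ t in sideParams ω L, g (t * sin ω) = (1 / sin ω) * ∫ y in sideHeights ω L, g y := by
  have hs : 0 < sin ω := sin_pos_of_pos_of_lt_pi h0 hπ
  rw [← integral_indicator (measurableSet_sideParams ω L),
    ← integral_indicator (measurableSet_sideHeights ω L)]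
  have := Measure.integral_comp_mul_right ((sideHeights ω L).indicator g) (sin ω)
  rw [abs_of_pos (inv_pos.2 hs), smul_eq_mul, ← one_div] at this
  rw [← this]
  congr 1
  ext t
  have : t ∈ sideParams ω L ↔ t * sin ω ∈ sideHeights ω L := by
    simp only [sideParams, sideHeights, mem_ofPred_eq, mul_pos_iff_of_pos_right hs]
  by_cases h : t * sin ω ∈ sideHeights ω L
  · rw [indicator_of_mem h, indicator_of_mem (this.2 h)]
  · rw [indicator_of_notMem h, indicator_of_notMem (fun h' => h (this.1 h'))]

/-- The boundary integral in coordinates. -/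
theorem integral_frontier {ω : ℝ} (h0 : 0 < ω) (hπ : ω < π) {L : ℝ} (hL : 0 < L)
    {w : Plane → ℝ} (hw : Continuous w) (hc : HasCompactSupport w) :
    ∫ x in frontier (twoCornerDomain ω L), w x ∂(μH[1] : Measure Plane) =
      (∫ x in Ioo (-L) L, w (pt x 0)) +
        (1 / sin ω) * (∫ y in sideHeights ω L, w (pt (-halfWidth ω L y) y)) +
        (1 / sin ω) * ∫ y in sideHeights ω L, w (pt (halfWidth ω L y) y) := by
  have hs : 0 < sin ω := sin_pos_of_pos_of_lt_pi h0 hπ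
  rw [hausdorff_restrict_frontier h0 hπ hL]
  have := isFiniteMeasureOnCompacts_map isometry_bottom (Ioo (-L) L)
  have := isFiniteMeasureOnCompacts_map (isometry_leftSide ω L) (sideParams ω L)
  have := isFiniteMeasureOnCompacts_map (isometry_rightSide ω L) (sideParams ω L)
  have i1 : Integrable w ((volume.restrict (Ioo (-L) L)).map (fun t : ℝ => pt t 0)) :=
    hw.integrable_of_hasCompactSupport hc
  have i2 : Integrable w ((volume.restrict (sideParams ω L)).map (leftSide ω L)) :=
    hw.integrable_of_hasCompactSupport hc
  have i3 : Integrable w ((volume.restrict (sideParams ω L)).map (rightSide ω L)) :=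
    hw.integrable_of_hasCompactSupport hc
  rw [integral_add_measure (i1.add_measure i2) i3, integral_add_measure i1 i2,
    isometry_bottom.isClosedEmbedding.measurableEmbedding.integral_map,
    (isometry_leftSide ω L).isClosedEmbedding.measurableEmbedding.integral_map,
    (isometry_rightSide ω L).isClosedEmbedding.measurableEmbedding.integral_map,
    ← integral_sideParams h0 hπ L (fun y => w (pt (-halfWidth ω L y) y)),
    ← integral_sideParams h0 hπ L (fun y => w (pt (halfWidth ω L y) y))]
  congr 2
  · congr 1
    ext t
    rw [halfWidth_mul_sin hs.ne', leftSide]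
    congr 3 <;> ring
  · ext t
    rw [halfWidth_mul_sin hs.ne', rightSide]
    congr 3 <;> ring

end Boundary

/-! ### The divergence theorem on the two-corner domain -/

section Divergence

/-- Differentiation under the integral sign for jointly continuous data. -/
lemma hasDerivAt_intervalIntegral_param {g g' : ℝ → ℝ → ℝ} (hg : Continuous (Function.uncurry g))
    (hg' : Continuous (Function.uncurry g'))
    (h : ∀ y ξ, HasDerivAt (fun y => g y ξ) (g' y ξ) y) (a b y₀ : ℝ) :
    HasDerivAt (fun y => ∫ ξ in a..b, g y ξ) (∫ ξ in a..b, g' y₀ ξ) y₀ := by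
  obtain ⟨M, hM⟩ := ((isCompact_closedBall y₀ 1).prod (isCompact_uIcc (a := a) (b := b))
    ).exists_bound_of_continuousOn hg'.continuousOn
  have c1 : ∀ y, Continuous (g y) := fun y => hg.comp (Continuous.prodMk_right y)
  have c2 : ∀ y, Continuous (g' y) := fun y => hg'.comp (Continuous.prodMk_right y)
  refine (intervalIntegral.hasDerivAt_integral_of_dominated_loc_of_deriv_le
    (F := g) (F' := g') (bound := fun _ => M) (Metric.closedBall_mem_nhds y₀ one_pos)
    (Eventually.of_forall fun y => (c1 y).aestronglyMeasurable) ((c1 y₀).intervalIntegrable a b)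
    (c2 y₀).aestronglyMeasurable (Eventually.of_forall fun t ht x hx => ?_)
    intervalIntegrable_const (Eventually.of_forall fun t _ x _ => h x t)).2
  exact hM (x, t) ⟨hx, uIoc_subset_uIcc ht⟩

lemma pt_eq_add (x y : ℝ) :
    pt x y = x • EuclideanSpace.single 0 1 + y • EuclideanSpace.single 1 1 := by
  ext i; fin_cases i <;> simp [pt]

lemma hasDerivAt_pt {f g : ℝ → ℝ} {f' g' t : ℝ} (hf : HasDerivAt f f' t)
    (hg : HasDerivAt g g' t) : HasDerivAt (fun t => pt (f t) (g t)) (pt f' g') t := by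
  simp only [pt_eq_add]
  exact (hf.smul_const _).add (hg.smul_const _)

lemma fderiv_pt (w : Plane → ℝ) (x : Plane) (a b : ℝ) :
    fderiv ℝ w x (pt a b) = a * pderivAt 0 w x + b * pderivAt 1 w x := by
  rw [pt_eq_add, map_add, map_smul, map_smul]; rfl

lemma hasDerivAt_comp_pt {w : Plane → ℝ} (hw : Differentiable ℝ w) {f g : ℝ → ℝ} {f' g' t : ℝ}
    (hf : HasDerivAt f f' t) (hg : HasDerivAt g g' t) :
    HasDerivAt (fun t => w (pt (f t) (g t)))
      (f' * pderivAt 0 w (pt (f t) (g t)) + g' * pderivAt 1 w (pt (f t) (g t))) t := by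
  have := (hw (pt (f t) (g t))).hasFDerivAt.comp_hasDerivAt t (hasDerivAt_pt hf hg)
  rwa [fderiv_pt] at this

lemma hasCompactSupport_curve {w : Plane → ℝ} (hc : HasCompactSupport w) {f : ℝ → ℝ}
    (hf : Continuous f) : HasCompactSupport fun y => w (pt (f y) y) := by
  have : Function.LeftInverse (fun x : Plane => x 1) (fun y => pt (f y) y) := fun y => rfl
  exact hc.comp_isClosedEmbedding (this.isClosedEmbedding (continuous_coord 1)
    (hf.pt continuous_id))

lemma hasDerivAt_halfWidth (ω L y : ℝ) :
    HasDerivAt (halfWidth ω L) (-(cos ω / sin ω)) y := by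
  unfold halfWidth
  simpa using ((hasDerivAt_id y).mul_const (cos ω / sin ω)).const_sub L

lemma pderivAt_eq_zero_of_notMem {w : Plane → ℝ} {x : Plane} (h : x ∉ tsupport w) (i : Fin 2) :
    pderivAt i w x = 0 := by
  rw [pderivAt, image_eq_zero_of_notMem_tsupport (fun h' => h (tsupport_fderiv_subset ℝ h'))]
  rfl

/-- A height T that serves as upper limit of integration for both shapes. In the triangle (cos ω >
0) it is the apex, where the width vanishes; otherwise it lies above the support of w. -/
lemma exists_height {ω : ℝ} (h0 : 0 < ω) (hπ : ω < π) {L : ℝ} (hL : 0 < L) {w : Plane → ℝ}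
    (hc : HasCompactSupport w) : ∃ T > 0, Ioo 0 T ⊆ sideHeights ω L ∧
      (∀ y ∈ sideHeights ω L, T ≤ y → ∀ x, pt x y ∉ tsupport w) ∧
      (halfWidth ω L T = 0 ∨ ∀ x, pt x T ∉ tsupport w) := by
  have hs : 0 < sin ω := sin_pos_of_pos_of_lt_pi h0 hπ
  rcases le_or_gt (cos ω) 0 with h | h
  · obtain ⟨R, hR⟩ := (hc.isCompact.image (continuous_coord 1)).isBounded.subset_closedBall 0
    have hT : ∀ y, |R| + 1 ≤ y → ∀ x, pt x y ∉ tsupport w := fun y hy x hx => by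
      have : y ∈ Metric.closedBall (0 : ℝ) R := hR ⟨_, hx, rfl⟩
      rw [Metric.mem_closedBall, dist_zero_right, Real.norm_eq_abs] at this
      linarith [le_abs_self y, le_abs_self R]
    refine ⟨|R| + 1, by positivity, fun y hy => ⟨hy.1, ?_⟩, fun y _ hy => hT y hy,
      Or.inr (hT _ le_rfl)⟩
    have : y * (cos ω / sin ω) ≤ 0 :=
      mul_nonpos_of_nonneg_of_nonpos hy.1.le (div_nonpos_of_nonpos_of_nonneg h hs.le)
    unfold halfWidth
    linarith
  · have hcs : 0 < cos ω / sin ω := div_pos h hs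
    refine ⟨L / (cos ω / sin ω), by positivity, fun y hy => ⟨hy.1, ?_⟩, fun y hy hTy => ?_,
      Or.inl ?_⟩
    · have := (lt_div_iff₀ hcs).1 hy.2
      unfold halfWidth; linarith
    · have h1 := (div_le_iff₀ hcs).1 hTy
      have h2 := hy.2
      unfold halfWidth at h2
      linarith
    · unfold halfWidth
      field_simp
      ring

lemma Ioo_halfWidth_eq_empty {ω L y : ℝ} (hy : ¬ 0 < halfWidth ω L y) :
    Ioo (-halfWidth ω L y) (halfWidth ω L y) = ∅ := Ioo_eq_empty (by linarith)

/-- Integration over the domain by horizontal slices. -/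
lemma integral_slices {ω : ℝ} (h0 : 0 < ω) (hπ : ω < π) (L : ℝ) {f : Plane → ℝ}
    (hf : IntegrableOn f (twoCornerDomain ω L)) :
    ∫ x in twoCornerDomain ω L, f x = ∫ y in sideHeights ω L,
      ∫ x in (-halfWidth ω L y)..(halfWidth ω L y), f (pt x y) := by
  rw [integral_twoCornerDomain h0 hπ L hf]
  have : sideHeights ω L ⊆ Ioi 0 := fun y hy => hy.1
  rw [setIntegral_eq_of_subset_of_forall_sdiff_eq_zero measurableSet_Ioi this (fun y hy => ?_)]
  · refine setIntegral_congr_fun (measurableSet_sideHeights ω L) fun y hy => ?_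
    rw [intervalIntegral.integral_of_le (by linarith [hy.2]), integral_Ioc_eq_integral_Ioo]
  · rw [Ioo_halfWidth_eq_empty (fun h => hy.2 ⟨hy.1, h⟩)]; simp

lemma integrable_test {μ : Measure Plane} [IsFiniteMeasureOnCompacts μ] {w : Plane → ℝ}
    (hw : Continuous w) (hc : HasCompactSupport w) : Integrable w μ :=
  hw.integrable_of_hasCompactSupport hc

lemma integrableOn_curve {w : Plane → ℝ} (hw : Continuous w) (hc : HasCompactSupport w)
    {f : ℝ → ℝ} (hf : Continuous f) (S : Set ℝ) : IntegrableOn (fun y => w (pt (f y) y)) S :=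
  ((hw.comp (hf.pt continuous_id)).integrable_of_hasCompactSupport
    (hasCompactSupport_curve hc hf)).integrableOn

lemma continuous_neg_halfWidth (ω L : ℝ) : Continuous fun y => -halfWidth ω L y :=
  (continuous_halfWidth ω L).neg

theorem integral_pderivAt_zero {ω : ℝ} (h0 : 0 < ω) (hπ : ω < π) (L : ℝ) {w : Plane → ℝ}
    (hw : ContDiff ℝ ((⊤ : ℕ∞) : WithTop ℕ∞) w) (hc : HasCompactSupport w) :
    ∫ x in twoCornerDomain ω L, pderivAt 0 w x =
      (∫ y in sideHeights ω L, w (pt (halfWidth ω L y) y)) -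
        ∫ y in sideHeights ω L, w (pt (-halfWidth ω L y) y) := by
  have hd := continuous_pderivAt hw 0
  rw [integral_slices h0 hπ L (integrable_test hd (hasCompactSupport_pderivAt hc 0)).integrableOn,
    ← integral_sub (integrableOn_curve hw.continuous hc (continuous_halfWidth ω L) _)
      (integrableOn_curve hw.continuous hc (continuous_neg_halfWidth ω L) _)]
  refine setIntegral_congr_fun (measurableSet_sideHeights ω L) fun y _ => ?_
  refine intervalIntegral.integral_eq_sub_of_hasDerivAt (f := fun x => w (pt x y))
    (fun x _ => ?_) (hd.comp (continuous_id.pt continuous_const)).continuousOn.intervalIntegrable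
  have := hasDerivAt_comp_pt (hw.differentiable (by simp)) (hasDerivAt_id x)
    (hasDerivAt_const x y)
  simpa using this

/-- Each row is rescaled to ξ in [-1, 1], so that the row integral G(y) has fixed limits and can be
differentiated under the integral sign. The slope of the sides then produces the lateral boundary
terms, and integrating G' from 0 to T leaves only the bottom, since G(T) = 0. -/
theorem integral_pderivAt_one {ω : ℝ} (h0 : 0 < ω) (hπ : ω < π) {L : ℝ} (hL : 0 < L)
    {w : Plane → ℝ} (hw : ContDiff ℝ ((⊤ : ℕ∞) : WithTop ℕ∞) w) (hc : HasCompactSupport w) :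
    ∫ x in twoCornerDomain ω L, pderivAt 1 w x =
      -(∫ x in Ioo (-L) L, w (pt x 0)) + (cos ω / sin ω) *
        ((∫ y in sideHeights ω L, w (pt (halfWidth ω L y) y)) +
          ∫ y in sideHeights ω L, w (pt (-halfWidth ω L y) y)) := by
  have hd0 := continuous_pderivAt hw 0
  have hd1 := continuous_pderivAt hw 1
  have hdw : Differentiable ℝ w := hw.differentiable (by simp)
  have hm := continuous_halfWidth ω L
  have hmn := continuous_neg_halfWidth ω L
  set m := halfWidth ω L with hmdef
  set c := cos ω / sin ω with hcdef
  set g : ℝ → ℝ → ℝ := fun y ξ => m y * w (pt (m y * ξ) y) with hg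
  set g' : ℝ → ℝ → ℝ := fun y ξ => -c * w (pt (m y * ξ) y) + m y *
    (-c * ξ * pderivAt 0 w (pt (m y * ξ) y) + 1 * pderivAt 1 w (pt (m y * ξ) y)) with hg'
  have hcpt : Continuous fun p : ℝ × ℝ => pt (m p.1 * p.2) p.1 :=
    ((hm.comp continuous_fst).mul continuous_snd).pt continuous_fst
  have hgc : Continuous (Function.uncurry g) :=
    (hm.comp continuous_fst).mul (hw.continuous.comp hcpt)
  have hgc' : Continuous (Function.uncurry g') := by
    refine (continuous_const.mul (hw.continuous.comp hcpt)).add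
      ((hm.comp continuous_fst).mul ?_)
    exact ((continuous_const.mul continuous_snd).mul (hd0.comp hcpt)).add
      (continuous_const.mul (hd1.comp hcpt))
  have hgd : ∀ y ξ, HasDerivAt (fun y => g y ξ) (g' y ξ) y := fun y ξ => by
    have h1 := hasDerivAt_halfWidth ω L y
    exact h1.mul (hasDerivAt_comp_pt hdw (h1.mul_const ξ) (hasDerivAt_id y))
  set G : ℝ → ℝ := fun y => ∫ ξ in (-1 : ℝ)..1, g y ξ with hG
  have hGd : ∀ y, HasDerivAt G (∫ ξ in (-1 : ℝ)..1, g' y ξ) y := fun y =>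
    hasDerivAt_intervalIntegral_param hgc hgc' hgd (-1) 1 y
  have hGcont' : Continuous fun y => ∫ ξ in (-1 : ℝ)..1, g' y ξ :=
    intervalIntegral.continuous_parametric_intervalIntegral_of_continuous' hgc' _ _
  have hGrow : ∀ y, G y = ∫ x in (-m y)..(m y), w (pt x y) := fun y => by
    simp only [hG, hg]
    rw [intervalIntegral.integral_const_mul,
      intervalIntegral.mul_integral_comp_mul_left (f := fun x => w (pt x y))]
    simp
  have hGval : ∀ y, ∫ ξ in (-1 : ℝ)..1, g' y ξ =
      (∫ x in (-m y)..(m y), pderivAt 1 w (pt x y)) -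
        c * (w (pt (m y) y) + w (pt (-m y) y)) := fun y => by
    have hk : Continuous fun ξ : ℝ => pt (m y * ξ) y :=
      (continuous_const.mul continuous_id).pt continuous_const
    -- The terms caused by the changing width form the exact derivative of ξ w(m ξ, y), hence
    -- integrate to values on the two sides.
    have e1 : ∫ ξ in (-1 : ℝ)..1, (1 * w (pt (m y * ξ) y) + ξ *
        (m y * pderivAt 0 w (pt (m y * ξ) y))) = w (pt (m y) y) + w (pt (-m y) y) := by
      rw [intervalIntegral.integral_eq_sub_of_hasDerivAt (f := fun ξ => ξ * w (pt (m y * ξ) y))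
        (fun ξ _ => ?_) (Continuous.intervalIntegrable ?_ _ _)]
      · simp
      · exact (continuous_const.mul (hw.continuous.comp hk)).add
          (continuous_id.mul (continuous_const.mul (hd0.comp hk)))
      · have h1 := hasDerivAt_comp_pt hdw ((hasDerivAt_id ξ).const_mul (m y))
          (hasDerivAt_const ξ y)
        simp only [mul_one, zero_mul, add_zero, id] at h1
        exact (hasDerivAt_id ξ).mul h1
    have e2 : ∫ ξ in (-1 : ℝ)..1, m y * pderivAt 1 w (pt (m y * ξ) y)
        = ∫ x in (-m y)..(m y), pderivAt 1 w (pt x y) := by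
      rw [intervalIntegral.integral_const_mul,
        intervalIntegral.mul_integral_comp_mul_left (f := fun x => pderivAt 1 w (pt x y))]
      simp
    rw [← e1, ← e2, ← intervalIntegral.integral_const_mul, ← intervalIntegral.integral_sub]
    · refine intervalIntegral.integral_congr fun ξ _ => ?_
      simp only [hg']
      ring
    · exact (continuous_const.mul (hd1.comp hk)).intervalIntegrable _ _
    · exact (continuous_const.mul ((continuous_const.mul (hw.continuous.comp hk)).add
          (continuous_id.mul (continuous_const.mul (hd0.comp hk))))).intervalIntegrable _ _
  obtain ⟨T, hT, hT1, hT2, hT3⟩ := exists_height h0 hπ hL hc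
  have hGT : G T = 0 := by
    rw [hGrow]
    rcases hT3 with h | h
    · rw [hmdef, h]; simp
    · simp [fun x => image_eq_zero_of_notMem_tsupport (h x)]
  have hG0 : G 0 = ∫ x in Ioo (-L) L, w (pt x 0) := by
    have : m 0 = L := by simp [hmdef, halfWidth]
    rw [hGrow, this, intervalIntegral.integral_of_le (by linarith), integral_Ioc_eq_integral_Ioo]
  have hFTC : ∫ y in (0 : ℝ)..T, (∫ ξ in (-1 : ℝ)..1, g' y ξ) = G T - G 0 :=
    intervalIntegral.integral_eq_sub_of_hasDerivAt (fun y _ => hGd y)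
      (hGcont'.intervalIntegrable _ _)
  have hrestr : ∀ f : ℝ → ℝ, (∀ y, (∀ x, pt x y ∉ tsupport w) → f y = 0) →
      ∫ y in sideHeights ω L, f y = ∫ y in (0 : ℝ)..T, f y := fun f hf => by
    rw [intervalIntegral.integral_of_le hT.le, integral_Ioc_eq_integral_Ioo]
    refine setIntegral_eq_of_subset_of_forall_sdiff_eq_zero (measurableSet_sideHeights ω L) hT1
      fun y hy => hf y (hT2 y hy.1 ?_)
    by_contra! hlt
    exact hy.2 ⟨hy.1.1, hlt⟩
  rw [integral_slices h0 hπ L (integrable_test hd1 (hasCompactSupport_pderivAt hc 1)).integrableOn,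
    ← integral_add (integrableOn_curve hw.continuous hc hm _)
      (integrableOn_curve hw.continuous hc hmn _), hrestr _ ?_, hrestr _ ?_]
  · rw [← hG0, ← intervalIntegral.integral_const_mul]
    rw [hGT, zero_sub] at hFTC
    rw [← hFTC, ← intervalIntegral.integral_add]
    · refine intervalIntegral.integral_congr fun y _ => ?_
      rw [hGval]
      ring
    · exact hGcont'.intervalIntegrable _ _
    · exact (continuous_const.mul ((hw.continuous.comp (hm.pt continuous_id)).add
        (hw.continuous.comp (hmn.pt continuous_id)))).intervalIntegrable _ _
  · intro y hy
    rw [image_eq_zero_of_notMem_tsupport (hy _), image_eq_zero_of_notMem_tsupport (hy _), add_zero]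
  · intro y hy
    simp [fun x => pderivAt_eq_zero_of_notMem (hy x) 1]

/-- The flux of a vector field through the boundary. -/
noncomputable def boundaryFlux (ω L : ℝ) (F₀ F₁ : Plane → ℝ) : ℝ :=
  (∫ x in Ioo (-L) L, -F₁ (pt x 0)) +
    (1 / sin ω) * (∫ y in sideHeights ω L, (-sin ω * F₀ (pt (-halfWidth ω L y) y) +
      cos ω * F₁ (pt (-halfWidth ω L y) y))) +
    (1 / sin ω) * ∫ y in sideHeights ω L, (sin ω * F₀ (pt (halfWidth ω L y) y) +
      cos ω * F₁ (pt (halfWidth ω L y) y))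

/-- The outward normals are (0, -1) on the bottom, (-sin ω, cos ω) on the left and (sin ω, cos ω) on
the right. On the sides arc length is dy / sin ω, which is the prefactor in `boundaryFlux`. -/
theorem integral_divergence {ω : ℝ} (h0 : 0 < ω) (hπ : ω < π) {L : ℝ} (hL : 0 < L)
    {F₀ F₁ : Plane → ℝ} (h₀ : ContDiff ℝ ((⊤ : ℕ∞) : WithTop ℕ∞) F₀) (c₀ : HasCompactSupport F₀)
    (h₁ : ContDiff ℝ ((⊤ : ℕ∞) : WithTop ℕ∞) F₁) (c₁ : HasCompactSupport F₁) :
    (∫ x in twoCornerDomain ω L, pderivAt 0 F₀ x) + (∫ x in twoCornerDomain ω L, pderivAt 1 F₁ x)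
      = boundaryFlux ω L F₀ F₁ := by
  have hs : 0 < sin ω := sin_pos_of_pos_of_lt_pi h0 hπ
  have hm := continuous_halfWidth ω L
  have hmn := continuous_neg_halfWidth ω L
  have i : ∀ {w : Plane → ℝ}, ContDiff ℝ ((⊤ : ℕ∞) : WithTop ℕ∞) w → HasCompactSupport w → ∀ {f : ℝ → ℝ},
      Continuous f → ∀ a : ℝ, Integrable (fun y => a * w (pt (f y) y))
        (volume.restrict (sideHeights ω L)) := fun hw hc _ hf a =>
    (integrableOn_curve hw.continuous hc hf _).const_mul a
  rw [integral_pderivAt_zero h0 hπ L h₀ c₀, integral_pderivAt_one h0 hπ hL h₁ c₁, boundaryFlux,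
    integral_add (i h₀ c₀ hmn _) (i h₁ c₁ hmn _), integral_add (i h₀ c₀ hm _) (i h₁ c₁ hm _)]
  simp only [integral_const_mul, integral_neg]
  field_simp
  ring

end Divergence

/-! ### The spectral gap for exponential weights -/

section ExponentialGap

lemma integral_lincomb₃ {Z : Type*} [MeasurableSpace Z] {μ : Measure Z} {f g h : Z → ℝ}
    (hf : Integrable f μ) (hg : Integrable g μ) (hh : Integrable h μ) (a b c : ℝ) :
    ∫ x, (a * f x + b * g x + c * h x) ∂μ = a * (∫ x, f x ∂μ) + b * (∫ x, g x ∂μ) +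
      c * ∫ x, h x ∂μ := by
  have h1 : Integrable (fun x => a * f x + b * g x) μ := (hf.const_mul a).add (hg.const_mul b)
  rw [integral_add h1 (hh.const_mul c), integral_add (hf.const_mul a) (hg.const_mul b),
    integral_const_mul, integral_const_mul, integral_const_mul]

lemma integral_exp_sq {k : ℝ} (hk : 0 < k) :
    ∫ s in Ioi (0 : ℝ), exp (-k * s) * exp (-k * s) = 1 / (2 * k) := by
  have : ∀ s : ℝ, exp (-k * s) * exp (-k * s) = exp (-(2 * k) * s) := fun s => by
    rw [← exp_add]; congr 1; ring
  simp only [this]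
  rw [integral_exp_mul_Ioi (by linarith)]
  simp only [mul_zero, exp_zero]
  field_simp

lemma integrableOn_exp_sq {k : ℝ} (hk : 0 < k) :
    IntegrableOn (fun s : ℝ => exp (-k * s) * exp (-k * s)) (Ioi 0) := by
  have : ∀ s : ℝ, exp (-k * s) * exp (-k * s) = exp (-(2 * k) * s) := fun s => by
    rw [← exp_add]; congr 1; ring
  simp only [this]
  exact integrableOn_exp_mul_Ioi (by linarith) 0

/-- `f` vanishes outside `[-R, R]`. -/
def VanishesOff (R : ℝ) (f : ℝ → ℝ) : Prop := ∀ x, R < |x| → f x = 0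

lemma VanishesOff.hasCompactSupport {R : ℝ} {f : ℝ → ℝ} (h : VanishesOff R f) :
    HasCompactSupport f :=
  HasCompactSupport.intro (isCompact_closedBall (0 : ℝ) R) fun x hx => h x (by
    simpa [Metric.mem_closedBall, Real.dist_eq] using hx)

lemma VanishesOff.integrable {R : ℝ} {f : ℝ → ℝ} (h : VanishesOff R f) (hf : Continuous f)
    (S : Set ℝ) : IntegrableOn f S :=
  (hf.integrable_of_hasCompactSupport h.hasCompactSupport).integrableOn

lemma VanishesOff.mul_left {R : ℝ} {f : ℝ → ℝ} (h : VanishesOff R f) (g : ℝ → ℝ) :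
    VanishesOff R fun x => g x * f x := fun x hx => by simp only [h x hx, mul_zero]

lemma VanishesOff.mul_right {R : ℝ} {f : ℝ → ℝ} (h : VanishesOff R f) (g : ℝ → ℝ) :
    VanishesOff R fun x => f x * g x := fun x hx => by simp only [h x hx, zero_mul]

lemma VanishesOff.add {R : ℝ} {f g : ℝ → ℝ} (h : VanishesOff R f) (h' : VanishesOff R g) :
    VanishesOff R fun x => f x + g x := fun x hx => by simp only [h x hx, h' x hx, add_zero]

lemma VanishesOff.sq {R : ℝ} {f : ℝ → ℝ} (h : VanishesOff R f) :
    VanishesOff R fun x => f x ^ 2 := fun x hx => by simp only [h x hx]; norm_num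

/-- The Cauchy-Schwarz inequality against the exponential. -/
lemma sq_integral_mul_exp_le {k R : ℝ} (hk : 0 < k) {h : ℝ → ℝ} (hc : Continuous h)
    (hR : VanishesOff R h) :
    2 * k * (∫ s in Ioi 0, h s * exp (-k * s)) ^ 2 ≤ ∫ s in Ioi 0, h s ^ 2 := by
  set P := ∫ s in Ioi 0, h s * exp (-k * s) with hP
  have hec : Continuous fun s : ℝ => exp (-k * s) := by fun_prop
  have i1 : IntegrableOn (fun s => h s ^ 2) (Ioi 0) := hR.sq.integrable (hc.pow 2) _
  have i2 : IntegrableOn (fun s => h s * exp (-k * s)) (Ioi 0) :=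
    (hR.mul_right _).integrable (hc.mul hec) _
  have i3 := integrableOn_exp_sq hk
  -- The integrand is the square of h minus its projection onto the exponential. The projection
  -- coefficient is 2kP because the exponential has squared norm 1/(2k).
  have h0 : 0 ≤ ∫ s in Ioi 0, (1 * h s ^ 2 + -(4 * k * P) * (h s * exp (-k * s)) +
      (2 * k * P) ^ 2 * (exp (-k * s) * exp (-k * s))) := by
    refine integral_nonneg fun s => ?_
    have : 1 * h s ^ 2 + -(4 * k * P) * (h s * exp (-k * s)) +
      (2 * k * P) ^ 2 * (exp (-k * s) * exp (-k * s)) = (h s - 2 * k * P * exp (-k * s)) ^ 2 := by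
      ring
    simp only [this]
    positivity
  rw [integral_lincomb₃ i1 i2 i3, integral_exp_sq hk, ← hP] at h0
  have : (2 * k * P) ^ 2 * (1 / (2 * k)) = 2 * k * P ^ 2 := by field_simp
  rw [this] at h0
  linarith

/-- The spectral gap of the half-line operator with ground state `exp (-k s)`. -/
theorem halfLine_gap {k R : ℝ} (hk : 0 < k) {f f' : ℝ → ℝ} (hf : ∀ x, HasDerivAt f (f' x) x)
    (hf'c : Continuous f') (hR : VanishesOff R f) (hR' : VanishesOff R f') :
    k ^ 2 * ((∫ s in Ioi 0, f s ^ 2) - 2 * k * (∫ s in Ioi 0, f s * exp (-k * s)) ^ 2) ≤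
      ∫ s in Ioi 0, (f' s + k * f s) ^ 2 := by
  have hfc : Continuous f := continuous_iff_continuousAt.2 fun x => (hf x).continuousAt
  have hec : Continuous fun s : ℝ => exp (-k * s) := by fun_prop
  have hed : ∀ s : ℝ, HasDerivAt (fun s : ℝ => exp (-k * s)) (-k * exp (-k * s)) s := fun s => by
    have := ((hasDerivAt_id s).const_mul (-k)).exp
    simp only [id, mul_one] at this
    rwa [mul_comm] at this
  set P := ∫ s in Ioi 0, f s * exp (-k * s) with hP
  set c := f 0 with hc
  set E := fun s : ℝ => exp (-k * s) with hE
  have i1 : IntegrableOn (fun s => f s ^ 2) (Ioi 0) := hR.sq.integrable (hfc.pow 2) _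
  have i2 : IntegrableOn (fun s => f s * E s) (Ioi 0) :=
    (hR.mul_right _).integrable (hfc.mul hec) _
  have i3 : IntegrableOn (fun s => E s * E s) (Ioi 0) := integrableOn_exp_sq hk
  have i4 : IntegrableOn (fun s => (f' s + k * f s) ^ 2) (Ioi 0) :=
    (hR'.add (hR.mul_left _)).sq.integrable ((hf'c.add (continuous_const.mul hfc)).pow 2) _
  have i5 : IntegrableOn (fun s => f s * f' s) (Ioi 0) :=
    (hR.mul_right _).integrable (hfc.mul hf'c) _
  have i6 : IntegrableOn (fun s => f' s * E s) (Ioi 0) :=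
    (hR'.mul_right _).integrable (hf'c.mul hec) _
  -- With E the exponential and h = f - f(0) E, one has f' + k f = h' + k h, because E' = -k E. In
  -- the square of the right-hand side, A = k² h², and B = 2k h h' is an exact derivative that
  -- integrates to zero since h(0) = 0; the rest is h'² ≥ 0.
  set A := fun s => k ^ 2 * (f s ^ 2) + -(2 * k ^ 2 * c) * (f s * E s) +
    k ^ 2 * c ^ 2 * (E s * E s) with hA
  set B := fun s => 2 * k * (f s * f' s) + 2 * k ^ 2 * c * (f s * E s) +
    -(2 * k * c) * (f' s * E s) + -(2 * k ^ 2 * c ^ 2) * (E s * E s) with hB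
  have iA : IntegrableOn A (Ioi 0) :=
    ((i1.const_mul _).add (i2.const_mul _)).add (i3.const_mul _)
  have iB : IntegrableOn B (Ioi 0) :=
    (((i5.const_mul _).add (i2.const_mul _)).add (i6.const_mul _)).add (i3.const_mul _)
  have h1 : ∫ s in Ioi 0, (A s + B s) ≤ ∫ s in Ioi 0, (f' s + k * f s) ^ 2 := by
    refine integral_mono (iA.add iB) i4 fun s => ?_
    have : (f' s + k * f s) ^ 2 = A s + B s + (f' s + k * c * E s) ^ 2 := by
      simp only [hA, hB]; ring
    simp only [this]
    have := sq_nonneg (f' s + k * c * E s)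
    linarith
  have h2 : ∫ s in Ioi 0, B s = 0 - k * (f 0 - c * E 0) ^ 2 := by
    refine integral_Ioi_of_hasDerivAt_of_tendsto' (f := fun s => k * (f s - c * E s) ^ 2)
      (fun s _ => ?_) iB ?_
    · have := (((hf s).sub ((hed s).const_mul c)).pow 2).const_mul k
      refine this.congr_deriv ?_
      simp only [hB, hE, Pi.sub_apply]
      push_cast
      ring
    · have t1 : Tendsto f atTop (𝓝 0) := by
        refine tendsto_const_nhds.congr' ?_
        filter_upwards [eventually_gt_atTop |R|] with s hs
        exact (hR s ((le_abs_self R).trans_lt (hs.trans_le (le_abs_self s)))).symm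
      have t2 : Tendsto E atTop (𝓝 0) := by
        have : Tendsto (fun s : ℝ => k * s) atTop atTop := tendsto_id.const_mul_atTop hk
        refine (tendsto_exp_neg_atTop_nhds_zero.comp this).congr fun s => ?_
        simp [hE]
      have := ((t1.sub (t2.const_mul c)).pow 2).const_mul k
      simpa using this
  have h3 : f 0 - c * E 0 = 0 := by simp [hE, hc]
  have h4 : ∫ s in Ioi 0, A s = k ^ 2 * (∫ s in Ioi 0, f s ^ 2) + -(2 * k ^ 2 * c) * P +
      k ^ 2 * c ^ 2 * (1 / (2 * k)) := by
    simp only [hA]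
    rw [integral_lincomb₃ i1 i2 i3, show ∫ s in Ioi 0, E s * E s = 1 / (2 * k) from integral_exp_sq hk]
  rw [integral_add iA iB, h2, h3, h4] at h1
  have h5 : k ^ 2 * c ^ 2 * (1 / (2 * k)) = k ^ 2 * (2 * k * (c / (2 * k)) ^ 2) := by
    field_simp
  have h6 : 2 * k ^ 2 * c * P = k ^ 2 * (2 * k * (2 * P * (c / (2 * k)))) := by
    field_simp
  -- The multiple f(0) E need not be the projection of f onto E, but no multiple of E is closer to f
  -- than the projection.
  have h7 : 0 ≤ k ^ 2 * (2 * k * (P - c / (2 * k)) ^ 2) := by positivity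
  nlinarith

/-- `f` vanishes outside `[-R, R]²`. -/
def VanishesOff₂ (R : ℝ) (f : ℝ → ℝ → ℝ) : Prop := ∀ y s, R < |y| ∨ R < |s| → f y s = 0

lemma VanishesOff₂.row {R : ℝ} {f : ℝ → ℝ → ℝ} (h : VanishesOff₂ R f) (y : ℝ) :
    VanishesOff R (f y) := fun s hs => h y s (Or.inr hs)

lemma VanishesOff₂.slice_eq {R : ℝ} (hR : 0 ≤ R) {f : ℝ → ℝ → ℝ} (h : VanishesOff₂ R f) (y : ℝ) :
    ∫ s in Ioi 0, f y s = ∫ s in (0 : ℝ)..R, f y s := by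
  rw [intervalIntegral.integral_of_le hR]
  refine setIntegral_eq_of_subset_of_forall_sdiff_eq_zero measurableSet_Ioi
    (fun s hs => hs.1) fun s hs => h y s (Or.inr ?_)
  have h1 : 0 < s := hs.1
  rw [abs_of_pos h1]
  by_contra! hle
  exact hs.2 ⟨h1, hle⟩

lemma VanishesOff₂.continuous_slice {R : ℝ} (hR : 0 ≤ R) {f : ℝ → ℝ → ℝ}
    (h : VanishesOff₂ R f) (hf : Continuous (Function.uncurry f)) :
    Continuous fun y => ∫ s in Ioi 0, f y s := by
  simp only [h.slice_eq hR]
  exact intervalIntegral.continuous_parametric_intervalIntegral_of_continuous' hf _ _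

lemma VanishesOff₂.slice {R : ℝ} {f : ℝ → ℝ → ℝ}
    (h : VanishesOff₂ R f) : VanishesOff R fun y => ∫ s in Ioi 0, f y s := fun y hy => by
  simp [fun s => h y s (Or.inl hy)]

lemma VanishesOff₂.mul {R : ℝ} {f : ℝ → ℝ → ℝ} (h : VanishesOff₂ R f) (g : ℝ → ℝ → ℝ) :
    VanishesOff₂ R fun y s => f y s * g y s := fun y s hy => by simp only [h y s hy, zero_mul]

lemma VanishesOff₂.add {R : ℝ} {f g : ℝ → ℝ → ℝ} (h : VanishesOff₂ R f) (h' : VanishesOff₂ R g) :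
    VanishesOff₂ R fun y s => f y s + g y s := fun y s hy => by
  simp only [h y s hy, h' y s hy, add_zero]

lemma VanishesOff₂.const_mul {R : ℝ} {f : ℝ → ℝ → ℝ} (h : VanishesOff₂ R f) (c : ℝ) :
    VanishesOff₂ R fun y s => c * f y s := fun y s hy => by simp only [h y s hy, mul_zero]

lemma VanishesOff₂.sq {R : ℝ} {f : ℝ → ℝ → ℝ} (h : VanishesOff₂ R f) :
    VanishesOff₂ R fun y s => f y s ^ 2 := fun y s hy => by simp only [h y s hy]; norm_num

/-- The spectral gap in a quarter plane with ground state `exp (-k s - κ y)`. -/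
theorem quadrant_gap {k κ R : ℝ} (hk : 0 < k) (hkκ : k ≤ κ) (hR : 0 ≤ R) {W Ws Wy : ℝ → ℝ → ℝ}
    (hs : ∀ y s, HasDerivAt (fun s => W y s) (Ws y s) s)
    (hy : ∀ y s, HasDerivAt (fun y => W y s) (Wy y s) y)
    (c : Continuous (Function.uncurry W)) (cs : Continuous (Function.uncurry Ws))
    (cy : Continuous (Function.uncurry Wy)) (v : VanishesOff₂ R W) (vs : VanishesOff₂ R Ws)
    (vy : VanishesOff₂ R Wy) :
    k ^ 2 * (∫ y in Ioi 0, ∫ s in Ioi 0, W y s ^ 2) -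
        4 * k * κ ^ 3 * (∫ y in Ioi 0, ∫ s in Ioi 0, W y s * exp (-k * s) * exp (-κ * y)) ^ 2 ≤
      (∫ y in Ioi 0, ∫ s in Ioi 0, (Ws y s + k * W y s) ^ 2) +
        ∫ y in Ioi 0, ∫ s in Ioi 0, (Wy y s + κ * W y s) ^ 2 := by
  have hκ : 0 < κ := hk.trans_le hkκ
  have rc : ∀ {f : ℝ → ℝ → ℝ}, Continuous (Function.uncurry f) → ∀ y, Continuous (f y) :=
    fun hf y => hf.comp (Continuous.prodMk_right y)
  have ce : Continuous fun p : ℝ × ℝ => exp (-k * p.2) := by fun_prop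
  -- p(y) is the exponential component of the row at height y. The half-line gap in s controls the
  -- rows up to p, and the half-line gap in y, with rate κ, controls p up to the pairing with the
  -- full ground state.
  set p : ℝ → ℝ := fun y => ∫ s in Ioi 0, W y s * exp (-k * s) with hp
  set p' : ℝ → ℝ := fun y => ∫ s in Ioi 0, Wy y s * exp (-k * s) with hp'
  have vWe : VanishesOff₂ R fun y s => W y s * exp (-k * s) := v.mul _
  have vWye : VanishesOff₂ R fun y s => Wy y s * exp (-k * s) := vy.mul _
  have cWe : Continuous (Function.uncurry fun y s => W y s * exp (-k * s)) := c.mul ce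
  have cWye : Continuous (Function.uncurry fun y s => Wy y s * exp (-k * s)) := cy.mul ce
  have hpd : ∀ y, HasDerivAt p (p' y) y := fun y => by
    simp only [hp, hp', vWe.slice_eq hR, vWye.slice_eq hR]
    exact hasDerivAt_intervalIntegral_param cWe cWye (fun y s => (hy y s).mul_const _) 0 R y
  have cp : Continuous p := vWe.continuous_slice hR cWe
  have cp' : Continuous p' := vWye.continuous_slice hR cWye
  have vp : VanishesOff R p := vWe.slice
  have vp' : VanishesOff R p' := vWye.slice
  have vD : VanishesOff₂ R fun y s => Ws y s + k * W y s := vs.add (v.const_mul k)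
  have cD : Continuous (Function.uncurry fun y s => Ws y s + k * W y s) :=
    cs.add (continuous_const.mul c)
  have vF : VanishesOff₂ R fun y s => Wy y s + κ * W y s := vy.add (v.const_mul κ)
  have cF : Continuous (Function.uncurry fun y s => Wy y s + κ * W y s) :=
    cy.add (continuous_const.mul c)
  have I : ∀ {f : ℝ → ℝ → ℝ}, VanishesOff₂ R f → Continuous (Function.uncurry f) →
      IntegrableOn (fun y => ∫ s in Ioi 0, f y s ^ 2) (Ioi 0) := fun hf hc =>
    hf.sq.slice.integrable (hf.sq.continuous_slice hR (hc.pow 2)) _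
  have ip : IntegrableOn (fun y => p y ^ 2) (Ioi 0) := vp.sq.integrable (cp.pow 2) _
  have h1 : k ^ 2 * ((∫ y in Ioi 0, ∫ s in Ioi 0, W y s ^ 2) - 2 * k * ∫ y in Ioi 0, p y ^ 2) ≤
      ∫ y in Ioi 0, ∫ s in Ioi 0, (Ws y s + k * W y s) ^ 2 := by
    rw [← integral_const_mul, ← integral_sub (I v c) (ip.const_mul _), ← integral_const_mul]
    refine integral_mono (((I v c).sub (ip.const_mul _)).const_mul _) (I vD cD) fun y => ?_
    exact halfLine_gap hk (hs y) (rc cs y) (v.row y) (vs.row y)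
  have h2 := halfLine_gap hκ hpd cp' vp vp'
  have h3 : 2 * k * ∫ y in Ioi 0, (p' y + κ * p y) ^ 2 ≤
      ∫ y in Ioi 0, ∫ s in Ioi 0, (Wy y s + κ * W y s) ^ 2 := by
    rw [← integral_const_mul]
    refine integral_mono (((vp'.add (vp.mul_left _)).sq.integrable
      ((cp'.add (continuous_const.mul cp)).pow 2) _).const_mul _) (I vF cF) fun y => ?_
    have h := sq_integral_mul_exp_le hk (rc cF y) (vF.row y)
    have e : p' y + κ * p y = ∫ s in Ioi 0, (Wy y s + κ * W y s) * exp (-k * s) := by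
      simp only [hp, hp']
      rw [← integral_const_mul, ← integral_add
        ((vWye.row y).integrable (rc cWye y) _)
        (((vWe.row y).integrable (rc cWe y) _).const_mul κ)]
      refine integral_congr_ae (Eventually.of_forall fun s => ?_)
      simp only
      ring
    simp only [e]
    exact h
  have h4 : ∫ y in Ioi 0, ∫ s in Ioi 0, W y s * exp (-k * s) * exp (-κ * y)
      = ∫ y in Ioi 0, p y * exp (-κ * y) := by
    refine integral_congr_ae (Eventually.of_forall fun y => ?_)
    simp only [hp]
    rw [integral_mul_const]
  rw [h4]
  set Q := ∫ y in Ioi 0, p y * exp (-κ * y) with hQ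
  have h5 : 0 ≤ ∫ y in Ioi 0, p y ^ 2 := integral_nonneg fun y => sq_nonneg _
  -- The rows lose 2k · k² ∫ p², while the estimate for p gains 2k · κ² ∫ p². This is where k ≤ κ is
  -- needed.
  have h6 : k ^ 2 * (∫ y in Ioi 0, p y ^ 2) ≤ κ ^ 2 * ∫ y in Ioi 0, p y ^ 2 :=
    mul_le_mul_of_nonneg_right (pow_le_pow_left₀ hk.le hkκ 2) h5
  have h7 := mul_le_mul_of_nonneg_left (h2) (show 0 ≤ 2 * k by linarith)
  nlinarith

end ExponentialGap

/-! ### Test functions and their energy -/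

section TestFunctions

/-- `φ ∈ C_c^∞(ℝ²)`. -/
structure IsTest (φ : Plane → ℝ) : Prop where
  smooth : ContDiff ℝ ((⊤ : ℕ∞) : WithTop ℕ∞) φ
  compact : HasCompactSupport φ

namespace IsTest

variable {φ ψ : Plane → ℝ}

lemma continuous (h : IsTest φ) : Continuous φ := h.smooth.continuous

lemma differentiable (h : IsTest φ) : Differentiable ℝ φ := h.smooth.differentiable (by simp)

lemma continuous_pderiv (h : IsTest φ) (i : Fin 2) : Continuous (pderivAt i φ) :=
  continuous_pderivAt h.smooth i

lemma compact_pderiv (h : IsTest φ) (i : Fin 2) : HasCompactSupport (pderivAt i φ) :=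
  hasCompactSupport_pderivAt h.compact i

lemma smooth_mul (hφ : ContDiff ℝ ((⊤ : ℕ∞) : WithTop ℕ∞) φ) (h : IsTest ψ) :
    IsTest fun x => φ x * ψ x := ⟨hφ.mul h.smooth, h.compact.mul_left⟩

lemma sq (h : IsTest φ) : IsTest fun x => φ x ^ 2 :=
  ⟨h.smooth.pow 2, by
    have : (fun x => φ x ^ 2) = fun x => φ x * φ x := by ext x; ring
    rw [this]; exact h.compact.mul_left⟩

lemma integrable_mul {f : Plane → ℝ} (h : IsTest φ) (hf : Continuous f) (μ : Measure Plane)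
    [IsFiniteMeasureOnCompacts μ] : Integrable (fun x => f x * φ x) μ :=
  (hf.mul h.continuous).integrable_of_hasCompactSupport h.compact.mul_left

lemma integrable_sq (h : IsTest φ) (μ : Measure Plane) [IsFiniteMeasureOnCompacts μ] :
    Integrable (fun x => φ x ^ 2) μ :=
  h.sq.continuous.integrable_of_hasCompactSupport h.sq.compact

end IsTest

lemma contDiff_coord (i : Fin 2) :
    ContDiff ℝ ((⊤ : ℕ∞) : WithTop ℕ∞) (fun x : Plane => x i) :=
  (EuclideanSpace.proj i : Plane →L[ℝ] ℝ).contDiff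

lemma pderivAt_eq_of_hasFDerivAt {φ : Plane → ℝ} {x : Plane} {φ' : Plane →L[ℝ] ℝ}
    (h : HasFDerivAt φ φ' x) (i : Fin 2) :
    pderivAt i φ x = φ' (EuclideanSpace.single i 1) := by
  rw [pderivAt, h.fderiv]

lemma pderivAt_mul {f g : Plane → ℝ} {x : Plane} (hf : DifferentiableAt ℝ f x)
    (hg : DifferentiableAt ℝ g x) (i : Fin 2) :
    pderivAt i (fun x => f x * g x) x = f x * pderivAt i g x + g x * pderivAt i f x := by
  have h : HasFDerivAt (fun x => f x * g x) (f x • fderiv ℝ g x + g x • fderiv ℝ f x) x :=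
    hf.hasFDerivAt.mul hg.hasFDerivAt
  rw [pderivAt_eq_of_hasFDerivAt h]
  rfl

lemma pderivAt_comp {f : Plane → ℝ} {x : Plane} {θ : ℝ → ℝ} {θ' : ℝ}
    (hθ : HasDerivAt θ θ' (f x)) (hf : DifferentiableAt ℝ f x) (i : Fin 2) :
    pderivAt i (fun x => θ (f x)) x = θ' * pderivAt i f x := by
  have h : HasFDerivAt (fun x => θ (f x)) (θ' • fderiv ℝ f x) x :=
    hθ.comp_hasFDerivAt x hf.hasFDerivAt
  rw [pderivAt_eq_of_hasFDerivAt h]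
  rfl

lemma pderivAt_coord (i j : Fin 2) (x : Plane) :
    pderivAt i (fun x : Plane => x j) x = if j = i then 1 else 0 := by
  have h : HasFDerivAt (fun x : Plane => x j) (EuclideanSpace.proj j : Plane →L[ℝ] ℝ) x :=
    (EuclideanSpace.proj j : Plane →L[ℝ] ℝ).hasFDerivAt
  rw [pderivAt_eq_of_hasFDerivAt h]
  simp

/-- The Robin energy of a test function. -/
noncomputable def robinEnergy (Ω : Set Plane) (β : ℝ) (φ : Plane → ℝ) : ℝ :=
  (∫ x in Ω, pderivAt 0 φ x ^ 2) + (∫ x in Ω, pderivAt 1 φ x ^ 2) -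
    β * ∫ x in frontier Ω, φ x ^ 2 ∂(μH[1] : Measure Plane)

lemma integrable_of_continuous_compact {f : Plane → ℝ} (hf : Continuous f)
    (hc : HasCompactSupport f) (S : Set Plane) : IntegrableOn f S :=
  (hf.integrable_of_hasCompactSupport hc).integrableOn

lemma HasCompactSupport.sq {f : Plane → ℝ} (h : HasCompactSupport f) :
    HasCompactSupport fun x => f x ^ 2 := by
  have : (fun x => f x ^ 2) = fun x => f x * f x := by ext x; ring
  rw [this]; exact h.mul_left

end TestFunctions

/-! ### The reflection symmetry -/

section Reflection

/-- The reflection in the second coordinate axis. -/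
noncomputable def reflX : Plane ≃ₗᵢ[ℝ] Plane :=
  LinearIsometryEquiv.piLpCongrRight 2 ![LinearIsometryEquiv.neg ℝ, LinearIsometryEquiv.refl ℝ ℝ]

lemma reflX_zero (x : Plane) : reflX x 0 = -x 0 := rfl
lemma reflX_one (x : Plane) : reflX x 1 = x 1 := rfl

lemma reflX_reflX (x : Plane) : reflX (reflX x) = x := by
  ext i; fin_cases i
  · change reflX (reflX x) 0 = x 0
    rw [reflX_zero, reflX_zero, neg_neg]
  · rfl

lemma reflX_pt (x y : ℝ) : reflX (pt x y) = pt (-x) y := by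
  ext i; fin_cases i <;> rfl

lemma preimage_reflX_domain {ω : ℝ} (h0 : 0 < ω) (hπ : ω < π) (L : ℝ) :
    reflX ⁻¹' twoCornerDomain ω L = twoCornerDomain ω L := by
  ext x
  rw [mem_preimage, mem_twoCornerDomain_iff h0 hπ, mem_twoCornerDomain_iff h0 hπ, reflX_zero,
    reflX_one, abs_neg]

lemma preimage_reflX_frontier {ω : ℝ} (h0 : 0 < ω) (hπ : ω < π) (L : ℝ) :
    reflX ⁻¹' frontier (twoCornerDomain ω L) = frontier (twoCornerDomain ω L) := by
  have := reflX.toHomeomorph.preimage_frontier (twoCornerDomain ω L)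
  have h := preimage_reflX_domain h0 hπ L
  change reflX ⁻¹' frontier _ = frontier (reflX ⁻¹' _) at this
  rw [this, h]

lemma measurePreserving_reflX_domain {ω : ℝ} (h0 : 0 < ω) (hπ : ω < π) (L : ℝ) :
    MeasurePreserving reflX (volume.restrict (twoCornerDomain ω L))
      (volume.restrict (twoCornerDomain ω L)) := by
  have := (reflX.measurePreserving).restrict_preimage_emb
    reflX.toHomeomorph.measurableEmbedding (twoCornerDomain ω L)
  rwa [preimage_reflX_domain h0 hπ] at this

lemma measurePreserving_reflX_frontier {ω : ℝ} (h0 : 0 < ω) (hπ : ω < π) (L : ℝ) :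
    MeasurePreserving reflX ((μH[1] : Measure Plane).restrict (frontier (twoCornerDomain ω L)))
      ((μH[1] : Measure Plane).restrict (frontier (twoCornerDomain ω L))) := by
  have := (reflX.toIsometryEquiv.measurePreserving_hausdorffMeasure 1).restrict_preimage_emb
    reflX.toHomeomorph.measurableEmbedding (frontier (twoCornerDomain ω L))
  change MeasurePreserving reflX ((μH[1] : Measure Plane).restrict (reflX ⁻¹' _)) _ at this
  rwa [preimage_reflX_frontier h0 hπ] at this

lemma integral_reflX_domain {ω : ℝ} (h0 : 0 < ω) (hπ : ω < π) (L : ℝ) (f : Plane → ℝ) :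
    ∫ x in twoCornerDomain ω L, f (reflX x) = ∫ x in twoCornerDomain ω L, f x :=
  (measurePreserving_reflX_domain h0 hπ L).integral_comp
    reflX.toHomeomorph.measurableEmbedding f

lemma integral_reflX_frontier {ω : ℝ} (h0 : 0 < ω) (hπ : ω < π) (L : ℝ) (f : Plane → ℝ) :
    ∫ x in frontier (twoCornerDomain ω L), f (reflX x) ∂(μH[1] : Measure Plane)
      = ∫ x in frontier (twoCornerDomain ω L), f x ∂(μH[1] : Measure Plane) :=
  (measurePreserving_reflX_frontier h0 hπ L).integral_comp
    reflX.toHomeomorph.measurableEmbedding f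

lemma IsTest.reflX {φ : Plane → ℝ} (h : IsTest φ) : IsTest fun x => φ (reflX x) :=
  ⟨h.smooth.comp _root_.reflX.contDiff,
    h.compact.comp_isClosedEmbedding _root_.reflX.toHomeomorph.isClosedEmbedding⟩

lemma reflX_single_zero : reflX (EuclideanSpace.single 0 1) = -EuclideanSpace.single 0 1 := by
  ext i; fin_cases i
  · change reflX _ 0 = _
    rw [reflX_zero]; rfl
  · change reflX _ 1 = _
    rw [reflX_one]; simp

lemma reflX_single_one : reflX (EuclideanSpace.single 1 1) = EuclideanSpace.single 1 1 := by
  ext i; fin_cases i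
  · change reflX _ 0 = _
    rw [reflX_zero]; simp
  · change reflX _ 1 = _
    rw [reflX_one]; rfl

lemma hasFDerivAt_reflX {φ : Plane → ℝ} (h : Differentiable ℝ φ) (x : Plane) :
    HasFDerivAt (fun x => φ (reflX x))
      ((fderiv ℝ φ (reflX x)).comp (reflX.toContinuousLinearEquiv : Plane →L[ℝ] Plane)) x :=
  (h (reflX x)).hasFDerivAt.comp x
    (reflX.toContinuousLinearEquiv : Plane →L[ℝ] Plane).hasFDerivAt

lemma pderivAt_reflX_zero {φ : Plane → ℝ} (h : Differentiable ℝ φ) (x : Plane) :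
    pderivAt 0 (fun x => φ (reflX x)) x = -pderivAt 0 φ (reflX x) := by
  rw [pderivAt_eq_of_hasFDerivAt (hasFDerivAt_reflX h x)]
  change fderiv ℝ φ (reflX x) (reflX (EuclideanSpace.single 0 1)) = _
  rw [reflX_single_zero, map_neg]; rfl

lemma pderivAt_reflX_one {φ : Plane → ℝ} (h : Differentiable ℝ φ) (x : Plane) :
    pderivAt 1 (fun x => φ (reflX x)) x = pderivAt 1 φ (reflX x) := by
  rw [pderivAt_eq_of_hasFDerivAt (hasFDerivAt_reflX h x)]
  change fderiv ℝ φ (reflX x) (reflX (EuclideanSpace.single 1 1)) = _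
  rw [reflX_single_one]; rfl

lemma robinEnergy_reflX {ω : ℝ} (h0 : 0 < ω) (hπ : ω < π) (L β : ℝ) {φ : Plane → ℝ}
    (h : IsTest φ) : robinEnergy (twoCornerDomain ω L) β (fun x => φ (reflX x)) =
      robinEnergy (twoCornerDomain ω L) β φ := by
  simp only [robinEnergy, pderivAt_reflX_zero h.differentiable,
    pderivAt_reflX_one h.differentiable, neg_sq]
  rw [integral_reflX_domain h0 hπ L (fun x => pderivAt 0 φ x ^ 2),
    integral_reflX_domain h0 hπ L (fun x => pderivAt 1 φ x ^ 2),
    integral_reflX_frontier h0 hπ L (fun x => φ x ^ 2)]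

end Reflection

/-! ### Energy identities -/

section EnergyIdentities

variable {ω : ℝ} (h0 : 0 < ω) (hπ : ω < π) {L : ℝ} (hL : 0 < L)

include h0 hπ hL

/-- Completing the square with a vector field whose flux density through the boundary is `β`. -/
theorem robinEnergy_eq_of_field (β : ℝ) {F₀ F₁ v : Plane → ℝ}
    (hF₀ : ContDiff ℝ ((⊤ : ℕ∞) : WithTop ℕ∞) F₀) (hF₁ : ContDiff ℝ ((⊤ : ℕ∞) : WithTop ℕ∞) F₁)
    (hv : IsTest v) (hb : ∀ x, v (pt x 0) ≠ 0 → -F₁ (pt x 0) = β)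
    (hl : ∀ y ∈ sideHeights ω L, v (pt (-halfWidth ω L y) y) ≠ 0 →
      -sin ω * F₀ (pt (-halfWidth ω L y) y) + cos ω * F₁ (pt (-halfWidth ω L y) y) = β)
    (hr : ∀ y ∈ sideHeights ω L, v (pt (halfWidth ω L y) y) ≠ 0 →
      sin ω * F₀ (pt (halfWidth ω L y) y) + cos ω * F₁ (pt (halfWidth ω L y) y) = β) :
    robinEnergy (twoCornerDomain ω L) β v =
      (∫ x in twoCornerDomain ω L, (pderivAt 0 v x - F₀ x * v x) ^ 2) +
        (∫ x in twoCornerDomain ω L, (pderivAt 1 v x - F₁ x * v x) ^ 2) -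
        ∫ x in twoCornerDomain ω L,
          (pderivAt 0 F₀ x + pderivAt 1 F₁ x + F₀ x ^ 2 + F₁ x ^ 2) * v x ^ 2 := by
  have t0 : IsTest fun x => F₀ x * v x ^ 2 := IsTest.smooth_mul hF₀ hv.sq
  have t1 : IsTest fun x => F₁ x * v x ^ 2 := IsTest.smooth_mul hF₁ hv.sq
  have hdiv := integral_divergence h0 hπ hL t0.smooth t0.compact t1.smooth t1.compact
  have hfr := integral_frontier h0 hπ hL hv.sq.continuous hv.sq.compact
  -- Where v is nonzero on the boundary, F has normal component β, so the flux of F v² is exactly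
  -- the Robin term. The divergence theorem turns it into ∫ (div F) v² + 2 v F · ∇v, and completing
  -- the square gives the claim.
  have hflux : boundaryFlux ω L (fun x => F₀ x * v x ^ 2) (fun x => F₁ x * v x ^ 2) =
      β * ∫ x in frontier (twoCornerDomain ω L), v x ^ 2 ∂(μH[1] : Measure Plane) := by
    have b1 : ∫ x in Ioo (-L) L, -(F₁ (pt x 0) * v (pt x 0) ^ 2) =
        β * ∫ x in Ioo (-L) L, v (pt x 0) ^ 2 := by
      rw [← integral_const_mul]
      refine integral_congr_ae (Eventually.of_forall fun x => ?_)
      by_cases hx : v (pt x 0) = 0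
      · simp [hx]
      · simp only [← hb x hx]; ring
    have b2 : ∫ y in sideHeights ω L, (-sin ω * (F₀ (pt (-halfWidth ω L y) y) *
        v (pt (-halfWidth ω L y) y) ^ 2) + cos ω * (F₁ (pt (-halfWidth ω L y) y) *
        v (pt (-halfWidth ω L y) y) ^ 2)) =
        β * ∫ y in sideHeights ω L, v (pt (-halfWidth ω L y) y) ^ 2 := by
      rw [← integral_const_mul]
      refine setIntegral_congr_fun (measurableSet_sideHeights ω L) fun y hy => ?_
      by_cases hx : v (pt (-halfWidth ω L y) y) = 0
      · simp [hx]
      · simp only [← hl y hy hx]; ring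
    have b3 : ∫ y in sideHeights ω L, (sin ω * (F₀ (pt (halfWidth ω L y) y) *
        v (pt (halfWidth ω L y) y) ^ 2) + cos ω * (F₁ (pt (halfWidth ω L y) y) *
        v (pt (halfWidth ω L y) y) ^ 2)) =
        β * ∫ y in sideHeights ω L, v (pt (halfWidth ω L y) y) ^ 2 := by
      rw [← integral_const_mul]
      refine setIntegral_congr_fun (measurableSet_sideHeights ω L) fun y hy => ?_
      by_cases hx : v (pt (halfWidth ω L y) y) = 0
      · simp [hx]
      · simp only [← hr y hy hx]; ring
    rw [hfr, boundaryFlux, b1, b2, b3]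
    ring
  have hdF₀ : Differentiable ℝ F₀ := hF₀.differentiable (by simp)
  have hdF₁ : Differentiable ℝ F₁ := hF₁.differentiable (by simp)
  have cv := hv.continuous
  have cF₀ := hF₀.continuous
  have cF₁ := hF₁.continuous
  have c0 := hv.continuous_pderiv 0
  have c1 := hv.continuous_pderiv 1
  have k0 := continuous_pderivAt hF₀ 0
  have k1 := continuous_pderivAt hF₁ 1
  have i1 : IntegrableOn (fun x => pderivAt 0 v x ^ 2) (twoCornerDomain ω L) :=
    integrable_of_continuous_compact (c0.pow 2) (hv.compact_pderiv 0).sq _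
  have i2 : IntegrableOn (fun x => pderivAt 1 v x ^ 2) (twoCornerDomain ω L) :=
    integrable_of_continuous_compact (c1.pow 2) (hv.compact_pderiv 1).sq _
  have hvc : ∀ i, HasCompactSupport fun x => v x * pderivAt i v x := fun i => hv.compact.mul_right
  have e0 : ∀ x, pderivAt 0 (fun x => F₀ x * v x ^ 2) x =
      pderivAt 0 F₀ x * v x ^ 2 + 2 * F₀ x * (v x * pderivAt 0 v x) := fun x => by
    rw [pderivAt_mul (hdF₀ x) (hv.sq.differentiable x),
      pderivAt_comp (θ := fun t => t ^ 2) (hasDerivAt_pow 2 (v x)) (hv.differentiable x)]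
    push_cast; ring
  have e1 : ∀ x, pderivAt 1 (fun x => F₁ x * v x ^ 2) x =
      pderivAt 1 F₁ x * v x ^ 2 + 2 * F₁ x * (v x * pderivAt 1 v x) := fun x => by
    rw [pderivAt_mul (hdF₁ x) (hv.sq.differentiable x),
      pderivAt_comp (θ := fun t => t ^ 2) (hasDerivAt_pow 2 (v x)) (hv.differentiable x)]
    push_cast; ring
  have j0 : IntegrableOn (fun x => pderivAt 0 F₀ x * v x ^ 2 + 2 * F₀ x * (v x * pderivAt 0 v x))
      (twoCornerDomain ω L) := integrable_of_continuous_compact (by fun_prop)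
        (hv.sq.compact.mul_left.add (hvc 0).mul_left) _
  have j1 : IntegrableOn (fun x => pderivAt 1 F₁ x * v x ^ 2 + 2 * F₁ x * (v x * pderivAt 1 v x))
      (twoCornerDomain ω L) := integrable_of_continuous_compact (by fun_prop)
        (hv.sq.compact.mul_left.add (hvc 1).mul_left) _
  have q0 : IntegrableOn (fun x => (pderivAt 0 v x - F₀ x * v x) ^ 2) (twoCornerDomain ω L) :=
    integrable_of_continuous_compact (by fun_prop)
      ((hv.compact_pderiv 0).sub hv.compact.mul_left).sq _
  have q1 : IntegrableOn (fun x => (pderivAt 1 v x - F₁ x * v x) ^ 2) (twoCornerDomain ω L) :=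
    integrable_of_continuous_compact (by fun_prop)
      ((hv.compact_pderiv 1).sub hv.compact.mul_left).sq _
  have i12 : IntegrableOn (fun x => pderivAt 0 v x ^ 2 + pderivAt 1 v x ^ 2)
      (twoCornerDomain ω L) := i1.add i2
  have j01 : IntegrableOn (fun x => pderivAt 0 F₀ x * v x ^ 2 + 2 * F₀ x * (v x * pderivAt 0 v x) +
      (pderivAt 1 F₁ x * v x ^ 2 + 2 * F₁ x * (v x * pderivAt 1 v x)))
      (twoCornerDomain ω L) := j0.add j1
  have q01 : IntegrableOn (fun x => (pderivAt 0 v x - F₀ x * v x) ^ 2 +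
      (pderivAt 1 v x - F₁ x * v x) ^ 2) (twoCornerDomain ω L) := q0.add q1
  have d01 : IntegrableOn (fun x => (pderivAt 0 F₀ x + pderivAt 1 F₁ x + F₀ x ^ 2 + F₁ x ^ 2) *
      v x ^ 2) (twoCornerDomain ω L) :=
    integrable_of_continuous_compact (by fun_prop) hv.sq.compact.mul_left _
  rw [hflux] at hdiv
  rw [robinEnergy, ← hdiv]
  simp only [e0, e1]
  rw [← integral_add i1 i2, ← integral_add q0 q1, ← integral_add j0 j1,
    ← integral_sub i12 j01, ← integral_sub q01 d01]
  refine integral_congr_ae (Eventually.of_forall fun x => ?_)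
  simp only
  ring

omit h0 hπ hL in
/-- The IMS localization formula. -/
theorem robinEnergy_ims {Ω : Set Plane}
    [IsFiniteMeasureOnCompacts ((μH[1] : Measure Plane).restrict (frontier Ω))] (β : ℝ)
    {ι : Type*} [Fintype ι] {χ : ι → Plane → ℝ}
    (hχ : ∀ j, ContDiff ℝ ((⊤ : ℕ∞) : WithTop ℕ∞) (χ j)) (hsum : ∀ x, ∑ j, χ j x ^ 2 = 1)
    {φ : Plane → ℝ} (hφ : IsTest φ) :
    robinEnergy Ω β φ = ∑ j, robinEnergy Ω β (fun x => χ j x * φ x) -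
      ∫ x in Ω, (∑ j, (pderivAt 0 (χ j) x ^ 2 + pderivAt 1 (χ j) x ^ 2)) * φ x ^ 2 := by
  have hd : ∀ j, Differentiable ℝ (χ j) := fun j => (hχ j).differentiable (by simp)
  have hc : ∀ j, Continuous (χ j) := fun j => (hχ j).continuous
  have hk : ∀ j i, Continuous (pderivAt i (χ j)) := fun j i => continuous_pderivAt (hχ j) i
  have cφ := hφ.continuous
  have ck := fun i => hφ.continuous_pderiv i
  -- Differentiating ∑ χ² = 1 shows that the cross terms in the localized gradients cancel.
  have hz : ∀ (i : Fin 2) x, ∑ j, χ j x * pderivAt i (χ j) x = 0 := fun i x => by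
    have h1 : HasFDerivAt (fun x => ∑ j, χ j x ^ 2)
        (∑ j, (2 * χ j x) • fderiv ℝ (χ j) x) x := by
      refine HasFDerivAt.fun_sum fun j _ => ?_
      simpa using (hd j x).hasFDerivAt.pow 2
    have h2 : HasFDerivAt (fun x => ∑ j, χ j x ^ 2) (0 : Plane →L[ℝ] ℝ) x := by
      simp only [hsum]; exact hasFDerivAt_const _ _
    have h3 := congrArg (fun T : Plane →L[ℝ] ℝ => T (EuclideanSpace.single i 1))
      (h1.unique h2)
    simp only [sum_apply, smul_apply, smul_eq_mul, zero_apply, mul_assoc,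
      ← Finset.mul_sum] at h3
    have h4 : (2 : ℝ) * ∑ j, χ j x * pderivAt i (χ j) x = 0 := h3
    linarith
  have hgrad : ∀ i : Fin 2, ∑ j, ∫ x in Ω, pderivAt i (fun x => χ j x * φ x) x ^ 2 =
      (∫ x in Ω, pderivAt i φ x ^ 2) + ∫ x in Ω, (∑ j, pderivAt i (χ j) x ^ 2) * φ x ^ 2 := by
    intro i
    have hci := hk
    have hcp := ck i
    rw [← integral_finsetSum _ (fun j _ => ?_), ← integral_add]
    · refine integral_congr_ae (Eventually.of_forall fun x => ?_)
      simp only [pderivAt_mul (hd _ x) (hφ.differentiable x)]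
      have : ∀ j, (χ j x * pderivAt i φ x + φ x * pderivAt i (χ j) x) ^ 2 =
          χ j x ^ 2 * pderivAt i φ x ^ 2 + (χ j x * pderivAt i (χ j) x) *
            (2 * φ x * pderivAt i φ x) + pderivAt i (χ j) x ^ 2 * φ x ^ 2 := fun j => by ring
      simp only [this, Finset.sum_add_distrib, ← Finset.sum_mul, hsum, hz]
      ring
    · exact integrable_of_continuous_compact (hcp.pow 2) (hφ.compact_pderiv i).sq _
    · exact integrable_of_continuous_compact (by fun_prop) hφ.sq.compact.mul_left _
    · have ht := IsTest.smooth_mul (hχ j) hφ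
      exact integrable_of_continuous_compact ((ht.continuous_pderiv i).pow 2)
        (ht.compact_pderiv i).sq _
  have hbd : ∑ j, ∫ x in frontier Ω, (χ j x * φ x) ^ 2 ∂(μH[1] : Measure Plane) =
      ∫ x in frontier Ω, φ x ^ 2 ∂(μH[1] : Measure Plane) := by
    rw [← integral_finsetSum _ (fun j _ => (IsTest.smooth_mul (hχ j) hφ).integrable_sq _)]
    refine integral_congr_ae (Eventually.of_forall fun x => ?_)
    simp only [mul_pow, ← Finset.sum_mul, hsum, one_mul]
  have i0 : ∀ i, IntegrableOn (fun x => (∑ j, pderivAt i (χ j) x ^ 2) * φ x ^ 2) Ω := fun i =>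
    integrable_of_continuous_compact (by fun_prop) hφ.sq.compact.mul_left _
  have hsplit : ∫ x in Ω, (∑ j, (pderivAt 0 (χ j) x ^ 2 + pderivAt 1 (χ j) x ^ 2)) * φ x ^ 2 =
      (∫ x in Ω, (∑ j, pderivAt 0 (χ j) x ^ 2) * φ x ^ 2) +
        ∫ x in Ω, (∑ j, pderivAt 1 (χ j) x ^ 2) * φ x ^ 2 := by
    rw [← integral_add (i0 0) (i0 1)]
    refine integral_congr_ae (Eventually.of_forall fun x => ?_)
    simp only [Finset.sum_add_distrib]
    ring
  rw [hsplit]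
  simp only [robinEnergy, Finset.sum_sub_distrib, Finset.sum_add_distrib, ← Finset.mul_sum, hbd,
    hgrad]
  ring

end EnergyIdentities

/-! ### The corner -/

section Corner

/-- The decay rate of the corner state along the bottom side. -/
noncomputable def cornerRate (β ω : ℝ) : ℝ := β * (1 + cos ω) / sin ω

/-- The ground state of the infinite sector with vertex `(-L, 0)`. -/
noncomputable def cornerState (β ω L : ℝ) (x : Plane) : ℝ :=
  exp (-cornerRate β ω * (x 0 + L) - β * x 1)

variable {ω : ℝ} (h0 : 0 < ω) (hπ : ω < π)

include h0 hπ

lemma one_add_cos_pos : 0 < 1 + cos ω := by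
  have := cos_lt_cos_of_nonneg_of_le_pi h0.le le_rfl hπ
  rw [cos_pi] at this
  linarith

lemma cornerRate_pos {β : ℝ} (hβ : 0 < β) : 0 < cornerRate β ω :=
  div_pos (mul_pos hβ (one_add_cos_pos h0 hπ)) (sin_pos_of_pos_of_lt_pi h0 hπ)

lemma cornerRate_mul_sin (β : ℝ) : cornerRate β ω * sin ω = β * (1 + cos ω) := by
  have := (sin_pos_of_pos_of_lt_pi h0 hπ).ne'
  unfold cornerRate; field_simp

/-- By half-angle formulas k = β cot(ω/2). The corner state decays with rates (k, β), so its energy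
is minus the sum of their squares. -/
lemma sectorEnergy_eq (β : ℝ) : sectorEnergy β (ω / 2) = -(cornerRate β ω ^ 2 + β ^ 2) := by
  have hs := (sin_pos_of_pos_of_lt_pi h0 hπ).ne'
  have h1 := sin_sq_add_cos_sq ω
  have h2 : sin (ω / 2) ^ 2 = (1 - cos ω) / 2 := by
    rw [sin_sq_eq_half_sub, mul_div_cancel₀ _ (by norm_num : (2 : ℝ) ≠ 0)]; ring
  have h3 : sin ω ^ 2 = (1 - cos ω) * (1 + cos ω) := by linear_combination h1
  have h4 : 1 - cos ω ≠ 0 := fun h => hs (by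
    rw [h, zero_mul] at h3; exact pow_eq_zero_iff (two_ne_zero) |>.1 h3)
  have h5 := (one_add_cos_pos h0 hπ).ne'
  rw [sectorEnergy, h2, cornerRate, div_pow, h3]
  field_simp
  ring

/-- When f vanishes to the right of the right side, nothing is lost by continuing each row to
infinity. In the coordinates y and s, the horizontal distance from the left side, the domain becomes
a quarter plane with unit Jacobian. -/
lemma integral_corner_coords {L : ℝ} {f : Plane → ℝ} (hf : Continuous f)
    (hc : HasCompactSupport f)
    (hz : ∀ x y, 0 < y → halfWidth ω L y ≤ x → f (pt x y) = 0) :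
    ∫ x in twoCornerDomain ω L, f x =
      ∫ y in Ioi 0, ∫ s in Ioi 0, f (pt (-halfWidth ω L y + s) y) := by
  rw [integral_twoCornerDomain h0 hπ L (integrable_of_continuous_compact hf hc _)]
  refine setIntegral_congr_fun measurableSet_Ioi fun y hy => ?_
  rw [← setIntegral_eq_of_subset_of_forall_sdiff_eq_zero
    (measurableSet_Ioi (a := -halfWidth ω L y)) (fun x hx => hx.1) (fun x hx => ?_),
    ← integral_indicator measurableSet_Ioi, ← integral_indicator measurableSet_Ioi,
    ← integral_add_left_eq_self _ (-halfWidth ω L y)]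
  · congr 1
    ext s
    by_cases hs : 0 < s
    · rw [indicator_of_mem (show s ∈ Ioi 0 from hs), indicator_of_mem]
      simp only [mem_Ioi]; linarith
    · rw [indicator_of_notMem (show s ∉ Ioi 0 from hs), indicator_of_notMem]
      simp only [mem_Ioi]; linarith
  · refine hz x y hy ?_
    by_contra! hlt
    exact hx.2 ⟨hx.1, hlt⟩

/-- The energy of a test function near the left corner. -/
lemma robinEnergy_corner_eq {L : ℝ} (hL : 0 < L) (β : ℝ) {v : Plane → ℝ} (hv : IsTest v)
    (hz : ∀ x y, 0 < y → halfWidth ω L y ≤ x → pt x y ∉ tsupport v) :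
    robinEnergy (twoCornerDomain ω L) β v =
      (∫ x in twoCornerDomain ω L, (pderivAt 0 v x + cornerRate β ω * v x) ^ 2) +
        (∫ x in twoCornerDomain ω L, (pderivAt 1 v x + β * v x) ^ 2) +
        sectorEnergy β (ω / 2) * ∫ x in twoCornerDomain ω L, v x ^ 2 := by
  have hk := cornerRate_mul_sin h0 hπ β
  -- The logarithmic gradient (-k, -β) of the corner state has normal component β on the bottom and,
  -- since k sin ω = β (1 + cos ω), on the left side as well. On the right side v vanishes.
  have := robinEnergy_eq_of_field h0 hπ hL β (F₀ := fun _ => -cornerRate β ω)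
    (F₁ := fun _ => -β) (v := v) contDiff_const contDiff_const hv (fun x _ => by ring)
    (fun y _ _ => by linarith)
    (fun y hy hne => absurd (image_eq_zero_of_notMem_tsupport (hz _ y hy.1 le_rfl)) hne)
  rw [this, sectorEnergy_eq h0 hπ]
  have e : ∀ (i : Fin 2) (c : ℝ) (x : Plane), pderivAt i (fun _ => c) x = 0 := fun i c x => by
    simp [pderivAt]
  simp only [e, neg_mul, sub_neg_eq_add, neg_sq, zero_add, integral_const_mul]
  ring

omit h0 hπ in
lemma exists_vanishesOff (L : ℝ) {v : Plane → ℝ} (hc : HasCompactSupport v) :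
    ∃ R, 0 ≤ R ∧ ∀ y s, R < |y| ∨ R < |s| → pt (-halfWidth ω L y + s) y ∉ tsupport v := by
  have hcont : Continuous fun x : Plane => (x 1, x 0 + halfWidth ω L (x 1)) :=
    (continuous_coord 1).prodMk
      ((continuous_coord 0).add ((continuous_halfWidth ω L).comp (continuous_coord 1)))
  obtain ⟨R, hR⟩ := (hc.isCompact.image hcont).isBounded.subset_closedBall 0
  refine ⟨|R|, abs_nonneg R, fun y s hys hmem => ?_⟩
  have h1 : (y, s) ∈ Metric.closedBall (0 : ℝ × ℝ) R := hR ⟨_, hmem, by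
    simp only [pt_zero, pt_one]; congr 1; ring⟩
  rw [Metric.mem_closedBall, dist_zero_right, Prod.norm_def, max_le_iff] at h1
  simp only [Real.norm_eq_abs] at h1
  have := le_abs_self R
  rcases hys with h | h <;> linarith [h1.1, h1.2]

/-- The spectral gap at a corner. -/
theorem corner_gap {β : ℝ} (hβ : 0 < β) : ∃ g > 0, ∃ D ≥ 0, ∀ L > 0, ∀ v : Plane → ℝ, IsTest v →
    (∀ x y, 0 < y → halfWidth ω L y ≤ x → pt x y ∉ tsupport v) →
    (sectorEnergy β (ω / 2) + g) * (∫ x in twoCornerDomain ω L, v x ^ 2) -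
      D * (∫ x in twoCornerDomain ω L, v x * cornerState β ω L x) ^ 2 ≤
        robinEnergy (twoCornerDomain ω L) β v := by
  have hs := sin_pos_of_pos_of_lt_pi h0 hπ
  have hk := cornerRate_pos h0 hπ hβ
  set k := cornerRate β ω with hkdef
  set c := cos ω / sin ω with hc
  -- On the row at height y one has x₀ + L = s + c y, so the corner state becomes exp(-k s - (k c +
  -- β) y), and k c + β equals k / sin ω.
  set κ := k / sin ω with hκ
  have hkκ : k ≤ κ := by
    rw [hκ, le_div_iff₀ hs]
    nlinarith [sin_le_one ω]
  have hκ' : κ = k * c + β := by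
    rw [hκ, hc, hkdef, cornerRate]
    field_simp
    linear_combination -(sin_sq_add_cos_sq ω)
  -- Cost of the shear: the y-derivative at fixed s is c ∂₀v + ∂₁v, so the sheared square is at most
  -- 2c² times the first original square plus twice the second.
  set M := 2 + 2 * c ^ 2 with hM
  have hM0 : 0 < M := by positivity
  refine ⟨k ^ 2 / M, by positivity, 4 * k * κ ^ 3 / M, by positivity, fun L hL v hv hz => ?_⟩
  obtain ⟨R, hR, hvan⟩ := exists_vanishesOff L hv.compact
  have cv := hv.continuous
  have c0 := hv.continuous_pderiv 0
  have c1 := hv.continuous_pderiv 1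
  have cm := continuous_halfWidth ω L
  have cpt : Continuous fun p : ℝ × ℝ => pt (-halfWidth ω L p.1 + p.2) p.1 :=
    ((cm.comp continuous_fst).neg.add continuous_snd).pt continuous_fst
  have hgap := quadrant_gap hk hkκ hR (W := fun y s => v (pt (-halfWidth ω L y + s) y))
    (Ws := fun y s => pderivAt 0 v (pt (-halfWidth ω L y + s) y))
    (Wy := fun y s => c * pderivAt 0 v (pt (-halfWidth ω L y + s) y) +
      pderivAt 1 v (pt (-halfWidth ω L y + s) y))
    (fun y s => by
      have := hasDerivAt_comp_pt hv.differentiable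
        ((hasDerivAt_id s).const_add (-halfWidth ω L y)) (hasDerivAt_const s y)
      simpa using this)
    (fun y s => by
      have := hasDerivAt_comp_pt hv.differentiable
        (((hasDerivAt_halfWidth ω L y).neg).add_const s) (hasDerivAt_id y)
      simpa using this)
    (cv.comp cpt) (c0.comp cpt) ((continuous_const.mul (c0.comp cpt)).add (c1.comp cpt))
    (fun y s h => image_eq_zero_of_notMem_tsupport (hvan y s h))
    (fun y s h => pderivAt_eq_zero_of_notMem (hvan y s h) 0)
    (fun y s h => by
      simp only [pderivAt_eq_zero_of_notMem (hvan y s h), mul_zero, add_zero])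
  have hΦ : ∀ y s, exp (-k * s) * exp (-κ * y) =
      cornerState β ω L (pt (-halfWidth ω L y + s) y) := fun y s => by
    rw [cornerState, ← exp_add, pt_zero, pt_one, ← hkdef, hκ', halfWidth, ← hc]
    congr 1; ring
  have cΦ : Continuous (cornerState β ω L) := by
    unfold cornerState
    exact Real.continuous_exp.comp ((continuous_const.mul ((continuous_coord 0).add
      continuous_const)).sub (continuous_const.mul (continuous_coord 1)))
  have hz0 : ∀ x y, 0 < y → halfWidth ω L y ≤ x → v (pt x y) = 0 := fun x y h1 h2 =>
    image_eq_zero_of_notMem_tsupport (hz x y h1 h2)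
  have hz1 : ∀ i x y, 0 < y → halfWidth ω L y ≤ x → pderivAt i v (pt x y) = 0 :=
    fun i x y h1 h2 => pderivAt_eq_zero_of_notMem (hz x y h1 h2) i
  have hc0 : HasCompactSupport fun x => pderivAt 0 v x + k * v x :=
    (hv.compact_pderiv 0).add hv.compact.mul_left
  have hc1 : HasCompactSupport fun x => pderivAt 1 v x + β * v x :=
    (hv.compact_pderiv 1).add hv.compact.mul_left
  have I1 : ∫ y in Ioi 0, ∫ s in Ioi 0, v (pt (-halfWidth ω L y + s) y) ^ 2 =
      ∫ x in twoCornerDomain ω L, v x ^ 2 :=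
    (integral_corner_coords h0 hπ (f := fun x => v x ^ 2) hv.sq.continuous hv.sq.compact
      (fun x y h1 h2 => by simp only [hz0 x y h1 h2]; norm_num)).symm
  have I2 : ∫ y in Ioi 0, ∫ s in Ioi 0, v (pt (-halfWidth ω L y + s) y) * exp (-k * s) *
      exp (-κ * y) = ∫ x in twoCornerDomain ω L, v x * cornerState β ω L x := by
    simp only [mul_assoc, hΦ]
    exact (integral_corner_coords h0 hπ (f := fun x => v x * cornerState β ω L x) (cv.mul cΦ)
      hv.compact.mul_right (fun x y h1 h2 => by simp only [hz0 x y h1 h2, zero_mul])).symm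
  have I3 : ∫ y in Ioi 0, ∫ s in Ioi 0, (pderivAt 0 v (pt (-halfWidth ω L y + s) y) +
      k * v (pt (-halfWidth ω L y + s) y)) ^ 2 =
      ∫ x in twoCornerDomain ω L, (pderivAt 0 v x + k * v x) ^ 2 :=
    (integral_corner_coords h0 hπ (f := fun x => (pderivAt 0 v x + k * v x) ^ 2) (by fun_prop)
      hc0.sq (fun x y h1 h2 => by simp only [hz0 x y h1 h2, hz1 0 x y h1 h2]; norm_num)).symm
  have I4 : ∫ y in Ioi 0, ∫ s in Ioi 0, (c * pderivAt 0 v (pt (-halfWidth ω L y + s) y) +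
      pderivAt 1 v (pt (-halfWidth ω L y + s) y) +
      κ * v (pt (-halfWidth ω L y + s) y)) ^ 2 =
      ∫ x in twoCornerDomain ω L, (c * pderivAt 0 v x + pderivAt 1 v x + κ * v x) ^ 2 :=
    (integral_corner_coords h0 hπ (f := fun x =>
      (c * pderivAt 0 v x + pderivAt 1 v x + κ * v x) ^ 2) (by fun_prop)
      ((((hv.compact_pderiv 0).mul_left.add (hv.compact_pderiv 1)).add hv.compact.mul_left).sq)
      (fun x y h1 h2 => by simp only [hz0 x y h1 h2, hz1 _ x y h1 h2]; norm_num)).symm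
  rw [I1, I2, I3, I4] at hgap
  have q0 : IntegrableOn (fun x => (pderivAt 0 v x + k * v x) ^ 2) (twoCornerDomain ω L) :=
    integrable_of_continuous_compact (by fun_prop) hc0.sq _
  have q1 : IntegrableOn (fun x => (pderivAt 1 v x + β * v x) ^ 2) (twoCornerDomain ω L) :=
    integrable_of_continuous_compact (by fun_prop) hc1.sq _
  have q2 : IntegrableOn (fun x => (c * pderivAt 0 v x + pderivAt 1 v x + κ * v x) ^ 2)
      (twoCornerDomain ω L) := integrable_of_continuous_compact (by fun_prop)
      ((((hv.compact_pderiv 0).mul_left.add (hv.compact_pderiv 1)).add hv.compact.mul_left).sq) _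
  have hle : ∫ x in twoCornerDomain ω L, (c * pderivAt 0 v x + pderivAt 1 v x + κ * v x) ^ 2 ≤
      2 * c ^ 2 * (∫ x in twoCornerDomain ω L, (pderivAt 0 v x + k * v x) ^ 2) +
      2 * ∫ x in twoCornerDomain ω L, (pderivAt 1 v x + β * v x) ^ 2 := by
    rw [← integral_const_mul, ← integral_const_mul, ← integral_add (q0.const_mul _)
      (q1.const_mul _)]
    refine integral_mono q2 ((q0.const_mul _).add (q1.const_mul _)) fun x => ?_
    have : c * pderivAt 0 v x + pderivAt 1 v x + κ * v x =
        c * (pderivAt 0 v x + k * v x) + (pderivAt 1 v x + β * v x) := by rw [hκ']; ring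
    simp only [this]
    nlinarith [sq_nonneg (c * (pderivAt 0 v x + k * v x) - (pderivAt 1 v x + β * v x))]
  rw [robinEnergy_corner_eq h0 hπ hL β hv hz, ← hkdef]
  set A := ∫ x in twoCornerDomain ω L, (pderivAt 0 v x + k * v x) ^ 2 with hA
  set B := ∫ x in twoCornerDomain ω L, (pderivAt 1 v x + β * v x) ^ 2 with hB
  have hA0 : 0 ≤ A := integral_nonneg fun x => sq_nonneg _
  have hB0 : 0 ≤ B := integral_nonneg fun x => sq_nonneg _
  set N := ∫ x in twoCornerDomain ω L, v x ^ 2 with hN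
  set Q := ∫ x in twoCornerDomain ω L, v x * cornerState β ω L x with hQ
  have h1 : k ^ 2 * N - 4 * k * κ ^ 3 * Q ^ 2 ≤ M * (A + B) := by
    have : 0 ≤ c ^ 2 * B := by positivity
    rw [hM]; nlinarith
  have h2 : k ^ 2 / M * N - 4 * k * κ ^ 3 / M * Q ^ 2 ≤ A + B := by
    have : k ^ 2 / M * N - 4 * k * κ ^ 3 / M * Q ^ 2 = (k ^ 2 * N - 4 * k * κ ^ 3 * Q ^ 2) / M := by
      field_simp
    rw [this, div_le_iff₀ hM0]
    linarith
  linarith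

end Corner

/-! ### Away from the corners -/

section Middle

lemma exists_deriv_smoothTransition_bound : ∃ C, 0 ≤ C ∧ ∀ x, |deriv smoothTransition x| ≤ C := by
  have hc : Continuous (deriv smoothTransition) :=
    (smoothTransition.contDiff (n := 1)).continuous_deriv le_rfl
  have hcs : HasCompactSupport (deriv smoothTransition) := by
    refine HasCompactSupport.intro (isCompact_Icc (a := (0 : ℝ)) (b := 1)) fun x hx => ?_
    rw [mem_Icc, not_and_or, not_le, not_le] at hx
    rcases hx with hx | hx
    · have : smoothTransition =ᶠ[𝓝 x] fun _ => 0 := by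
        filter_upwards [Iio_mem_nhds hx] with y hy
        exact smoothTransition.zero_of_nonpos (le_of_lt hy)
      rw [this.deriv_eq, deriv_const]
    · have : smoothTransition =ᶠ[𝓝 x] fun _ => 1 := by
        filter_upwards [Ioi_mem_nhds hx] with y hy
        exact smoothTransition.one_of_one_le (le_of_lt hy)
      rw [this.deriv_eq, deriv_const]
  obtain ⟨C, hC⟩ := hcs.exists_bound_of_continuous hc
  exact ⟨|C|, abs_nonneg C, fun x => (hC x).trans (le_abs_self C)⟩

lemma hasDerivAt_smoothTransition (x : ℝ) :
    HasDerivAt smoothTransition (deriv smoothTransition x) x :=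
  ((smoothTransition.contDiff (n := 1)).differentiable one_ne_zero x).hasDerivAt

lemma pderivAt_const_mul {f : Plane → ℝ} {x : Plane} (hf : DifferentiableAt ℝ f x) (c : ℝ)
    (i : Fin 2) : pderivAt i (fun x => c * f x) x = c * pderivAt i f x := by
  rw [pderivAt_comp (θ := fun t => c * t) ((hasDerivAt_id _).const_mul c) hf, mul_one]

variable {ω : ℝ} (h0 : 0 < ω) (hπ : ω < π)

include h0 hπ

/-- A lower bound for the energy away from the two corners. -/
theorem middle_lower (β : ℝ) {A B ν h : ℝ} (hh : 0 < h) (hβν : β ^ 2 ≤ ν)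
    (hAB : A ^ 2 + B ^ 2 ≤ ν) (hn : sin ω * A + cos ω * B = β) (hor : A = 0 ∨ cos ω ≤ 0) :
    ∃ C ≥ 0, ∀ L > 0, ∀ v : Plane → ℝ, IsTest v →
      (∀ y, 0 < y → y < h * L → v (pt (-halfWidth ω L y) y) = 0 ∧
        v (pt (halfWidth ω L y) y) = 0) →
      -(ν + C / L) * (∫ x in twoCornerDomain ω L, v x ^ 2) ≤
        robinEnergy (twoCornerDomain ω L) β v := by
  have hs := sin_pos_of_pos_of_lt_pi h0 hπ
  obtain ⟨K, hK0, hK⟩ := exists_deriv_smoothTransition_bound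
  refine ⟨|A| * K + |B + β| * (2 / h * K), by positivity, fun L hL v hv hz => ?_⟩
  -- ζ rises from 0 to 1 between heights hL/2 and hL, and ξ from -1 to 1 between x₀ = -L and x₀ = L.
  -- Both have gradient O(1/L), which is the source of the error C/L.
  set ζ : Plane → ℝ := fun x => smoothTransition (2 / (h * L) * x 1 - 1) with hζ
  set ξ : Plane → ℝ := fun x => 2 * smoothTransition (1 / (2 * L) * x 0 + 1 / 2) - 1 with hξ
  have sζ : ContDiff ℝ ((⊤ : ℕ∞) : WithTop ℕ∞) ζ :=
    smoothTransition.contDiff.comp ((contDiff_const.mul (contDiff_coord 1)).sub contDiff_const)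
  have sξ : ContDiff ℝ ((⊤ : ℕ∞) : WithTop ℕ∞) ξ :=
    (contDiff_const.mul (smoothTransition.contDiff.comp
      ((contDiff_const.mul (contDiff_coord 0)).add contDiff_const))).sub contDiff_const
  have hζ0 : ∀ x : Plane, x 1 ≤ 0 → ζ x = 0 := fun x hx => by
    refine smoothTransition.zero_of_nonpos ?_
    have : 2 / (h * L) * x 1 ≤ 0 := mul_nonpos_of_nonneg_of_nonpos (by positivity) hx
    linarith
  have hζ1 : ∀ x : Plane, h * L ≤ x 1 → ζ x = 1 := fun x hx => by
    refine smoothTransition.one_of_one_le ?_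
    have : 2 / (h * L) * (h * L) ≤ 2 / (h * L) * x 1 :=
      mul_le_mul_of_nonneg_left hx (by positivity)
    rw [div_mul_cancel₀ _ (by positivity)] at this
    linarith
  have hζI : ∀ x, 0 ≤ ζ x ∧ ζ x ≤ 1 := fun x =>
    ⟨smoothTransition.nonneg _, smoothTransition.le_one _⟩
  have hξI : ∀ x, -1 ≤ ξ x ∧ ξ x ≤ 1 := fun x => by
    have h1 := smoothTransition.nonneg (1 / (2 * L) * x 0 + 1 / 2)
    have h2 := smoothTransition.le_one (1 / (2 * L) * x 0 + 1 / 2)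
    simp only [hξ]
    exact ⟨by linarith, by linarith⟩
  have hξ1 : ∀ x : Plane, L ≤ x 0 → ξ x = 1 := fun x hx => by
    simp only [hξ]
    rw [smoothTransition.one_of_one_le]
    · norm_num
    · have : 1 / (2 * L) * L ≤ 1 / (2 * L) * x 0 := mul_le_mul_of_nonneg_left hx (by positivity)
      have e : 1 / (2 * L) * L = 1 / 2 := by field_simp
      linarith
  have hξ2 : ∀ x : Plane, x 0 ≤ -L → ξ x = -1 := fun x hx => by
    simp only [hξ]
    rw [smoothTransition.zero_of_nonpos]
    · norm_num
    · have : 1 / (2 * L) * x 0 ≤ 1 / (2 * L) * -L := mul_le_mul_of_nonneg_left hx (by positivity)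
      have e : 1 / (2 * L) * -L = -(1 / 2) := by field_simp
      linarith
  -- The field moves from (0, -β) on the bottom to (±A, B) on the sides. On the sides it is needed
  -- only at heights above hL, where ζ = 1. Either A = 0 and the sign does not matter, or cos ω ≤ 0
  -- and the sides lie in |x₀| ≥ L, where ξ = ±1.
  set F₀ : Plane → ℝ := fun x => A * (ζ x * ξ x) with hF₀
  set F₁ : Plane → ℝ := fun x => (B + β) * ζ x - β with hF₁
  have sF₀ : ContDiff ℝ ((⊤ : ℕ∞) : WithTop ℕ∞) F₀ := contDiff_const.mul (sζ.mul sξ)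
  have sF₁ : ContDiff ℝ ((⊤ : ℕ∞) : WithTop ℕ∞) F₁ := (contDiff_const.mul sζ).sub contDiff_const
  have hm : cos ω ≤ 0 → ∀ y, 0 < y → L ≤ halfWidth ω L y := fun hc y hy => by
    have : y * (cos ω / sin ω) ≤ 0 :=
      mul_nonpos_of_nonneg_of_nonpos hy.le (div_nonpos_of_nonpos_of_nonneg hc hs.le)
    unfold halfWidth; linarith
  have hyh : ∀ y ∈ sideHeights ω L, (v (pt (-halfWidth ω L y) y) ≠ 0 ∨
      v (pt (halfWidth ω L y) y) ≠ 0) → h * L ≤ y := fun y hy hne => by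
    by_contra! hlt
    obtain ⟨z1, z2⟩ := hz y hy.1 hlt
    rcases hne with hne | hne
    · exact hne z1
    · exact hne z2
  have hid := robinEnergy_eq_of_field h0 hπ hL β sF₀ sF₁ hv
    (fun x _ => by simp only [hF₁, hζ0 (pt x 0) le_rfl]; ring)
    (fun y hy hne => by
      have hy' := hyh y hy (Or.inl hne)
      simp only [hF₁, hF₀, hζ1 (pt (-halfWidth ω L y) y) hy']
      rcases hor with hA | hc
      · rw [hA] at hn ⊢; linarith
      · rw [hξ2 (pt (-halfWidth ω L y) y) (by rw [pt_zero]; linarith [hm hc y hy.1])]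
        linarith)
    (fun y hy hne => by
      have hy' := hyh y hy (Or.inr hne)
      simp only [hF₁, hF₀, hζ1 (pt (halfWidth ω L y) y) hy']
      rcases hor with hA | hc
      · rw [hA] at hn ⊢; linarith
      · rw [hξ1 (pt (halfWidth ω L y) y) (by rw [pt_zero]; linarith [hm hc y hy.1])]
        linarith)
  have dζ : ∀ (i : Fin 2) x, pderivAt i ζ x = deriv smoothTransition (2 / (h * L) * x 1 - 1) *
      (2 / (h * L)) * (if (1 : Fin 2) = i then 1 else 0) := fun i x => by
    have := pderivAt_comp (f := fun x : Plane => x 1) (x := x)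
      ((hasDerivAt_smoothTransition _).comp (x 1)
        (((hasDerivAt_id (x 1)).const_mul (2 / (h * L))).sub_const 1))
      ((contDiff_coord 1).differentiable (by simp) x) i
    rw [pderivAt_coord] at this
    simpa only [Function.comp_def, id, mul_one] using this
  have dξ : ∀ (i : Fin 2) x, pderivAt i ξ x = deriv smoothTransition (1 / (2 * L) * x 0 + 1 / 2) *
      (1 / L) * (if (0 : Fin 2) = i then 1 else 0) := fun i x => by
    have := pderivAt_comp (f := fun x : Plane => x 0) (x := x)
      ((((hasDerivAt_smoothTransition _).comp (x 0)
        (((hasDerivAt_id (x 0)).const_mul (1 / (2 * L))).add_const (1 / 2))).const_mul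
          2).sub_const 1)
      ((contDiff_coord 0).differentiable (by simp) x) i
    rw [pderivAt_coord] at this
    simp only [Function.comp_def, id, mul_one] at this
    rw [this]
    field_simp
  have hdiv : ∀ x, pderivAt 0 F₀ x + pderivAt 1 F₁ x ≤
      (|A| * K + |B + β| * (2 / h * K)) / L := fun x => by
    have tζ : DifferentiableAt ℝ ζ x := sζ.differentiable (by simp) x
    have tξ : DifferentiableAt ℝ ξ x := sξ.differentiable (by simp) x
    have e0 : pderivAt 0 F₀ x =
        A * (ζ x * (deriv smoothTransition (1 / (2 * L) * x 0 + 1 / 2) * (1 / L))) := by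
      simp only [hF₀]
      rw [pderivAt_const_mul (f := fun x => ζ x * ξ x) (tζ.mul tξ), pderivAt_mul tζ tξ, dζ, dξ]
      simp
    have e1 : pderivAt 1 F₁ x =
        (B + β) * (deriv smoothTransition (2 / (h * L) * x 1 - 1) * (2 / (h * L))) := by
      simp only [hF₁]
      rw [pderivAt_comp (θ := fun t => (B + β) * t - β)
        (((hasDerivAt_id _).const_mul (B + β)).sub_const β) tζ, dζ]
      simp
    have b0 : pderivAt 0 F₀ x ≤ |A| * (K * (1 / L)) := by
      rw [e0]
      refine (le_abs_self _).trans ?_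
      rw [abs_mul, abs_mul, abs_mul, abs_of_nonneg (hζI x).1,
        abs_of_pos (show 0 < 1 / L by positivity)]
      refine mul_le_mul_of_nonneg_left ?_ (abs_nonneg _)
      calc _ ≤ 1 * (K * (1 / L)) := by
            refine mul_le_mul (hζI x).2 ?_ (by positivity) zero_le_one
            exact mul_le_mul_of_nonneg_right (hK _) (by positivity)
        _ = _ := one_mul _
    have b1 : pderivAt 1 F₁ x ≤ |B + β| * (K * (2 / (h * L))) := by
      rw [e1]
      refine (le_abs_self _).trans ?_
      rw [abs_mul, abs_mul, abs_of_pos (show 0 < 2 / (h * L) by positivity)]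
      refine mul_le_mul_of_nonneg_left ?_ (abs_nonneg _)
      exact mul_le_mul_of_nonneg_right (hK _) (by positivity)
    have e : (|A| * K + |B + β| * (2 / h * K)) / L =
      |A| * (K * (1 / L)) + |B + β| * (K * (2 / (h * L))) := by field_simp
    rw [e]; linarith
  have hF2 : ∀ x, F₀ x ^ 2 + F₁ x ^ 2 ≤ ν := fun x => by
    obtain ⟨z1, z2⟩ := hζI x
    obtain ⟨x1, x2⟩ := hξI x
    have hξsq : ξ x ^ 2 ≤ 1 := by nlinarith
    -- Convexity of the square along the interpolation by ζ: |F|² is at most the average of its two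
    -- end values, β² and at most ν.
    have e : F₀ x ^ 2 + F₁ x ^ 2 = ζ x * (A ^ 2 * ξ x ^ 2 + B ^ 2) + (1 - ζ x) * β ^ 2 -
        ζ x * (1 - ζ x) * (A ^ 2 * ξ x ^ 2 + (B + β) ^ 2) := by
      simp only [hF₀, hF₁]; ring
    have t1 : A ^ 2 * ξ x ^ 2 + B ^ 2 ≤ ν := by nlinarith [sq_nonneg A]
    have t2 : 0 ≤ ζ x * (1 - ζ x) * (A ^ 2 * ξ x ^ 2 + (B + β) ^ 2) :=
      mul_nonneg (mul_nonneg z1 (by linarith)) (by positivity)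
    have t3 := mul_le_mul_of_nonneg_left t1 z1
    have t4 := mul_le_mul_of_nonneg_left hβν (show 0 ≤ 1 - ζ x by linarith)
    rw [e]; linarith
  have k0 := continuous_pderivAt sF₀ 0
  have k1 := continuous_pderivAt sF₁ 1
  have cF₀ := sF₀.continuous
  have cF₁ := sF₁.continuous
  have cv := hv.continuous
  have hint : ∫ x in twoCornerDomain ω L,
      (pderivAt 0 F₀ x + pderivAt 1 F₁ x + F₀ x ^ 2 + F₁ x ^ 2) * v x ^ 2 ≤
      (ν + (|A| * K + |B + β| * (2 / h * K)) / L) * ∫ x in twoCornerDomain ω L, v x ^ 2 := by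
    rw [← integral_const_mul]
    refine integral_mono (integrable_of_continuous_compact (by fun_prop) hv.sq.compact.mul_left _)
      ((hv.integrable_sq _).const_mul _) fun x => ?_
    exact mul_le_mul_of_nonneg_right (by linarith [hdiv x, hF2 x]) (sq_nonneg _)
  have p0 : 0 ≤ ∫ x in twoCornerDomain ω L, (pderivAt 0 v x - F₀ x * v x) ^ 2 :=
    integral_nonneg fun x => sq_nonneg _
  have p1 : 0 ≤ ∫ x in twoCornerDomain ω L, (pderivAt 1 v x - F₁ x * v x) ^ 2 :=
    integral_nonneg fun x => sq_nonneg _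
  rw [hid]
  linarith

end Middle

/-! ### Cutoffs at the corners -/

section Cutoffs

/-- A smooth bump around the left corner. -/
noncomputable def leftBump (ω L : ℝ) (x : Plane) : ℝ :=
  smoothTransition (4 / 3 * (1 - ((x 0 + L) ^ 2 + x 1 ^ 2) / (L * sin ω) ^ 2))

/-- The cutoff at the left corner. -/
noncomputable def leftCut (ω L : ℝ) (x : Plane) : ℝ := sin (π / 2 * leftBump ω L x)

/-- The cutoff away from both corners. -/
noncomputable def midCut (ω L : ℝ) (x : Plane) : ℝ :=
  cos (π / 2 * (leftBump ω L x + leftBump ω L (reflX x)))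

lemma contDiff_leftBump (ω L : ℝ) :
    ContDiff ℝ ((⊤ : ℕ∞) : WithTop ℕ∞) (leftBump ω L) :=
  smoothTransition.contDiff.comp (contDiff_const.mul (contDiff_const.sub
    (((((contDiff_coord 0).add contDiff_const).pow 2).add
      ((contDiff_coord 1).pow 2)).div_const _)))

lemma contDiff_leftCut (ω L : ℝ) : ContDiff ℝ ((⊤ : ℕ∞) : WithTop ℕ∞) (leftCut ω L) :=
  contDiff_sin.comp (contDiff_const.mul (contDiff_leftBump ω L))

lemma contDiff_comp_reflX {f : Plane → ℝ} (hf : ContDiff ℝ ((⊤ : ℕ∞) : WithTop ℕ∞) f) :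
    ContDiff ℝ ((⊤ : ℕ∞) : WithTop ℕ∞) fun x => f (reflX x) := hf.comp reflX.contDiff

lemma contDiff_midCut (ω L : ℝ) : ContDiff ℝ ((⊤ : ℕ∞) : WithTop ℕ∞) (midCut ω L) :=
  contDiff_cos.comp (contDiff_const.mul ((contDiff_leftBump ω L).add
    (contDiff_comp_reflX (contDiff_leftBump ω L))))

lemma leftBump_nonneg (ω L : ℝ) (x : Plane) : 0 ≤ leftBump ω L x := smoothTransition.nonneg _

lemma leftBump_le_one (ω L : ℝ) (x : Plane) : leftBump ω L x ≤ 1 := smoothTransition.le_one _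

variable {ω : ℝ} (h0 : 0 < ω) (hπ : ω < π) {L : ℝ} (hL : 0 < L)

include h0 hπ hL

lemma lt_of_leftBump_ne_zero {x : Plane} (h : leftBump ω L x ≠ 0) :
    (x 0 + L) ^ 2 + x 1 ^ 2 < (L * sin ω) ^ 2 := by
  have hs := sin_pos_of_pos_of_lt_pi h0 hπ
  by_contra! hle
  refine h (smoothTransition.zero_of_nonpos ?_)
  have : 1 ≤ ((x 0 + L) ^ 2 + x 1 ^ 2) / (L * sin ω) ^ 2 := by
    rw [le_div_iff₀ (by positivity)]; linarith
  linarith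

lemma leftBump_eq_one {x : Plane} (h : (x 0 + L) ^ 2 + x 1 ^ 2 ≤ (L * sin ω) ^ 2 / 4) :
    leftBump ω L x = 1 := by
  have hs := sin_pos_of_pos_of_lt_pi h0 hπ
  refine smoothTransition.one_of_one_le ?_
  -- The factor 4/3 in `leftBump` is chosen so that at half the radius the argument is 4/3 · (1 -
  -- 1/4) = 1.
  have : ((x 0 + L) ^ 2 + x 1 ^ 2) / (L * sin ω) ^ 2 ≤ 1 / 4 := by
    rw [div_le_iff₀ (by positivity)]; linarith
  linarith

lemma neg_of_leftBump_ne_zero {x : Plane} (h : leftBump ω L x ≠ 0) : x 0 < 0 := by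
  have hs := sin_pos_of_pos_of_lt_pi h0 hπ
  have h1 := lt_of_leftBump_ne_zero h0 hπ hL h
  have h2 : (L * sin ω) ^ 2 ≤ L ^ 2 := by
    rw [mul_pow]
    exact mul_le_of_le_one_right (sq_nonneg L) (sin_sq_le_one ω)
  by_contra! h3
  nlinarith [sq_nonneg (x 1)]

lemma leftBump_mul_refl (x : Plane) : leftBump ω L x * leftBump ω L (reflX x) = 0 := by
  by_contra h
  have h1 := neg_of_leftBump_ne_zero h0 hπ hL (left_ne_zero_of_mul h)
  have h2 := neg_of_leftBump_ne_zero h0 hπ hL (right_ne_zero_of_mul h)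
  rw [reflX_zero] at h2
  linarith

/-- At every point at most one of the two bumps is nonzero, so the identity is sin² + cos² = 1.
Trigonometric functions of the bump keep the quadratic partition smooth. -/
lemma cut_sq_sum (x : Plane) :
    leftCut ω L x ^ 2 + leftCut ω L (reflX x) ^ 2 + midCut ω L x ^ 2 = 1 := by
  unfold leftCut midCut
  rcases mul_eq_zero.1 (leftBump_mul_refl h0 hπ hL x) with h | h
  · rw [h, mul_zero, sin_zero, zero_add]
    linear_combination sin_sq_add_cos_sq (π / 2 * leftBump ω L (reflX x))
  · rw [h, mul_zero, sin_zero, add_zero]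
    linear_combination sin_sq_add_cos_sq (π / 2 * leftBump ω L x)

lemma leftCut_mul_refl (x : Plane) : leftCut ω L x * leftCut ω L (reflX x) = 0 := by
  unfold leftCut
  rcases mul_eq_zero.1 (leftBump_mul_refl h0 hπ hL x) with h | h
  · rw [h, mul_zero, sin_zero, zero_mul]
  · rw [h, mul_zero, sin_zero, mul_zero]

lemma tsupport_leftCut_subset :
    tsupport (leftCut ω L) ⊆ {x : Plane | (x 0 + L) ^ 2 + x 1 ^ 2 ≤ (L * sin ω) ^ 2} := by
  refine closure_minimal (fun x hx => ?_) ?_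
  · refine (lt_of_leftBump_ne_zero h0 hπ hL fun h => hx ?_).le
    rw [leftCut, h, mul_zero, sin_zero]
  · exact isClosed_le ((((continuous_coord 0).add continuous_const).pow 2).add
      ((continuous_coord 1).pow 2)) continuous_const

lemma hasCompactSupport_leftCut : HasCompactSupport (leftCut ω L) := by
  have hs := sin_pos_of_pos_of_lt_pi h0 hπ
  refine HasCompactSupport.of_support_subset_isCompact
    (isCompact_closedBall (pt (-L) 0) (L * sin ω)) fun x hx => ?_
  have h1 := tsupport_leftCut_subset h0 hπ hL (subset_tsupport _ hx)
  rw [Metric.mem_closedBall, EuclideanSpace.dist_eq, Fin.sum_univ_two]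
  refine Real.sqrt_le_iff.2 ⟨by positivity, ?_⟩
  rw [Real.dist_eq, Real.dist_eq, sq_abs, sq_abs, pt_zero, pt_one, sub_neg_eq_add, sub_zero]
  exact h1

/-- The line carrying the right side has distance 2L sin ω from the left corner, twice the radius of
the cutoff. -/
lemma notMem_tsupport_leftCut {x y : ℝ} (h : halfWidth ω L y ≤ x) :
    pt x y ∉ tsupport (leftCut ω L) := fun hmem => by
  have hs := sin_pos_of_pos_of_lt_pi h0 hπ
  have h1 : (x + L) ^ 2 + y ^ 2 ≤ (L * sin ω) ^ 2 := tsupport_leftCut_subset h0 hπ hL hmem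
  have h2 : 2 * (L * sin ω) ≤ (x + L) * sin ω + y * cos ω := by
    have : y * (cos ω / sin ω) * sin ω = y * cos ω := by field_simp
    unfold halfWidth at h
    nlinarith
  have h3 : ((x + L) * sin ω + y * cos ω) ^ 2 ≤ (x + L) ^ 2 + y ^ 2 := by
    have : (x + L) ^ 2 + y ^ 2 = ((x + L) * sin ω + y * cos ω) ^ 2 +
        ((x + L) * cos ω - y * sin ω) ^ 2 := by
      linear_combination (-(x + L) ^ 2 - y ^ 2) * sin_sq_add_cos_sq ω
    rw [this]
    nlinarith [sq_nonneg ((x + L) * cos ω - y * sin ω)]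
  have h4 : 0 < L * sin ω := by positivity
  nlinarith

/-- The boundary point at height y has distance y / sin ω from its corner, here less than half the
radius L sin ω, so the bump equals 1 there. -/
lemma midCut_side {y : ℝ} (hy : 0 < y) (hyL : y < sin ω ^ 2 / 2 * L) :
    midCut ω L (pt (-halfWidth ω L y) y) = 0 ∧ midCut ω L (pt (halfWidth ω L y) y) = 0 := by
  have hs := sin_pos_of_pos_of_lt_pi h0 hπ
  have h1 : leftBump ω L (pt (-halfWidth ω L y) y) = 1 := by
    refine leftBump_eq_one h0 hπ hL ?_
    rw [pt_zero, pt_one, halfWidth]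
    have : (-(L - y * (cos ω / sin ω)) + L) ^ 2 + y ^ 2 = (y / sin ω) ^ 2 := by
      field_simp
      linear_combination y ^ 2 * sin_sq_add_cos_sq ω
    rw [this, show (L * sin ω) ^ 2 / 4 = (L * sin ω / 2) ^ 2 by ring]
    refine pow_le_pow_left₀ (by positivity) ?_ 2
    rw [div_le_iff₀ hs]
    nlinarith
  have h2 := leftBump_mul_refl h0 hπ hL (pt (-halfWidth ω L y) y)
  rw [h1, one_mul, reflX_pt, neg_neg] at h2
  constructor
  · rw [midCut, reflX_pt, neg_neg, h1, h2, add_zero, mul_one, cos_pi_div_two]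
  · rw [midCut, reflX_pt, h1, h2, zero_add, mul_one, cos_pi_div_two]

omit hL

/-- The bump is a fixed profile on the scale L. Outside its ball the derivative of the transition
function vanishes; inside, the squared distance has gradient at most 2L sin ω, against the
normalization (L sin ω)². -/
lemma exists_leftBump_deriv_bound :
    ∃ G ≥ 0, ∀ L > 0, ∀ i x, |pderivAt i (leftBump ω L) x| ≤ G / L := by
  have hs := sin_pos_of_pos_of_lt_pi h0 hπ
  obtain ⟨K, hK0, hK⟩ := exists_deriv_smoothTransition_bound
  refine ⟨K * (8 / 3) / sin ω, by positivity, fun L hL i x => ?_⟩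
  set q : Plane → ℝ := fun x => (x 0 + L) ^ 2 + x 1 ^ 2 with hq
  have hqd : ∀ x, HasFDerivAt q ((2 * (x 0 + L)) • (EuclideanSpace.proj 0 : Plane →L[ℝ] ℝ) +
      (2 * x 1) • (EuclideanSpace.proj 1 : Plane →L[ℝ] ℝ)) x := fun x => by
    have p0 : HasFDerivAt (fun x : Plane => x 0) (EuclideanSpace.proj 0 : Plane →L[ℝ] ℝ) x :=
      (EuclideanSpace.proj 0 : Plane →L[ℝ] ℝ).hasFDerivAt
    have p1 : HasFDerivAt (fun x : Plane => x 1) (EuclideanSpace.proj 1 : Plane →L[ℝ] ℝ) x :=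
      (EuclideanSpace.proj 1 : Plane →L[ℝ] ℝ).hasFDerivAt
    refine (((p0.add_const L).pow 2).add (p1.pow 2)).congr_fderiv ?_
    norm_num [mul_add]
  set t := 4 / 3 * (1 - q x / (L * sin ω) ^ 2) with ht
  have e : pderivAt i (leftBump ω L) x =
      deriv smoothTransition t * (-(4 / 3) / (L * sin ω) ^ 2) * pderivAt i q x := by
    have h1 : HasDerivAt (fun r : ℝ => smoothTransition (4 / 3 * (1 - r / (L * sin ω) ^ 2)))
        (deriv smoothTransition t * (-(4 / 3) / (L * sin ω) ^ 2)) (q x) := by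
      have h2 := (((hasDerivAt_id (q x)).div_const ((L * sin ω) ^ 2)).const_sub 1).const_mul (4 / 3)
      have h3 := (hasDerivAt_smoothTransition t).comp (q x) h2
      refine h3.congr_deriv ?_
      field_simp
    exact pderivAt_comp h1 (hqd x).differentiableAt i
  rcases lt_or_ge ((L * sin ω) ^ 2) (q x) with hlt | hle
  · have : deriv smoothTransition t = 0 := by
      have ht0 : t < 0 := by
        have : 1 < q x / (L * sin ω) ^ 2 := by rw [lt_div_iff₀ (by positivity)]; linarith
        rw [ht]; linarith
      have : smoothTransition =ᶠ[𝓝 t] fun _ => 0 := by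
        filter_upwards [Iio_mem_nhds ht0] with y hy
        exact smoothTransition.zero_of_nonpos (le_of_lt hy)
      rw [this.deriv_eq, deriv_const]
    rw [e, this, zero_mul, zero_mul, abs_zero]
    positivity
  · have hqi : |pderivAt i q x| ≤ 2 * (L * sin ω) := by
      rw [pderivAt_eq_of_hasFDerivAt (hqd x)]
      have a0 : |x 0 + L| ≤ L * sin ω := abs_le_of_sq_le_sq (by
        simp only [hq] at hle; nlinarith [sq_nonneg (x 1)]) (by positivity)
      have a1 : |x 1| ≤ L * sin ω := abs_le_of_sq_le_sq (by
        simp only [hq] at hle; nlinarith [sq_nonneg (x 0 + L)]) (by positivity)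
      fin_cases i
      · simp [abs_mul]
        exact a0
      · simp [abs_mul]
        exact a1
    rw [e, abs_mul, abs_mul, abs_div, abs_neg, abs_of_pos (show (0 : ℝ) < 4 / 3 by norm_num),
      abs_of_pos (show 0 < (L * sin ω) ^ 2 by positivity)]
    calc _ ≤ K * (4 / 3 / (L * sin ω) ^ 2) * (2 * (L * sin ω)) := by
          gcongr
          exact hK t
      _ = _ := by field_simp; ring

lemma exists_cut_deriv_bound : ∃ G ≥ 0, ∀ L > 0, ∀ i x, |pderivAt i (leftCut ω L) x| ≤ G / L ∧
    |pderivAt i (fun x => leftCut ω L (reflX x)) x| ≤ G / L ∧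
    |pderivAt i (midCut ω L) x| ≤ G / L := by
  obtain ⟨G, hG, hGb⟩ := exists_leftBump_deriv_bound h0 hπ
  refine ⟨π * G, by positivity, fun L hL i x => ?_⟩
  have hd := (contDiff_leftBump ω L).differentiable (by simp)
  have hdr := (contDiff_comp_reflX (contDiff_leftBump ω L)).differentiable (by simp)
  have hdc := (contDiff_leftCut ω L).differentiable (by simp)
  have hpi := pi_pos
  have hGL : 0 ≤ G / L := by positivity
  have h1 : ∀ i x, |pderivAt i (leftCut ω L) x| ≤ π * G / L := fun i x => by
    have := pderivAt_comp (((hasDerivAt_id _).const_mul (π / 2)).sin) (hd x) i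
    change |pderivAt i (fun x => sin (π / 2 * leftBump ω L x)) x| ≤ _
    simp only [id] at this
    rw [this, mul_one, abs_mul, abs_mul, abs_of_pos (show 0 < π / 2 by positivity)]
    calc _ ≤ 1 * (π / 2) * (G / L) := by
          gcongr
          · exact abs_cos_le_one _
          · exact hGb L hL i x
      _ ≤ π * (G / L) := by nlinarith
      _ = _ := by ring
  have hr : ∀ i x, |pderivAt i (fun x => leftBump ω L (reflX x)) x| ≤ G / L := fun i x => by
    fin_cases i
    · change |pderivAt 0 _ x| ≤ _
      rw [pderivAt_reflX_zero hd, abs_neg]; exact hGb L hL _ _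
    · change |pderivAt 1 _ x| ≤ _
      rw [pderivAt_reflX_one hd]; exact hGb L hL _ _
  refine ⟨h1 i x, ?_, ?_⟩
  · fin_cases i
    · change |pderivAt 0 _ x| ≤ _
      rw [pderivAt_reflX_zero hdc, abs_neg]; exact h1 _ _
    · change |pderivAt 1 _ x| ≤ _
      rw [pderivAt_reflX_one hdc]; exact h1 _ _
  · have hadd : HasFDerivAt (fun x => leftBump ω L x + leftBump ω L (reflX x))
        (fderiv ℝ (leftBump ω L) x + fderiv ℝ (fun x => leftBump ω L (reflX x)) x) x :=
      (hd x).hasFDerivAt.add (hdr x).hasFDerivAt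
    have := pderivAt_comp (((hasDerivAt_id _).const_mul (π / 2)).cos) hadd.differentiableAt i
    change |pderivAt i (fun x => cos (π / 2 * (leftBump ω L x + leftBump ω L (reflX x)))) x| ≤ _
    simp only [id] at this
    have e : pderivAt i (fun x => leftBump ω L x + leftBump ω L (reflX x)) x =
        pderivAt i (leftBump ω L) x + pderivAt i (fun x => leftBump ω L (reflX x)) x := by
      rw [pderivAt_eq_of_hasFDerivAt hadd]; rfl
    rw [this, e, mul_one, abs_mul, abs_mul, abs_neg, abs_of_pos (show 0 < π / 2 by positivity)]
    calc _ ≤ 1 * (π / 2) * (G / L + G / L) := by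
          gcongr
          · exact abs_sin_le_one _
          · exact (abs_add_le _ _).trans (add_le_add (hGb L hL i x) (hr i x))
      _ = _ := by ring

end Cutoffs

/-! ### The lower bound for the Robin energy -/

section LowerBound

/-- The trial state at the left corner. -/
noncomputable def leftTrial (β ω L : ℝ) (x : Plane) : ℝ := leftCut ω L x * cornerState β ω L x

lemma contDiff_cornerState (β ω L : ℝ) :
    ContDiff ℝ ((⊤ : ℕ∞) : WithTop ℕ∞) (cornerState β ω L) :=
  Real.contDiff_exp.comp ((contDiff_const.mul ((contDiff_coord 0).add contDiff_const)).sub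
    (contDiff_const.mul (contDiff_coord 1)))

/-- For ω < π/3 take the vertical field of length β / cos ω, so that ν is minus the energy of a
sector of half-opening π/2 - ω, that of the third corner. The inequality sin²(ω/2) < cos² ω amounts
to cos ω > 1/2. For ω ≥ π/2 take β times the outward normal of the right side, so ν = β², which is
smaller than -E_α by the square of `cornerRate`. -/
lemma exists_field {ω : ℝ} (hω : ω ∈ Ioo 0 (π / 3) ∪ Ico (π / 2) π) {β : ℝ} (hβ : 0 < β) :
    ∃ A B ν : ℝ, β ^ 2 ≤ ν ∧ A ^ 2 + B ^ 2 ≤ ν ∧ sin ω * A + cos ω * B = β ∧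
      (A = 0 ∨ cos ω ≤ 0) ∧ ν < -sectorEnergy β (ω / 2) := by
  have hpi := pi_pos
  rcases hω with ⟨h1, h2⟩ | ⟨h1, h2⟩
  · have hc : 1 / 2 < cos ω := by
      rw [← cos_pi_div_three]
      exact cos_lt_cos_of_nonneg_of_le_pi h1.le (by linarith) h2
    have hs2 : sin (ω / 2) ^ 2 = (1 - cos ω) / 2 := by
      rw [sin_sq_eq_half_sub, mul_div_cancel₀ _ (by norm_num : (2 : ℝ) ≠ 0)]; ring
    have hs0 : 0 < sin (ω / 2) := sin_pos_of_pos_of_lt_pi (by linarith) (by linarith)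
    refine ⟨0, β / cos ω, (β / cos ω) ^ 2, ?_, by simp, by field_simp; ring, Or.inl rfl, ?_⟩
    · refine pow_le_pow_left₀ hβ.le ?_ 2
      rw [le_div_iff₀ (by linarith)]
      nlinarith [cos_le_one ω]
    · rw [sectorEnergy, neg_neg, div_pow]
      refine div_lt_div_of_pos_left (by positivity) (by positivity) ?_
      rw [hs2]
      nlinarith
  · have h0 : 0 < ω := by linarith
    refine ⟨β * sin ω, β * cos ω, β ^ 2, le_rfl, ?_, ?_, Or.inr ?_, ?_⟩
    · refine le_of_eq ?_
      linear_combination β ^ 2 * sin_sq_add_cos_sq ω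
    · linear_combination β * sin_sq_add_cos_sq ω
    · exact cos_nonpos_of_pi_div_two_le_of_le h1 (by linarith)
    · rw [sectorEnergy_eq h0 h2, neg_neg]
      have := cornerRate_pos h0 h2 hβ
      nlinarith

lemma angle_bounds {ω : ℝ} (hω : ω ∈ Ioo 0 (π / 3) ∪ Ico (π / 2) π) : 0 < ω ∧ ω < π := by
  have hpi := pi_pos
  rcases hω with ⟨h1, h2⟩ | ⟨h1, h2⟩
  · exact ⟨h1, by linarith⟩
  · exact ⟨by linarith, h2⟩

/-- Up to the two trial states, the Robin energy is uniformly above the sector energy. -/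
theorem robinEnergy_lower {ω : ℝ} (hω : ω ∈ Ioo 0 (π / 3) ∪ Ico (π / 2) π) {β : ℝ} (hβ : 0 < β) :
    ∃ g > 0, ∃ C ≥ 0, ∃ D ≥ 0, ∀ L ≥ 1, ∀ φ : Plane → ℝ, IsTest φ →
      (sectorEnergy β (ω / 2) + g - C / L) * (∫ x in twoCornerDomain ω L, φ x ^ 2) -
        D * ((∫ x in twoCornerDomain ω L, φ x * leftTrial β ω L x) ^ 2 +
          (∫ x in twoCornerDomain ω L, φ x * leftTrial β ω L (reflX x)) ^ 2) ≤
        robinEnergy (twoCornerDomain ω L) β φ ∧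
      (sectorEnergy β (ω / 2) - C / L) * (∫ x in twoCornerDomain ω L, φ x ^ 2) ≤
        robinEnergy (twoCornerDomain ω L) β φ := by
  obtain ⟨h0, hπ⟩ := angle_bounds hω
  have hs := sin_pos_of_pos_of_lt_pi h0 hπ
  obtain ⟨A, B, ν, hν1, hν2, hn, hor, hν3⟩ := exists_field hω hβ
  obtain ⟨g₁, hg₁, D, hD, hcorner⟩ := corner_gap h0 hπ hβ
  obtain ⟨C₁, hC₁, hmid⟩ := middle_lower h0 hπ β (h := sin ω ^ 2 / 2) (by positivity)
    hν1 hν2 hn hor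
  obtain ⟨G, hG, hGb⟩ := exists_cut_deriv_bound h0 hπ
  set E := sectorEnergy β (ω / 2) with hE
  -- The gap is the worse of the corner gap and the distance from E to -ν. The error C₁ comes from
  -- the middle field and 6G² from two derivatives of each of the three cutoffs.
  refine ⟨min g₁ (-E - ν), lt_min hg₁ (by linarith), C₁ + 6 * G ^ 2, by positivity, D, hD,
    fun L hL1 φ hφ => ?_⟩
  have hL : 0 < L := by linarith
  have := isFiniteMeasureOnCompacts_frontier h0 hπ hL
  set Ω := twoCornerDomain ω L with hΩ
  have sl := contDiff_leftCut ω L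
  have sr := contDiff_comp_reflX sl
  have sm := contDiff_midCut ω L
  have tl := IsTest.smooth_mul sl hφ
  have tr := IsTest.smooth_mul sr hφ
  have tm := IsTest.smooth_mul sm hφ
  -- The right corner is treated by reflecting φ and applying the estimate at the left corner.
  have trr : IsTest fun x => leftCut ω L x * φ (reflX x) := IsTest.smooth_mul sl hφ.reflX
  have hims : robinEnergy Ω β φ = robinEnergy Ω β (fun x => leftCut ω L x * φ x) +
      robinEnergy Ω β (fun x => leftCut ω L (reflX x) * φ x) +
      robinEnergy Ω β (fun x => midCut ω L x * φ x) - ∫ x in Ω,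
        (pderivAt 0 (leftCut ω L) x ^ 2 + pderivAt 1 (leftCut ω L) x ^ 2 +
        (pderivAt 0 (fun x => leftCut ω L (reflX x)) x ^ 2 +
          pderivAt 1 (fun x => leftCut ω L (reflX x)) x ^ 2) +
        (pderivAt 0 (midCut ω L) x ^ 2 + pderivAt 1 (midCut ω L) x ^ 2)) * φ x ^ 2 := by
    have h := robinEnergy_ims (Ω := Ω) β
      (χ := ![leftCut ω L, fun x => leftCut ω L (reflX x), midCut ω L])
      (fun j => by fin_cases j <;> assumption)
      (fun x => by
        rw [Fin.sum_univ_three]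
        exact cut_sq_sum h0 hπ hL x) hφ
    simp only [Fin.sum_univ_three] at h
    exact h
  have hsupp : ∀ {ψ : Plane → ℝ} (x y : ℝ), 0 < y → halfWidth ω L y ≤ x →
      pt x y ∉ tsupport fun x => leftCut ω L x * ψ x := fun x y _ hxy hmem =>
    notMem_tsupport_leftCut h0 hπ hL hxy (tsupport_mul_subset_left hmem)
  have hl := hcorner L hL _ tl hsupp
  have hr := hcorner L hL _ trr hsupp
  have hl' := robinEnergy_corner_eq h0 hπ hL β tl hsupp
  have hr' := robinEnergy_corner_eq h0 hπ hL β trr hsupp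
  have hm := hmid L hL _ tm (fun y hy hyL => by
    obtain ⟨z1, z2⟩ := midCut_side h0 hπ hL hy hyL
    simp only [z1, z2, zero_mul, and_self])
  have erefl : ∀ x, leftCut ω L (reflX x) * φ x =
      (fun x => leftCut ω L x * φ (reflX x)) (reflX x) := fun x => by
    simp only [reflX_reflX]
  have e1 : robinEnergy Ω β (fun x => leftCut ω L (reflX x) * φ x) =
      robinEnergy Ω β (fun x => leftCut ω L x * φ (reflX x)) := by
    rw [← robinEnergy_reflX h0 hπ L β trr]
    simp only [reflX_reflX]
    rfl
  have e2 : ∫ x in Ω, (leftCut ω L x * φ (reflX x)) ^ 2 =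
      ∫ x in Ω, (leftCut ω L (reflX x) * φ x) ^ 2 := by
    rw [← integral_reflX_domain h0 hπ L]
    simp only [reflX_reflX]
    rfl
  have e3 : ∫ x in Ω, leftCut ω L x * φ (reflX x) * cornerState β ω L x =
      ∫ x in Ω, φ x * leftTrial β ω L (reflX x) := by
    rw [← integral_reflX_domain h0 hπ L]
    refine integral_congr_ae (Eventually.of_forall fun x => ?_)
    simp only [reflX_reflX, leftTrial]
    ring
  have e4 : ∫ x in Ω, leftCut ω L x * φ x * cornerState β ω L x =
      ∫ x in Ω, φ x * leftTrial β ω L x := by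
    refine integral_congr_ae (Eventually.of_forall fun x => ?_)
    simp only [leftTrial]
    ring
  have hN : (∫ x in Ω, (leftCut ω L x * φ x) ^ 2) +
      (∫ x in Ω, (leftCut ω L (reflX x) * φ x) ^ 2) + (∫ x in Ω, (midCut ω L x * φ x) ^ 2) =
      ∫ x in Ω, φ x ^ 2 := by
    have := integral_lincomb₃ (tl.integrable_sq (volume.restrict Ω))
      (tr.integrable_sq (volume.restrict Ω)) (tm.integrable_sq (volume.restrict Ω)) 1 1 1
    rw [one_mul, one_mul, one_mul] at this
    rw [← this]
    refine integral_congr_ae (Eventually.of_forall fun x => ?_)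
    simp only
    linear_combination φ x ^ 2 * cut_sq_sum h0 hπ hL x
  have hgrad : ∫ x in Ω, (pderivAt 0 (leftCut ω L) x ^ 2 + pderivAt 1 (leftCut ω L) x ^ 2 +
      (pderivAt 0 (fun x => leftCut ω L (reflX x)) x ^ 2 +
        pderivAt 1 (fun x => leftCut ω L (reflX x)) x ^ 2) +
      (pderivAt 0 (midCut ω L) x ^ 2 + pderivAt 1 (midCut ω L) x ^ 2)) * φ x ^ 2 ≤
      6 * G ^ 2 / L * ∫ x in Ω, φ x ^ 2 := by
    rw [← integral_const_mul]
    have c1 := fun i => continuous_pderivAt sl i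
    have c2 := fun i => continuous_pderivAt sr i
    have c3 := fun i => continuous_pderivAt sm i
    have cφ := hφ.continuous
    refine integral_mono (integrable_of_continuous_compact (by fun_prop) hφ.sq.compact.mul_left _)
      ((hφ.integrable_sq _).const_mul _) fun x => ?_
    refine mul_le_mul_of_nonneg_right ?_ (sq_nonneg _)
    -- The localization error is of order 1/L²; L ≥ 1 is used to weaken it to the order 1/L of the
    -- other errors.
    have hb : ∀ {r : ℝ}, |r| ≤ G / L → r ^ 2 ≤ G ^ 2 / L := fun {r} hr => by
      have h1 : r ^ 2 ≤ (G / L) ^ 2 := sq_le_sq' (by linarith [(abs_le.1 hr).1]) (abs_le.1 hr).2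
      have h2 : (G / L) ^ 2 ≤ G ^ 2 / L := by
        rw [div_pow]
        refine div_le_div_of_nonneg_left (by positivity) hL ?_
        nlinarith
      linarith
    obtain ⟨a1, a2, a3⟩ := hGb L hL 0 x
    obtain ⟨b1, b2, b3⟩ := hGb L hL 1 x
    have e : 6 * G ^ 2 / L = 6 * (G ^ 2 / L) := by ring
    rw [e]
    linarith [hb a1, hb a2, hb a3, hb b1, hb b2, hb b3]
  rw [e2, e3, ← e1] at hr
  rw [e2, ← e1] at hr'
  rw [e4] at hl
  set Nl := ∫ x in Ω, (leftCut ω L x * φ x) ^ 2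
  set Nr := ∫ x in Ω, (leftCut ω L (reflX x) * φ x) ^ 2
  set Nm := ∫ x in Ω, (midCut ω L x * φ x) ^ 2
  have pl : 0 ≤ Nl := integral_nonneg fun x => sq_nonneg _
  have pr : 0 ≤ Nr := integral_nonneg fun x => sq_nonneg _
  have pm : 0 ≤ Nm := integral_nonneg fun x => sq_nonneg _
  have q1 : 0 ≤ ∫ x in Ω, (pderivAt 0 (fun x => leftCut ω L x * φ x) x +
      cornerRate β ω * (leftCut ω L x * φ x)) ^ 2 := integral_nonneg fun x => sq_nonneg _
  have q2 : 0 ≤ ∫ x in Ω, (pderivAt 1 (fun x => leftCut ω L x * φ x) x +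
      β * (leftCut ω L x * φ x)) ^ 2 := integral_nonneg fun x => sq_nonneg _
  have q3 : 0 ≤ ∫ x in Ω, (pderivAt 0 (fun x => leftCut ω L x * φ (reflX x)) x +
      cornerRate β ω * (leftCut ω L x * φ (reflX x))) ^ 2 := integral_nonneg fun x => sq_nonneg _
  have q4 : 0 ≤ ∫ x in Ω, (pderivAt 1 (fun x => leftCut ω L x * φ (reflX x)) x +
      β * (leftCut ω L x * φ (reflX x))) ^ 2 := integral_nonneg fun x => sq_nonneg _
  have g1 := min_le_left g₁ (-E - ν)
  have g2 := min_le_right g₁ (-E - ν)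
  set g := min g₁ (-E - ν)
  have w1 := mul_le_mul_of_nonneg_right g1 pl
  have w2 := mul_le_mul_of_nonneg_right g1 pr
  have w3 := mul_le_mul_of_nonneg_right g2 pm
  have w4 : C₁ / L * Nm ≤ C₁ / L * ∫ x in Ω, φ x ^ 2 :=
    mul_le_mul_of_nonneg_left (by linarith) (by positivity)
  have w5 : (C₁ + 6 * G ^ 2) / L = C₁ / L + 6 * G ^ 2 / L := by ring
  have w6 : ν * Nm ≤ -E * Nm := mul_le_mul_of_nonneg_right hν3.le pm
  rw [w5]
  change _ ≤ robinEnergy Ω β _ at hl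
  change robinEnergy Ω β _ = _ at hl'
  change _ ≤ robinEnergy Ω β _ at hm
  rw [← hE] at hl' hr'
  constructor
  · have : (E + g - (C₁ / L + 6 * G ^ 2 / L)) * (∫ x in Ω, φ x ^ 2) =
        (E + g) * Nl + (E + g) * Nr + (E + g) * Nm - C₁ / L * (∫ x in Ω, φ x ^ 2) -
          6 * G ^ 2 / L * ∫ x in Ω, φ x ^ 2 := by rw [← hN]; ring
    rw [this]
    linarith
  · have : (E - (C₁ / L + 6 * G ^ 2 / L)) * (∫ x in Ω, φ x ^ 2) =
        E * Nl + E * Nr + E * Nm - C₁ / L * (∫ x in Ω, φ x ^ 2) -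
          6 * G ^ 2 / L * ∫ x in Ω, φ x ^ 2 := by rw [← hN]; ring
    rw [this]
    linarith

end LowerBound

/-! ### The Robin form on Sobolev triples -/

section Triples

lemma inner_eq_mul (a b : ℝ) : ⟪a, b⟫ = a * b := by
  rw [RCLike.inner_apply, conj_trivial, mul_comm]

lemma inner_toLp {Ω : Set Plane} (u : L2Dom Ω) {f : Plane → ℝ}
    (hf : MemLp f 2 (volume.restrict Ω)) : ⟪u, hf.toLp f⟫ = ∫ x in Ω, u x * f x := by
  rw [L2.inner_def]
  refine integral_congr_ae ?_
  filter_upwards [hf.coeFn_toLp] with x hx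
  rw [hx, inner_eq_mul]

/-- The ambient space of the triples `(u, ∇u, u|_∂Ω)`. -/
abbrev Triple (Ω : Set Plane) : Type := L2Dom Ω × (Fin 2 → L2Dom Ω) × L2Bdry Ω

variable (Ω : Set Plane)

/-- The Robin form as a bounded bilinear form. -/
noncomputable def robinCLM (β : ℝ) : Triple Ω →L[ℝ] Triple Ω →L[ℝ] ℝ :=
  let P : Fin 2 → Triple Ω →L[ℝ] L2Dom Ω := fun i =>
    (ContinuousLinearMap.proj (R := ℝ) (φ := fun _ : Fin 2 => L2Dom Ω) i).comp
      ((ContinuousLinearMap.fst ℝ (Fin 2 → L2Dom Ω) (L2Bdry Ω)).comp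
        (ContinuousLinearMap.snd ℝ (L2Dom Ω) _))
  let T : Triple Ω →L[ℝ] L2Bdry Ω :=
    (ContinuousLinearMap.snd ℝ (Fin 2 → L2Dom Ω) (L2Bdry Ω)).comp
      (ContinuousLinearMap.snd ℝ (L2Dom Ω) _)
  (realInnerCLM (L2Dom Ω)).bilinearComp (P 0) (P 0) +
    (realInnerCLM (L2Dom Ω)).bilinearComp (P 1) (P 1) -
    β • (realInnerCLM (L2Bdry Ω)).bilinearComp T T

lemma robinCLM_eq (β : ℝ) (p q : Triple Ω) :
    robinCLM Ω β p q = ⟪p.2.1 0, q.2.1 0⟫ + ⟪p.2.1 1, q.2.1 1⟫ - β * ⟪p.2.2, q.2.2⟫ := rfl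

lemma robinCLM_apply (β : ℝ) (p q : Triple Ω) : robinCLM Ω β p q = robinForm Ω β p q := by
  rw [robinCLM_eq, robinForm, Fin.sum_univ_two]

lemma robinCLM_comm (β : ℝ) (p q : Triple Ω) : robinCLM Ω β p q = robinCLM Ω β q p := by
  simp only [robinCLM_eq, real_inner_comm]

/-- The restriction of a triple to its function. -/
noncomputable def tripleFst : Triple Ω →L[ℝ] L2Dom Ω := ContinuousLinearMap.fst ℝ _ _

lemma tripleFst_apply (p : Triple Ω) : tripleFst Ω p = p.1 := rfl

/-- Each integration by parts against a fixed test function is an equation between continuous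
functions of the triple, so their intersection is closed. -/
lemma isClosed_weakGrad : IsClosed {p : Triple Ω | IsWeakGrad Ω p.1 p.2.1} := by
  have : {p : Triple Ω | IsWeakGrad Ω p.1 p.2.1} =
      ⋂ (φ : Plane → ℝ) (h1 : ContDiff ℝ ((⊤ : ℕ∞) : WithTop ℕ∞) φ) (h2 : HasCompactSupport φ)
        (_ : tsupport φ ⊆ Ω) (i : Fin 2),
        {p : Triple Ω | ⟪p.1, (memLp_test Ω (continuous_pderivAt h1 i)
            (hasCompactSupport_pderivAt h2 i)).toLp _⟫ =
          -⟪p.2.1 i, (memLp_test Ω h1.continuous h2).toLp _⟫} := by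
    ext p
    simp only [mem_iInter, mem_ofPred_eq, IsWeakGrad]
    refine forall_congr' fun φ => forall_congr' fun h1 => forall_congr' fun h2 =>
      forall_congr' fun h3 => forall_congr' fun i => ?_
    rw [inner_toLp, inner_toLp]
  rw [this]
  refine isClosed_iInter fun φ => isClosed_iInter fun h1 => isClosed_iInter fun h2 =>
    isClosed_iInter fun h3 => isClosed_iInter fun i => isClosed_eq (by fun_prop) (by fun_prop)

end Triples

/-! ### Triples of test functions and their density in the form domain. -/

section TestTriples

lemma toLp_inner_toLp {α : Type*} [MeasurableSpace α] {μ : Measure α} {f g : α → ℝ}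
    (hf : MemLp f 2 μ) (hg : MemLp g 2 μ) : ⟪hf.toLp f, hg.toLp g⟫ = ∫ x, f x * g x ∂μ := by
  rw [L2.inner_def]
  refine integral_congr_ae ?_
  filter_upwards [hf.coeFn_toLp, hg.coeFn_toLp] with x hx hy
  rw [hx, hy, inner_eq_mul]

variable {Ω : Set Plane}

namespace IsTest

variable {φ ψ : Plane → ℝ}

lemma memLp (h : IsTest φ) (Ω : Set Plane) : MemLp φ 2 (volume.restrict Ω) :=
  memLp_test Ω h.continuous h.compact

lemma memLp_pderiv (h : IsTest φ) (Ω : Set Plane) (i : Fin 2) :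
    MemLp (pderivAt i φ) 2 (volume.restrict Ω) :=
  memLp_test Ω (h.continuous_pderiv i) (h.compact_pderiv i)

variable [IsFiniteMeasureOnCompacts ((μH[1] : Measure Plane).restrict (frontier Ω))]

lemma memLp_frontier (h : IsTest φ) :
    MemLp φ 2 ((μH[1] : Measure Plane).restrict (frontier Ω)) :=
  h.continuous.memLp_of_hasCompactSupport h.compact

variable (Ω) in
/-- The triple of a test function. -/
noncomputable def triple (h : IsTest φ) : Triple Ω :=
  ((h.memLp Ω).toLp φ, fun i => (h.memLp_pderiv Ω i).toLp _, h.memLp_frontier.toLp φ)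

lemma triple_mem_smoothTriples (h : IsTest φ) : h.triple Ω ∈ smoothTriples Ω :=
  ⟨φ, h.smooth, h.compact, (h.memLp Ω).coeFn_toLp, fun i => (h.memLp_pderiv Ω i).coeFn_toLp,
    h.memLp_frontier.coeFn_toLp⟩

lemma triple_eq (h : IsTest φ) {p : Triple Ω} (h1 : p.1 =ᵐ[volume.restrict Ω] φ)
    (h2 : ∀ i, p.2.1 i =ᵐ[volume.restrict Ω] pderivAt i φ)
    (h3 : p.2.2 =ᵐ[(μH[1] : Measure Plane).restrict (frontier Ω)] φ) : p = h.triple Ω := by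
  refine Prod.ext (Lp.ext (h1.trans (h.memLp Ω).coeFn_toLp.symm)) (Prod.ext (funext fun i => ?_)
    (Lp.ext (h3.trans h.memLp_frontier.coeFn_toLp.symm)))
  exact Lp.ext ((h2 i).trans (h.memLp_pderiv Ω i).coeFn_toLp.symm)

lemma triple_add (h : IsTest φ) (k : IsTest ψ) (hk : IsTest fun x => φ x + ψ x) :
    hk.triple Ω = h.triple Ω + k.triple Ω := by
  symm
  refine hk.triple_eq ?_ (fun i => ?_) ?_
  · filter_upwards [Lp.coeFn_add ((h.memLp Ω).toLp φ) ((k.memLp Ω).toLp ψ),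
      (h.memLp Ω).coeFn_toLp, (k.memLp Ω).coeFn_toLp] with x h1 h2 h3
    refine h1.trans ?_
    rw [Pi.add_apply, h2, h3]
  · filter_upwards [Lp.coeFn_add ((h.memLp_pderiv Ω i).toLp _) ((k.memLp_pderiv Ω i).toLp _),
      (h.memLp_pderiv Ω i).coeFn_toLp, (k.memLp_pderiv Ω i).coeFn_toLp] with x h1 h2 h3
    refine h1.trans ?_
    have hd : HasFDerivAt (fun x => φ x + ψ x) (fderiv ℝ φ x + fderiv ℝ ψ x) x :=
      (h.differentiable x).hasFDerivAt.add (k.differentiable x).hasFDerivAt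
    rw [Pi.add_apply, h2, h3, pderivAt_eq_of_hasFDerivAt hd]
    rfl
  · filter_upwards [Lp.coeFn_add ((h.memLp_frontier (Ω := Ω)).toLp φ)
      ((k.memLp_frontier (Ω := Ω)).toLp ψ),
      (h.memLp_frontier (Ω := Ω)).coeFn_toLp, (k.memLp_frontier (Ω := Ω)).coeFn_toLp]
      with x h1 h2 h3
    refine h1.trans ?_
    rw [Pi.add_apply, h2, h3]

lemma triple_smul (h : IsTest φ) (c : ℝ) (hc : IsTest fun x => c * φ x) :
    hc.triple Ω = c • h.triple Ω := by
  symm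
  refine hc.triple_eq ?_ (fun i => ?_) ?_
  · filter_upwards [Lp.coeFn_smul c ((h.memLp Ω).toLp φ), (h.memLp Ω).coeFn_toLp] with x h1 h2
    refine h1.trans ?_
    rw [Pi.smul_apply, h2, smul_eq_mul]
  · filter_upwards [Lp.coeFn_smul c ((h.memLp_pderiv Ω i).toLp _),
      (h.memLp_pderiv Ω i).coeFn_toLp] with x h1 h2
    refine h1.trans ?_
    rw [Pi.smul_apply, h2, smul_eq_mul, pderivAt_const_mul (h.differentiable x)]
  · filter_upwards [Lp.coeFn_smul c ((h.memLp_frontier (Ω := Ω)).toLp φ),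
      (h.memLp_frontier (Ω := Ω)).coeFn_toLp] with x h1 h2
    refine h1.trans ?_
    rw [Pi.smul_apply, h2, smul_eq_mul]

lemma robinCLM_triple (h : IsTest φ) (k : IsTest ψ) (β : ℝ) :
    robinCLM Ω β (h.triple Ω) (k.triple Ω) = (∫ x in Ω, pderivAt 0 φ x * pderivAt 0 ψ x) +
      (∫ x in Ω, pderivAt 1 φ x * pderivAt 1 ψ x) -
      β * ∫ x in frontier Ω, φ x * ψ x ∂(μH[1] : Measure Plane) := by
  rw [robinCLM_eq]
  exact congrArg₂ (· - ·) (congrArg₂ (· + ·)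
    (toLp_inner_toLp (h.memLp_pderiv Ω 0) (k.memLp_pderiv Ω 0))
    (toLp_inner_toLp (h.memLp_pderiv Ω 1) (k.memLp_pderiv Ω 1)))
    (congrArg (β * ·) (toLp_inner_toLp (h.memLp_frontier (Ω := Ω)) k.memLp_frontier))

lemma robinCLM_triple_self (h : IsTest φ) (β : ℝ) :
    robinCLM Ω β (h.triple Ω) (h.triple Ω) = robinEnergy Ω β φ := by
  rw [h.robinCLM_triple h, robinEnergy]
  simp only [pow_two]

lemma norm_sq_triple (h : IsTest φ) : ‖tripleFst Ω (h.triple Ω)‖ ^ 2 = ∫ x in Ω, φ x ^ 2 := by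
  rw [← real_inner_self_eq_norm_sq]
  refine (toLp_inner_toLp (h.memLp Ω) (h.memLp Ω)).trans ?_
  simp only [pow_two]

lemma inner_triple (h : IsTest φ) {f : Plane → ℝ} (hf : MemLp f 2 (volume.restrict Ω)) :
    ⟪tripleFst Ω (h.triple Ω), hf.toLp f⟫ = ∫ x in Ω, φ x * f x :=
  toLp_inner_toLp (h.memLp Ω) hf

end IsTest

lemma IsTest.pderiv {φ : Plane → ℝ} (h : IsTest φ) (i : Fin 2) : IsTest (pderivAt i φ) :=
  ⟨(h.smooth.fderiv_right (m := ((⊤ : ℕ∞) : WithTop ℕ∞)) le_rfl).clm_apply contDiff_const,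
    h.compact_pderiv i⟩

lemma integral_mul_pderivAt {φ ψ : Plane → ℝ} (h : IsTest φ) (k : IsTest ψ) (hψ : tsupport ψ ⊆ Ω)
    (i : Fin 2) : ∫ x in Ω, φ x * pderivAt i ψ x = -∫ x in Ω, pderivAt i φ x * ψ x := by
  rw [setIntegral_eq_integral_of_forall_compl_eq_zero (fun x hx => by
      rw [pderivAt_eq_zero_of_notMem (fun hh => hx (hψ hh)), mul_zero]),
    setIntegral_eq_integral_of_forall_compl_eq_zero (fun x hx => by
      rw [image_eq_zero_of_notMem_tsupport (fun hh => hx (hψ hh)), mul_zero])]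
  exact integral_mul_fderiv_eq_neg_fderiv_mul_of_integrable (μ := volume)
    (k.integrable_mul (h.continuous_pderiv i) _) ((k.pderiv i).integrable_mul h.continuous _)
    (k.integrable_mul h.continuous _) (fun x _ => h.differentiable x)
    (fun x _ => k.differentiable x)

lemma smoothTriples_le_weakGrad {p : Triple Ω} (hp : p ∈ smoothTriples Ω) :
    IsWeakGrad Ω p.1 p.2.1 := by
  obtain ⟨φ, h1, h2, e1, e2, -⟩ := hp
  intro ψ k1 k2 k3 i
  have d1 : ∫ x in Ω, p.1 x * pderivAt i ψ x = ∫ x in Ω, φ x * pderivAt i ψ x := by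
    refine integral_congr_ae ?_
    filter_upwards [e1] with x hx
    rw [hx]
  have d2 : ∫ x in Ω, p.2.1 i x * ψ x = ∫ x in Ω, pderivAt i φ x * ψ x := by
    refine integral_congr_ae ?_
    filter_upwards [e2 i] with x hx
    rw [hx]
  rw [d1, d2, integral_mul_pderivAt ⟨h1, h2⟩ ⟨k1, k2⟩ k3]

/-- The weak-gradient condition is closed and holds for smooth triples, so it is automatic on their
closure. Hence every closed statement about Sobolev triples may be checked on test functions. -/
lemma sobolevH1_eq (Ω : Set Plane) : sobolevH1 Ω = (smoothTriples Ω).topologicalClosure := by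
  refine le_antisymm (fun p hp => hp.2) fun p hp => ⟨?_, hp⟩
  exact closure_minimal (fun q hq => smoothTriples_le_weakGrad hq) (isClosed_weakGrad Ω) hp

lemma isClosed_sobolevH1 (Ω : Set Plane) : IsClosed (sobolevH1 Ω : Set (Triple Ω)) := by
  rw [sobolevH1_eq]; exact Submodule.isClosed_topologicalClosure _

variable [IsFiniteMeasureOnCompacts ((μH[1] : Measure Plane).restrict (frontier Ω))]

lemma IsTest.triple_mem {φ : Plane → ℝ} (h : IsTest φ) : h.triple Ω ∈ sobolevH1 Ω := by
  rw [sobolevH1_eq]; exact Submodule.le_topologicalClosure _ h.triple_mem_smoothTriples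

/-- Closed conditions pass from test functions to Sobolev triples. -/
lemma sobolevH1_induction {P : Triple Ω → Prop} (hP : IsClosed {p | P p})
    (h : ∀ φ : Plane → ℝ, ∀ hφ : IsTest φ, P (hφ.triple Ω)) {p : Triple Ω}
    (hp : p ∈ sobolevH1 Ω) : P p := by
  rw [sobolevH1_eq] at hp
  refine closure_minimal (fun q hq => ?_) hP hp
  obtain ⟨φ, h1, h2, e1, e2, e3⟩ := hq
  have hφ : IsTest φ := ⟨h1, h2⟩
  rw [hφ.triple_eq e1 e2 e3]
  exact h φ hφ

omit [IsFiniteMeasureOnCompacts ((μH[1] : Measure Plane).restrict (frontier Ω))] in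
lemma mem_robinLaplacian_graph_iff (hΩ : IsOpen Ω) (β : ℝ) (u f : L2Dom Ω) :
    (u, f) ∈ (robinLaplacian Ω β).graph ↔ ∃ p ∈ sobolevH1 Ω, tripleFst Ω p = u ∧
      ∀ q ∈ sobolevH1 Ω, robinCLM Ω β p q = ⟪f, tripleFst Ω q⟫ := by
  rw [robinLaplacian_graph hΩ]
  simp only [robinCLM_apply]
  rfl

end TestTriples

/-! ### Coercivity and lower bounds on the form domain. -/

section FormBounds

variable {ω : ℝ} (hω : ω ∈ Ioo 0 (π / 3) ∪ Ico (π / 2) π) {β : ℝ} (hβ : 0 < β)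
include hω hβ

omit hβ in
lemma isTest_leftTrial {L : ℝ} (hL : 0 < L) : IsTest (leftTrial β ω L) := by
  obtain ⟨h0, hπ⟩ := angle_bounds hω
  have : leftTrial β ω L = fun x => cornerState β ω L x * leftCut ω L x := by
    ext x; rw [leftTrial, mul_comm]
  rw [this]
  exact IsTest.smooth_mul (contDiff_cornerState β ω L)
    ⟨contDiff_leftCut ω L, hasCompactSupport_leftCut h0 hπ hL⟩

/-- The lower bound for the doubled parameter 2β is a trace inequality: it bounds 2β times the
boundary term by the Dirichlet integral plus M times the squared L² norm. The form with β thus keeps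
half of the Dirichlet integral, and c spreads this half over gradient and trace. -/
lemma exists_coercive {L : ℝ} (hL : 1 ≤ L) : ∃ c > 0, ∃ C, ∀ p ∈ sobolevH1 (twoCornerDomain ω L),
    c * ‖p‖ ^ 2 ≤ robinCLM _ β p p + C * ‖tripleFst _ p‖ ^ 2 := by
  obtain ⟨h0, hπ⟩ := angle_bounds hω
  have := isFiniteMeasureOnCompacts_frontier h0 hπ (by linarith : 0 < L)
  obtain ⟨g, -, C, hC, D, -, hlow⟩ := robinEnergy_lower hω (by linarith : 0 < 2 * β)
  set M := |sectorEnergy (2 * β) (ω / 2) - C / L| with hM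
  have hM0 : 0 ≤ M := abs_nonneg _
  set c := (1 / 2) / (1 + 1 / (2 * β)) with hc
  have hc0 : 0 < c := by positivity
  have hc1 : c * (1 + 1 / (2 * β)) = 1 / 2 := by rw [hc]; field_simp
  refine ⟨c, hc0, M / 2 + c + c * (M / (2 * β)), fun p hp => ?_⟩
  have h1 : -M * ‖tripleFst _ p‖ ^ 2 ≤ robinCLM _ (2 * β) p p := by
    refine sobolevH1_induction (P := fun p => -M * ‖tripleFst _ p‖ ^ 2 ≤ robinCLM _ (2 * β) p p)
      (isClosed_le (by fun_prop) (continuous_form _)) (fun φ hφ => ?_) hp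
    rw [hφ.robinCLM_triple_self, hφ.norm_sq_triple]
    refine le_trans (mul_le_mul_of_nonneg_right (neg_abs_le _)
      (integral_nonneg fun x => sq_nonneg _)) (hlow L hL φ hφ).2
  rw [robinCLM_eq] at h1 ⊢
  simp only [real_inner_self_eq_norm_sq, tripleFst_apply] at h1 ⊢
  have h2 : ‖p‖ ^ 2 ≤ ‖p.1‖ ^ 2 + (‖p.2.1 0‖ ^ 2 + ‖p.2.1 1‖ ^ 2) + ‖p.2.2‖ ^ 2 := by
    have b0 := sq_nonneg ‖p.1‖
    have b1 := sq_nonneg ‖p.2.1 0‖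
    have b2 := sq_nonneg ‖p.2.1 1‖
    have b3 := sq_nonneg ‖p.2.2‖
    have : ‖p‖ ≤ √(‖p.1‖ ^ 2 + (‖p.2.1 0‖ ^ 2 + ‖p.2.1 1‖ ^ 2) + ‖p.2.2‖ ^ 2) := by
      refine max_le (Real.le_sqrt_of_sq_le (by linarith)) (max_le ?_
        (Real.le_sqrt_of_sq_le (by linarith)))
      refine (pi_norm_le_iff_of_nonneg (Real.sqrt_nonneg _)).2 fun i => ?_
      refine Real.le_sqrt_of_sq_le ?_
      fin_cases i
      · change ‖p.2.1 0‖ ^ 2 ≤ _; linarith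
      · change ‖p.2.1 1‖ ^ 2 ≤ _; linarith
    have h := pow_le_pow_left₀ (norm_nonneg p) this 2
    rwa [Real.sq_sqrt (by positivity)] at h
  set N := ‖p.1‖ ^ 2
  set G := ‖p.2.1 0‖ ^ 2 + ‖p.2.1 1‖ ^ 2
  set B := ‖p.2.2‖ ^ 2
  have h3 : B ≤ 1 / (2 * β) * G + M / (2 * β) * N := by
    have : B = 1 / (2 * β) * (2 * β * B) := by field_simp
    rw [this]
    have e : 1 / (2 * β) * G + M / (2 * β) * N = 1 / (2 * β) * (G + M * N) := by ring
    rw [e]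
    exact mul_le_mul_of_nonneg_left (by linarith) (by positivity)
  have h4 : c * ‖p‖ ^ 2 ≤ c * (N + G + (1 / (2 * β) * G + M / (2 * β) * N)) :=
    mul_le_mul_of_nonneg_left (by linarith) hc0.le
  have h5 : c * (N + G + (1 / (2 * β) * G + M / (2 * β) * N)) =
      1 / 2 * G + (c + c * (M / (2 * β))) * N := by
    rw [← hc1]; ring
  linarith

/-- `robinEnergy_lower` on the form domain. -/
lemma robinCLM_lower : ∃ g > 0, ∃ C ≥ 0, ∃ D ≥ 0, ∀ L, ∀ hL : 1 ≤ L,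
    ∀ p ∈ sobolevH1 (twoCornerDomain ω L),
      (sectorEnergy β (ω / 2) + g - C / L) * ‖tripleFst _ p‖ ^ 2 -
        D * (⟪tripleFst _ p, ((isTest_leftTrial hω (β := β) (L := L)
            (by linarith)).memLp (twoCornerDomain ω L)).toLp _⟫ ^ 2 +
          ⟪tripleFst _ p, ((isTest_leftTrial hω (β := β) (L := L)
            (by linarith)).reflX.memLp (twoCornerDomain ω L)).toLp _⟫ ^ 2) ≤
        robinCLM _ β p p ∧
      (sectorEnergy β (ω / 2) - C / L) * ‖tripleFst _ p‖ ^ 2 ≤ robinCLM _ β p p := by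
  obtain ⟨h0, hπ⟩ := angle_bounds hω
  obtain ⟨g, hg, C, hC, D, hD, hlow⟩ := robinEnergy_lower hω hβ
  refine ⟨g, hg, C, hC, D, hD, fun L hL p hp => ?_⟩
  have := isFiniteMeasureOnCompacts_frontier h0 hπ (by linarith : 0 < L)
  refine sobolevH1_induction (P := fun p =>
    (sectorEnergy β (ω / 2) + g - C / L) * ‖tripleFst _ p‖ ^ 2 -
        D * (⟪tripleFst _ p, ((isTest_leftTrial hω (β := β) (L := L)
            (by linarith)).memLp (twoCornerDomain ω L)).toLp _⟫ ^ 2 +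
          ⟪tripleFst _ p, ((isTest_leftTrial hω (β := β) (L := L)
            (by linarith)).reflX.memLp (twoCornerDomain ω L)).toLp _⟫ ^ 2) ≤
        robinCLM _ β p p ∧
      (sectorEnergy β (ω / 2) - C / L) * ‖tripleFst _ p‖ ^ 2 ≤ robinCLM _ β p p) ?_ ?_ hp
  · exact (isClosed_le (by fun_prop) (continuous_form _)).inter
      (isClosed_le (by fun_prop) (continuous_form _))
  · intro φ hφ
    rw [hφ.robinCLM_triple_self, hφ.norm_sq_triple, hφ.inner_triple, hφ.inner_triple]
    exact hlow L hL φ hφ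

end FormBounds

/-! ### The energy of the trial states -/

section Trial

variable {ω : ℝ} (hω : ω ∈ Ioo 0 (π / 3) ∪ Ico (π / 2) π) {β : ℝ} (hβ : 0 < β)

lemma leftCut_nonneg (ω L : ℝ) (x : Plane) : 0 ≤ leftCut ω L x := by
  have := pi_pos
  have h0 := leftBump_nonneg ω L x
  have h1 := leftBump_le_one ω L x
  exact sin_nonneg_of_nonneg_of_le_pi (by positivity) (by nlinarith)

lemma leftCut_le_one (ω L : ℝ) (x : Plane) : leftCut ω L x ≤ 1 := sin_le_one _

lemma leftTrial_nonneg (β ω L : ℝ) (x : Plane) : 0 ≤ leftTrial β ω L x :=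
  mul_nonneg (leftCut_nonneg ω L x) (exp_nonneg _)

lemma pderivAt_cornerState (β ω L : ℝ) (x : Plane) :
    pderivAt 0 (cornerState β ω L) x = -cornerRate β ω * cornerState β ω L x ∧
      pderivAt 1 (cornerState β ω L) x = -β * cornerState β ω L x := by
  have p0 : HasFDerivAt (fun x : Plane => x 0) (EuclideanSpace.proj 0 : Plane →L[ℝ] ℝ) x :=
    (EuclideanSpace.proj 0 : Plane →L[ℝ] ℝ).hasFDerivAt
  have p1 : HasFDerivAt (fun x : Plane => x 1) (EuclideanSpace.proj 1 : Plane →L[ℝ] ℝ) x :=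
    (EuclideanSpace.proj 1 : Plane →L[ℝ] ℝ).hasFDerivAt
  have hd : HasFDerivAt (cornerState β ω L) (cornerState β ω L x •
      ((-cornerRate β ω) • (EuclideanSpace.proj 0 : Plane →L[ℝ] ℝ) -
        β • (EuclideanSpace.proj 1 : Plane →L[ℝ] ℝ))) x :=
    (((p0.add_const L).const_mul (-cornerRate β ω)).sub (p1.const_mul β)).exp
  constructor <;> rw [pderivAt_eq_of_hasFDerivAt hd] <;> simp <;> ring

/-- In the sheared coordinates the square of the corner state factors, so its integral over the
quarter plane is explicit and independent of L. -/
lemma cornerState_corner {ω : ℝ} (h0 : 0 < ω) (hπ : ω < π) (β L y s : ℝ) :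
    cornerState β ω L (pt (-halfWidth ω L y + s) y) ^ 2 =
      exp (-(2 * (cornerRate β ω / sin ω)) * y) * exp (-(2 * cornerRate β ω) * s) := by
  have hs := (sin_pos_of_pos_of_lt_pi h0 hπ).ne'
  have hk := cornerRate_mul_sin h0 hπ β
  have h1 : cornerRate β ω / sin ω = cornerRate β ω * (cos ω / sin ω) + β := by
    field_simp
    have h2 : cornerRate β ω * sin ω ^ 2 = β * (1 + cos ω) * sin ω := by rw [sq, ← mul_assoc, hk]
    have h3 : cornerRate β ω * (1 - cos ω) * (1 + cos ω) = β * sin ω * (1 + cos ω) := by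
      have := sin_sq_add_cos_sq ω
      linear_combination h2 - cornerRate β ω * this
    have := mul_right_cancel₀ (one_add_cos_pos h0 hπ).ne' h3
    linarith
  rw [cornerState, pt_zero, pt_one, h1, sq, ← exp_add, ← exp_add, halfWidth]
  congr 1
  ring

include hω hβ

/-- The cutoff has gradient O(1/L) and the corner state has an L² norm independent of L. By the
energy identity at the corner these integrals are the whole excess energy of the trial state. -/
lemma exists_cut_energy_bound : ∃ M ≥ 0, ∀ L > 0, ∀ i,
    ∫ x in twoCornerDomain ω L, (cornerState β ω L x * pderivAt i (leftCut ω L) x) ^ 2 ≤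
      M / L ^ 2 := by
  obtain ⟨h0, hπ⟩ := angle_bounds hω
  have hs := sin_pos_of_pos_of_lt_pi h0 hπ
  have hk := cornerRate_pos h0 hπ hβ
  obtain ⟨G, hG, hGb⟩ := exists_cut_deriv_bound h0 hπ
  set k := cornerRate β ω
  refine ⟨G ^ 2 * (1 / (2 * k)) * (1 / (2 * (k / sin ω))), by positivity, fun L hL i => ?_⟩
  have hc := hasCompactSupport_leftCut h0 hπ hL
  have hcont : Continuous fun x => (cornerState β ω L x * pderivAt i (leftCut ω L) x) ^ 2 :=
    ((contDiff_cornerState β ω L).continuous.mul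
      (continuous_pderivAt (contDiff_leftCut ω L) i)).pow 2
  have hexp : ∀ {r : ℝ}, 0 < r → IntegrableOn (fun s : ℝ => exp (-r * s)) (Ioi 0) ∧
      ∫ s in Ioi (0 : ℝ), exp (-r * s) = 1 / r := fun {r} hr => by
    refine ⟨integrableOn_exp_mul_Ioi (by linarith) 0, ?_⟩
    rw [integral_exp_mul_Ioi (by linarith), mul_zero, exp_zero, neg_div_neg_eq]
  rw [integral_corner_coords h0 hπ hcont
    (HasCompactSupport.sq (hasCompactSupport_pderivAt hc i).mul_left) (fun x y _ hxy => by
      rw [pderivAt_eq_zero_of_notMem (notMem_tsupport_leftCut h0 hπ hL hxy), mul_zero, sq,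
        mul_zero])]
  have e1 := hexp (show 0 < 2 * k by positivity)
  have e2 := hexp (show 0 < 2 * (k / sin ω) by positivity)
  have hinner : ∀ y, ∫ s in Ioi 0, (cornerState β ω L (pt (-halfWidth ω L y + s) y) *
      pderivAt i (leftCut ω L) (pt (-halfWidth ω L y + s) y)) ^ 2 ≤
      (G / L) ^ 2 * (1 / (2 * k)) * exp (-(2 * (k / sin ω)) * y) := fun y => by
    have e3 : (G / L) ^ 2 * (1 / (2 * k)) * exp (-(2 * (k / sin ω)) * y) =
        ∫ s in Ioi 0, (G / L) ^ 2 * exp (-(2 * (k / sin ω)) * y) * exp (-(2 * k) * s) := by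
      rw [integral_const_mul, e1.2]; ring
    rw [e3]
    refine integral_mono_of_nonneg (Eventually.of_forall fun s => sq_nonneg _)
      (e1.1.const_mul _) (Eventually.of_forall fun s => ?_)
    simp only
    rw [mul_pow, cornerState_corner h0 hπ]
    have : pderivAt i (leftCut ω L) (pt (-halfWidth ω L y + s) y) ^ 2 ≤ (G / L) ^ 2 := by
      have h := (hGb L hL i (pt (-halfWidth ω L y + s) y)).1
      exact sq_le_sq' (by linarith [(abs_le.1 h).1]) (abs_le.1 h).2
    calc _ ≤ exp (-(2 * (k / sin ω)) * y) * exp (-(2 * k) * s) * (G / L) ^ 2 := by gcongr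
      _ = _ := by ring
  refine (integral_mono_of_nonneg (Eventually.of_forall fun y => integral_nonneg fun s =>
    sq_nonneg _) (e2.1.const_mul _) (Eventually.of_forall hinner)).trans (le_of_eq ?_)
  rw [integral_const_mul, e2.2, div_pow]
  ring

omit hβ in
-- The trial state for L = 1, translated by L - 1 to the left, is dominated by the trial state for
-- L: its support has radius sin ω, and for L ≥ 2 the larger cutoff equals 1 on that ball. The
-- constant c is therefore the squared norm for L = 1.
lemma exists_trial_norm_bound : ∃ c > 0, ∀ L ≥ 2,
    c ≤ ∫ x in twoCornerDomain ω L, leftTrial β ω L x ^ 2 := by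
  obtain ⟨h0, hπ⟩ := angle_bounds hω
  have hs := sin_pos_of_pos_of_lt_pi h0 hπ
  have t1 := isTest_leftTrial hω (β := β) (L := 1) one_pos
  have hvan : ∀ {L : ℝ}, 0 < L → ∀ x y, halfWidth ω L y ≤ x → leftTrial β ω L (pt x y) = 0 :=
    fun {L} hL x y hxy => by
      rw [leftTrial, image_eq_zero_of_notMem_tsupport (notMem_tsupport_leftCut h0 hπ hL hxy),
        zero_mul]
  refine ⟨∫ x in twoCornerDomain ω 1, leftTrial β ω 1 x ^ 2, ?_, fun L hL => ?_⟩
  · change 0 < _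
    rw [setIntegral_pos_iff_support_of_nonneg_ae (Eventually.of_forall fun x => sq_nonneg _)
      (t1.integrable_sq _)]
    refine ((t1.sq.continuous.isOpen_support).inter
      (isOpen_twoCornerDomain hπ.le 1)).measure_pos _ ?_
    have hmem : pt (-1) 0 ∈ closure (twoCornerDomain ω 1) := by
      refine frontier_subset_closure ?_
      rw [mem_frontier_twoCornerDomain_iff h0 hπ one_pos]
      rw [pt_zero, pt_one]
      simp [halfWidth]
    refine mem_closure_iff.1 hmem _ t1.sq.continuous.isOpen_support ?_
    rw [Function.mem_support, leftTrial, leftCut, leftBump_eq_one h0 hπ one_pos, mul_one,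
      sin_pi_div_two, one_mul]
    · exact pow_ne_zero _ (exp_ne_zero _)
    · simp only [pt_zero, pt_one]
      norm_num
      positivity
  · have hL0 : 0 < L := by linarith
    have tL := isTest_leftTrial hω (β := β) hL0
    set T : Plane → Plane := fun x => x + pt (L - 1) 0 with hT
    have hTs : IsTest fun x => leftTrial β ω 1 (T x) :=
      ⟨t1.smooth.comp (contDiff_id.add contDiff_const),
        t1.compact.comp_homeomorph (Homeomorph.addRight (pt (L - 1) 0))⟩
    have T0 : ∀ x, T x 0 = x 0 + (L - 1) := fun x => rfl
    have T1 : ∀ x, T x 1 = x 1 := fun x => add_zero _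
    have hTpt : ∀ x y, T (pt x y) = pt (x + (L - 1)) y := fun x y => by
      ext i; fin_cases i
      · rfl
      · exact add_zero _
    have e : ∫ x in twoCornerDomain ω 1, leftTrial β ω 1 x ^ 2 =
        ∫ x in twoCornerDomain ω L, leftTrial β ω 1 (T x) ^ 2 := by
      rw [integral_corner_coords h0 hπ t1.sq.continuous t1.sq.compact (fun x y _ hxy => by
        rw [hvan one_pos x y hxy, sq, mul_zero]),
        integral_corner_coords h0 hπ hTs.sq.continuous hTs.sq.compact (fun x y _ hxy => by
          rw [hTpt, hvan one_pos, sq, mul_zero]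
          simp only [halfWidth] at hxy ⊢
          linarith)]
      refine integral_congr_ae (Eventually.of_forall fun y => ?_)
      refine integral_congr_ae (Eventually.of_forall fun s => ?_)
      simp only [hTpt, halfWidth]
      congr 3
      ring
    rw [e]
    refine integral_mono (hTs.integrable_sq _) (tL.integrable_sq _) fun x => ?_
    refine pow_le_pow_left₀ (leftTrial_nonneg _ _ _ _) ?_ 2
    by_cases hz : leftBump ω 1 (T x) = 0
    · rw [leftTrial, leftCut, hz, mul_zero, sin_zero, zero_mul]
      exact leftTrial_nonneg _ _ _ _
    · have hlt := lt_of_leftBump_ne_zero h0 hπ one_pos hz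
      rw [T0, T1] at hlt
      have hone : leftBump ω L x = 1 := by
        refine leftBump_eq_one h0 hπ hL0 ?_
        have h1 : (x 0 + L) ^ 2 + x 1 ^ 2 < sin ω ^ 2 := by
          have : x 0 + (L - 1) + 1 = x 0 + L := by ring
          rwa [this, one_mul] at hlt
        have h2 : 4 ≤ L ^ 2 := by nlinarith
        rw [mul_pow]
        nlinarith [sq_nonneg (sin ω)]
      rw [leftTrial, leftTrial, leftCut.eq_1 ω L, hone, mul_one, sin_pi_div_two]
      have e : cornerState β ω 1 (T x) = cornerState β ω L x := by
        rw [cornerState, cornerState, T0, T1]; congr 1; ring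
      rw [e]
      exact mul_le_mul_of_nonneg_right (leftCut_le_one _ _ _) (exp_nonneg _)

/-- The trial states are asymptotically optimal. -/
lemma exists_trial_energy_bound : ∃ C ≥ 0, ∀ L ≥ 2,
    0 < (∫ x in twoCornerDomain ω L, leftTrial β ω L x ^ 2) ∧
    robinEnergy (twoCornerDomain ω L) β (leftTrial β ω L) ≤
      (sectorEnergy β (ω / 2) + C / L) * ∫ x in twoCornerDomain ω L, leftTrial β ω L x ^ 2 := by
  obtain ⟨h0, hπ⟩ := angle_bounds hω
  obtain ⟨M, hM, hMb⟩ := exists_cut_energy_bound hω hβ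
  obtain ⟨c, hc, hcb⟩ := exists_trial_norm_bound hω (β := β)
  refine ⟨2 * M / c, by positivity, fun L hL => ?_⟩
  have hL0 : 0 < L := by linarith
  have hN := hcb L hL
  refine ⟨by linarith, ?_⟩
  have t := isTest_leftTrial hω (β := β) hL0
  rw [robinEnergy_corner_eq h0 hπ hL0 β t fun x y _ hxy hmem =>
    notMem_tsupport_leftCut h0 hπ hL0 hxy (tsupport_mul_subset_left hmem)]
  have hdc := (contDiff_leftCut ω L).differentiable (by simp)
  have hds := (contDiff_cornerState β ω L).differentiable (by simp)
  -- The corner state satisfies ∂₀Φ + kΦ = 0 and ∂₁Φ + βΦ = 0, so only the derivative of the cutoff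
  -- survives in the two squares.
  have e0 : ∀ x, pderivAt 0 (leftTrial β ω L) x + cornerRate β ω * leftTrial β ω L x =
      cornerState β ω L x * pderivAt 0 (leftCut ω L) x := fun x => by
    have := pderivAt_mul (hdc x) (hds x) 0
    change pderivAt 0 (fun x => leftCut ω L x * cornerState β ω L x) x + _ = _
    rw [this, (pderivAt_cornerState β ω L x).1, leftTrial]; ring
  have e1 : ∀ x, pderivAt 1 (leftTrial β ω L) x + β * leftTrial β ω L x =
      cornerState β ω L x * pderivAt 1 (leftCut ω L) x := fun x => by
    have := pderivAt_mul (hdc x) (hds x) 1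
    change pderivAt 1 (fun x => leftCut ω L x * cornerState β ω L x) x + _ = _
    rw [this, (pderivAt_cornerState β ω L x).2, leftTrial]; ring
  simp only [e0, e1]
  have b0 := hMb L hL0 0
  have b1 := hMb L hL0 1
  have h1 : M / L ^ 2 ≤ M / L := div_le_div_of_nonneg_left hM hL0 (by nlinarith)
  have h2 : 2 * M / L ≤ 2 * M / c / L * ∫ x in twoCornerDomain ω L, leftTrial β ω L x ^ 2 := by
    have : 2 * M / L = 2 * M / c / L * c := by field_simp
    rw [this]
    exact mul_le_mul_of_nonneg_left hN (by positivity)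
  have h3 : 2 * M / L = M / L + M / L := by ring
  linarith

end Trial

/-! ### Minimizers in symmetry classes -/

section SymmetricMinimizers

variable {X H : Type*} [NormedAddCommGroup X] [NormedSpace ℝ X]
  [NormedAddCommGroup H] [InnerProductSpace ℝ H]

/-- The part of `V` on which the reflection `R` acts as the scalar `s`. -/
def symmPart (V : Submodule ℝ X) (R : X →L[ℝ] X) (s : ℝ) : Submodule ℝ X where
  carrier := {p | p ∈ V ∧ R p = s • p}
  zero_mem' := ⟨V.zero_mem, by rw [map_zero, smul_zero]⟩
  add_mem' := fun hp hq => ⟨V.add_mem hp.1 hq.1, by rw [map_add, hp.2, hq.2, smul_add]⟩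
  smul_mem' := fun c p hp => ⟨V.smul_mem c hp.1, by rw [map_smul, hp.2, smul_comm]⟩

lemma isClosed_symmPart {V : Submodule ℝ X} (hV : IsClosed (V : Set X)) (R : X →L[ℝ] X) (s : ℝ) :
    IsClosed (symmPart V R s : Set X) :=
  hV.inter (isClosed_eq R.continuous (continuous_const_smul s))

/-- Minimizers of the form in the two symmetry classes, and the lower bound off them. -/
theorem exists_symmetric_minimizers [CompleteSpace X] (a : X →L[ℝ] X →L[ℝ] ℝ)
    (hs : ∀ p q, a p q = a q p) (J : X →L[ℝ] H) (V : Submodule ℝ X) (hV : IsClosed (V : Set X))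
    (R : X →L[ℝ] X) (hRV : ∀ p ∈ V, R p ∈ V) (hRR : ∀ p ∈ V, R (R p) = p)
    (haR : ∀ p q, a (R p) (R q) = a p q) (hJR : ∀ p q, ⟪J (R p), J (R q)⟫ = ⟪J p, J q⟫)
    {ψ ψ' : H} (hψ : ∀ p, ⟪J (R p), ψ⟫ = ⟪J p, ψ'⟫) {c C D μ : ℝ} (hc : 0 < c) (hD : 0 ≤ D)
    (hcoer : ∀ p ∈ V, c * ‖p‖ ^ 2 ≤ a p p + C * ‖J p‖ ^ 2)
    (hgap : ∀ p ∈ V, μ * ‖J p‖ ^ 2 - D * (⟪J p, ψ⟫ ^ 2 + ⟪J p, ψ'⟫ ^ 2) ≤ a p p)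
    (hex : ∀ s : ℝ, s ^ 2 = 1 → ∃ p ∈ symmPart V R s, a p p < μ * ‖J p‖ ^ 2) :
    ∃ (e : ℝ → X) (lam : ℝ → ℝ), (∀ s : ℝ, s ^ 2 = 1 → e s ∈ symmPart V R s ∧ lam s < μ ∧
        ‖J (e s)‖ = 1 ∧ (∀ q ∈ V, a (e s) q = lam s * ⟪J (e s), J q⟫) ∧
        ∀ p ∈ symmPart V R s, lam s * ‖J p‖ ^ 2 ≤ a p p) ∧
      ⟪J (e 1), J (e (-1))⟫ = 0 ∧
      (∀ p ∈ V, min (lam 1) (lam (-1)) * ‖J p‖ ^ 2 ≤ a p p) ∧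
      ∀ p ∈ V, ⟪J p, J (e 1)⟫ = 0 → ⟪J p, J (e (-1))⟫ = 0 → μ * ‖J p‖ ^ 2 ≤ a p p := by
  -- Quantifying over all real s, with dummy values unless s² = 1, treats the even and the odd class
  -- at once and allows `choose`.
  have key : ∀ s : ℝ, ∃ (e : X) (lam : ℝ), s ^ 2 = 1 → e ∈ symmPart V R s ∧ lam < μ ∧
      ‖J e‖ = 1 ∧ (∀ q ∈ symmPart V R s, a e q = lam * ⟪J e, J q⟫) ∧
      (∀ p ∈ symmPart V R s, lam * ‖J p‖ ^ 2 ≤ a p p) ∧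
      ∀ p ∈ symmPart V R s, ⟪J p, J e⟫ = 0 → μ * ‖J p‖ ^ 2 ≤ a p p := fun s => by
    by_cases h : s ^ 2 = 1
    · obtain ⟨e, he, lam, hlam, h1, h2, h3, h4⟩ := exists_minimizer a hs J (symmPart V R s)
        (isClosed_symmPart hV R s) ψ hc (by positivity : 0 ≤ 2 * D)
        (fun p hp => hcoer p hp.1) (fun p hp => by
          have h5 := hgap p hp.1
          -- On a symmetry class the two penalties coincide, so only one direction with constant 2D
          -- remains and `exists_minimizer` applies.
          have h6 : ⟪J p, ψ'⟫ ^ 2 = ⟪J p, ψ⟫ ^ 2 := by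
            rw [← hψ, hp.2, map_smul, real_inner_smul_left, mul_pow, h, one_mul]
          rw [h6] at h5
          linarith) (hex s h)
      exact ⟨e, lam, fun _ => ⟨he, hlam, h1, h2, h3, h4⟩⟩
    · exact ⟨0, 0, fun h' => absurd h' h⟩
  choose e lam hel using key
  -- The reflection preserves both pairings but changes the sign of q, so each pairing equals its
  -- own negative.
  have orth : ∀ p ∈ symmPart V R 1, ∀ q ∈ symmPart V R (-1), a p q = 0 ∧ ⟪J p, J q⟫ = 0 := by
    intro p hp q hq
    have h1 := haR p q
    have h2 := hJR p q
    rw [hp.2, hq.2, one_smul, neg_one_smul, map_neg] at h1 h2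
    rw [inner_neg_right] at h2
    exact ⟨by linarith, by linarith⟩
  have split : ∀ p ∈ V, ∃ p₁ ∈ symmPart V R 1, ∃ p₂ ∈ symmPart V R (-1), p = p₁ + p₂ := by
    intro p hp
    refine ⟨(1 / 2 : ℝ) • (p + R p), ⟨V.smul_mem _ (V.add_mem hp (hRV p hp)), ?_⟩,
      (1 / 2 : ℝ) • (p - R p), ⟨V.smul_mem _ (V.sub_mem hp (hRV p hp)), ?_⟩, ?_⟩
    · rw [map_smul, map_add, hRR p hp, add_comm, one_smul]
    · rw [map_smul, map_sub, hRR p hp, neg_one_smul, ← smul_neg, neg_sub]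
    · rw [← smul_add, add_add_sub_cancel, ← two_smul ℝ p, smul_smul]; norm_num
  obtain ⟨a1, a2, a3, a4, a5, a6⟩ := hel 1 (by norm_num)
  obtain ⟨b1, b2, b3, b4, b5, b6⟩ := hel (-1) (by norm_num)
  refine ⟨e, lam, fun s h => ?_, (orth _ a1 _ b1).2, fun p hp => ?_, fun p hp h1 h2 => ?_⟩
  · obtain ⟨c1, c2, c3, c4, c5, c6⟩ := hel s h
    refine ⟨c1, c2, c3, fun q hq => ?_, c5⟩
    obtain ⟨p₁, hp₁, p₂, hp₂, rfl⟩ := split q hq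
    have hcase : s = 1 ∨ s = -1 := mul_self_eq_one_iff.1 (by rw [← sq]; exact h)
    rcases hcase with rfl | rfl
    · rw [map_add, map_add, inner_add_right, a4 p₁ hp₁, (orth _ a1 _ hp₂).1, (orth _ a1 _ hp₂).2]
      ring
    · rw [map_add, map_add, inner_add_right, b4 p₂ hp₂, hs _ p₁, real_inner_comm (J p₁),
        (orth _ hp₁ _ b1).1, (orth _ hp₁ _ b1).2]
      ring
  · obtain ⟨p₁, hp₁, p₂, hp₂, rfl⟩ := split p hp
    have o := orth _ hp₁ _ hp₂
    have h1 := mul_le_mul_of_nonneg_right (min_le_left (lam 1) (lam (-1))) (sq_nonneg ‖J p₁‖)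
    have h2 := mul_le_mul_of_nonneg_right (min_le_right (lam 1) (lam (-1))) (sq_nonneg ‖J p₂‖)
    have h3 := a5 p₁ hp₁
    have h4 := b5 p₂ hp₂
    rw [form_add a hs, o.1, map_add, norm_add_sq_real, o.2]
    linarith
  · obtain ⟨p₁, hp₁, p₂, hp₂, rfl⟩ := split p hp
    have o := orth _ hp₁ _ hp₂
    rw [map_add, inner_add_left] at h1 h2
    have o1 := (orth _ a1 _ hp₂).2
    have o2 := (orth _ hp₁ _ b1).2
    rw [real_inner_comm] at o1
    have h3 := a6 p₁ hp₁ (by linarith)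
    have h4 := b6 p₂ hp₂ (by linarith)
    rw [form_add a hs, o.1, map_add, norm_add_sq_real, o.2]
    linarith

end SymmetricMinimizers

/-! ### The reflection on Sobolev triples -/

section Reflection

variable {ω : ℝ} (h0 : 0 < ω) (hπ : ω < π) (L : ℝ)

/-- The action of the reflection on triples. -/
noncomputable def reflTriple : Triple (twoCornerDomain ω L) →L[ℝ] Triple (twoCornerDomain ω L) :=
  let S := (Lp.compMeasurePreservingₗᵢ (E := ℝ) (p := 2) ℝ reflX
    (measurePreserving_reflX_domain h0 hπ L)).toContinuousLinearMap
  let B := (Lp.compMeasurePreservingₗᵢ (E := ℝ) (p := 2) ℝ reflX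
    (measurePreserving_reflX_frontier h0 hπ L)).toContinuousLinearMap
  ContinuousLinearMap.prodMap S (ContinuousLinearMap.prodMap (ContinuousLinearMap.pi fun i =>
    (if i = 0 then -1 else 1 : ℝ) • S.comp (ContinuousLinearMap.proj i)) B)

variable {L}

lemma inner_compMeasurePreserving {α : Type*} [MeasurableSpace α] {μ : Measure α} {σ : α → α}
    (hσ : MeasurePreserving σ μ μ) (u v : Lp ℝ 2 μ) :
    ⟪Lp.compMeasurePreserving σ hσ u, Lp.compMeasurePreserving σ hσ v⟫ = ⟪u, v⟫ :=
  (Lp.compMeasurePreservingₗᵢ (E := ℝ) (p := 2) ℝ σ hσ).inner_map_map u v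

lemma robinCLM_reflTriple (β : ℝ) (p q : Triple (twoCornerDomain ω L)) :
    robinCLM _ β (reflTriple h0 hπ L p) (reflTriple h0 hπ L q) = robinCLM _ β p q := by
  have e1 : ∀ p, (reflTriple h0 hπ L p).2.1 0 = (-1 : ℝ) • Lp.compMeasurePreserving reflX
    (measurePreserving_reflX_domain h0 hπ L) (p.2.1 0) := fun p => rfl
  have e2 : ∀ p, (reflTriple h0 hπ L p).2.1 1 = (1 : ℝ) • Lp.compMeasurePreserving reflX
    (measurePreserving_reflX_domain h0 hπ L) (p.2.1 1) := fun p => rfl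
  have e3 : ∀ p, (reflTriple h0 hπ L p).2.2 = Lp.compMeasurePreserving reflX
    (measurePreserving_reflX_frontier h0 hπ L) p.2.2 := fun p => rfl
  rw [robinCLM_eq, robinCLM_eq, e1, e1, e2, e2, e3, e3, inner_compMeasurePreserving,
    real_inner_smul_left, real_inner_smul_left, real_inner_smul_right, real_inner_smul_right,
    inner_compMeasurePreserving, inner_compMeasurePreserving]
  ring

lemma inner_reflTriple (p q : Triple (twoCornerDomain ω L)) :
    ⟪tripleFst _ (reflTriple h0 hπ L p), tripleFst _ (reflTriple h0 hπ L q)⟫ =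
      ⟪tripleFst _ p, tripleFst _ q⟫ := inner_compMeasurePreserving _ _ _

lemma inner_reflTriple_toLp (p : Triple (twoCornerDomain ω L)) {f : Plane → ℝ}
    (hf : MemLp f 2 (volume.restrict (twoCornerDomain ω L)))
    (hf' : MemLp (fun x => f (reflX x)) 2 (volume.restrict (twoCornerDomain ω L))) :
    ⟪tripleFst _ (reflTriple h0 hπ L p), hf.toLp f⟫ = ⟪tripleFst _ p, hf'.toLp _⟫ := by
  rw [inner_toLp, inner_toLp, ← integral_reflX_domain h0 hπ L]
  refine integral_congr_ae ?_
  have h1 : tripleFst _ (reflTriple h0 hπ L p) =ᵐ[volume.restrict (twoCornerDomain ω L)]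
      fun x => tripleFst _ p (reflX x) :=
    Lp.coeFn_compMeasurePreserving _ (measurePreserving_reflX_domain h0 hπ L)
  have h2 := (measurePreserving_reflX_domain h0 hπ L).quasiMeasurePreserving.ae h1
  filter_upwards [h2] with x hx
  rw [hx, reflX_reflX]

variable [IsFiniteMeasureOnCompacts
  ((μH[1] : Measure Plane).restrict (frontier (twoCornerDomain ω L)))]

lemma reflTriple_triple {φ : Plane → ℝ} (h : IsTest φ) :
    reflTriple h0 hπ L (h.triple _) = h.reflX.triple _ := by
  have q1 := (measurePreserving_reflX_domain h0 hπ L).quasiMeasurePreserving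
  have q2 := (measurePreserving_reflX_frontier h0 hπ L).quasiMeasurePreserving
  refine h.reflX.triple_eq ?_ (fun i => ?_) ?_
  · have h1 : (reflTriple h0 hπ L (h.triple _)).1 =ᵐ[volume.restrict (twoCornerDomain ω L)]
      fun x => (h.triple _).1 (reflX x) :=
      Lp.coeFn_compMeasurePreserving _ (measurePreserving_reflX_domain h0 hπ L)
    exact h1.trans (q1.ae_eq_comp (h.memLp _).coeFn_toLp)
  · have h1 : (reflTriple h0 hπ L (h.triple _)).2.1 i =ᵐ[volume.restrict (twoCornerDomain ω L)]
        fun x => (if i = 0 then -1 else 1 : ℝ) * pderivAt i φ (reflX x) := by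
      refine (Lp.coeFn_smul _ _).trans ?_
      filter_upwards [Lp.coeFn_compMeasurePreserving ((h.triple (twoCornerDomain ω L)).2.1 i)
        (measurePreserving_reflX_domain h0 hπ L), q1.ae_eq_comp (h.memLp_pderiv _ i).coeFn_toLp]
        with x hx hx'
      rw [Pi.smul_apply, smul_eq_mul]
      exact congrArg _ (hx.trans hx')
    refine h1.trans (Eventually.of_forall fun x => ?_)
    fin_cases i
    · change (if (0 : Fin 2) = 0 then (-1 : ℝ) else 1) * _ = pderivAt 0 _ x
      rw [pderivAt_reflX_zero h.differentiable]; simp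
    · change (if (1 : Fin 2) = 0 then (-1 : ℝ) else 1) * _ = pderivAt 1 _ x
      rw [pderivAt_reflX_one h.differentiable]; simp
  · have h1 : (reflTriple h0 hπ L (h.triple _)).2.2
        =ᵐ[(μH[1] : Measure Plane).restrict (frontier (twoCornerDomain ω L))]
        fun x => (h.triple _).2.2 (reflX x) :=
      Lp.coeFn_compMeasurePreserving _ (measurePreserving_reflX_frontier h0 hπ L)
    exact h1.trans (q2.ae_eq_comp h.memLp_frontier.coeFn_toLp)

lemma reflTriple_mem {p : Triple (twoCornerDomain ω L)}
    (hp : p ∈ sobolevH1 (twoCornerDomain ω L)) :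
    reflTriple h0 hπ L p ∈ sobolevH1 (twoCornerDomain ω L) :=
  sobolevH1_induction (P := fun p => reflTriple h0 hπ L p ∈ sobolevH1 (twoCornerDomain ω L))
    ((isClosed_sobolevH1 _).preimage (reflTriple h0 hπ L).continuous) (fun φ hφ => by
      rw [reflTriple_triple]; exact hφ.reflX.triple_mem) hp

lemma reflTriple_reflTriple {p : Triple (twoCornerDomain ω L)}
    (hp : p ∈ sobolevH1 (twoCornerDomain ω L)) :
    reflTriple h0 hπ L (reflTriple h0 hπ L p) = p :=
  sobolevH1_induction (P := fun p => reflTriple h0 hπ L (reflTriple h0 hπ L p) = p)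
    (isClosed_eq (by fun_prop) continuous_id) (fun φ hφ => by
      rw [reflTriple_triple, reflTriple_triple]
      simp only [reflX_reflX]) hp

lemma pderivAt_eq_zero_of_nonneg {f : Plane → ℝ} (hf : ∀ x, 0 ≤ f x) {x : Plane} (hx : f x = 0)
    (i : Fin 2) : pderivAt i f x = 0 := by
  have : IsLocalMin f x := Eventually.of_forall fun y => by rw [hx]; exact hf y
  rw [pderivAt, this.fderiv_eq_zero]; rfl

include h0 hπ in
/-- A nonnegative function and its reflection do not interact if their product vanishes. -/
lemma IsTest.form_add_refl {f : Plane → ℝ} (t : IsTest f) (hf : ∀ x, 0 ≤ f x)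
    (hmul : ∀ x, f x * f (_root_.reflX x) = 0) (β : ℝ) {s : ℝ} (hs : s ^ 2 = 1) :
    robinCLM _ β (t.triple (twoCornerDomain ω L) + s • t.reflX.triple _)
        (t.triple (twoCornerDomain ω L) + s • t.reflX.triple _) =
      2 * robinEnergy (twoCornerDomain ω L) β f ∧
    ‖tripleFst _ (t.triple (twoCornerDomain ω L) + s • t.reflX.triple _)‖ ^ 2 =
      2 * ∫ x in twoCornerDomain ω L, f x ^ 2 := by
  set Ω := twoCornerDomain ω L
  -- At each point f or its reflection vanishes. A zero of a nonnegative function is a minimum, so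
  -- the gradient of that factor vanishes too and the Dirichlet cross term is zero.
  have hgrad : ∀ i x, pderivAt i f x * pderivAt i (fun x => f (_root_.reflX x)) x = 0 :=
    fun i x => by
      rcases mul_eq_zero.1 (hmul x) with h | h
      · rw [pderivAt_eq_zero_of_nonneg hf h, zero_mul]
      · rw [pderivAt_eq_zero_of_nonneg (f := fun x => f (_root_.reflX x)) (fun x => hf _) h,
          mul_zero]
  have c1 : robinCLM Ω β (t.triple Ω) (t.reflX.triple Ω) = 0 := by
    rw [t.robinCLM_triple t.reflX]
    simp only [hgrad, hmul, integral_zero]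
    ring
  have c2 : ⟪tripleFst Ω (t.triple Ω), tripleFst Ω (t.reflX.triple Ω)⟫ = 0 := by
    refine (t.inner_triple (t.reflX.memLp Ω)).trans ?_
    simp only [hmul, integral_zero]
  have c3 : robinCLM Ω β (t.reflX.triple Ω) (t.reflX.triple Ω) =
      robinCLM Ω β (t.triple Ω) (t.triple Ω) := by
    rw [← reflTriple_triple h0 hπ, robinCLM_reflTriple]
  have c4 : ‖tripleFst Ω (t.reflX.triple Ω)‖ ^ 2 = ‖tripleFst Ω (t.triple Ω)‖ ^ 2 := by
    rw [← real_inner_self_eq_norm_sq, ← real_inner_self_eq_norm_sq, ← reflTriple_triple h0 hπ,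
      inner_reflTriple]
  constructor
  · have h := form_add_smul (robinCLM Ω β) (robinCLM_comm Ω β) (t.triple Ω) (t.reflX.triple Ω) 1 s
    rw [one_smul] at h
    rw [h, c1, c3, hs, t.robinCLM_triple_self]
    ring
  · rw [map_add, map_smul, norm_add_sq_real, norm_smul, real_inner_smul_right, c2, mul_pow,
      Real.norm_eq_abs, sq_abs, hs, c4, t.norm_sq_triple]
    ring

end Reflection

/-! ### Even and odd trial states. -/

section SymmetricTrial

variable {ω : ℝ} (hω : ω ∈ Ioo 0 (π / 3) ∪ Ico (π / 2) π) {β : ℝ} (hβ : 0 < β)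

include hω hβ

/-- The one-corner trial state plus s times its reflection. The two summands do not interact, so the
Rayleigh quotient is that of a single corner in both symmetry classes. -/
lemma exists_symmetric_trial : ∃ C ≥ 0, ∀ L ≥ 2, ∀ s : ℝ, s ^ 2 = 1 →
    ∃ p ∈ symmPart (sobolevH1 (twoCornerDomain ω L))
        (reflTriple (angle_bounds hω).1 (angle_bounds hω).2 L) s,
      0 < ‖tripleFst _ p‖ ∧
      robinCLM _ β p p ≤ (sectorEnergy β (ω / 2) + C / L) * ‖tripleFst _ p‖ ^ 2 := by
  obtain ⟨h0, hπ⟩ := angle_bounds hω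
  obtain ⟨C, hC, hCb⟩ := exists_trial_energy_bound hω hβ
  refine ⟨C, hC, fun L hL s hs => ?_⟩
  have hL0 : 0 < L := by linarith
  have := isFiniteMeasureOnCompacts_frontier h0 hπ hL0
  obtain ⟨hN, hE⟩ := hCb L hL
  have t := isTest_leftTrial hω (β := β) hL0
  set Ω := twoCornerDomain ω L
  have hmul : ∀ x, leftTrial β ω L x * leftTrial β ω L (reflX x) = 0 := fun x => by
    have := leftCut_mul_refl h0 hπ hL0 x
    rw [leftTrial, leftTrial]
    linear_combination cornerState β ω L x * cornerState β ω L (reflX x) * this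
  obtain ⟨ha, hn⟩ := t.form_add_refl h0 hπ (L := L) (leftTrial_nonneg β ω L) hmul β hs
  refine ⟨t.triple Ω + s • t.reflX.triple Ω, ⟨Submodule.add_mem _ t.triple_mem
    (Submodule.smul_mem _ s t.reflX.triple_mem), ?_⟩, ?_, ?_⟩
  · rw [map_add, map_smul, reflTriple_triple, reflTriple_triple, smul_add, smul_smul, ← sq, hs,
      one_smul, add_comm]
    simp only [reflX_reflX]
    rfl
  · have : 0 < ‖tripleFst Ω (t.triple Ω + s • t.reflX.triple Ω)‖ ^ 2 := by rw [hn]; linarith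
    exact (norm_nonneg _).lt_of_ne fun h => by rw [← h] at this; norm_num at this
  · rw [ha, hn]
    linarith

end SymmetricTrial

/-! ### Truncation of odd functions -/

section Truncation

/-- A smooth even approximation of the absolute value that vanishes near zero. -/
lemma exists_smooth_abs {ε : ℝ} (hε : 0 < ε) : ∃ θ : ℝ → ℝ,
    ContDiff ℝ ((⊤ : ℕ∞) : WithTop ℕ∞) θ ∧ (∀ t, |t| ≤ ε → θ t = 0) ∧ (∀ t, θ (-t) = θ t) ∧
    (∀ t, 0 ≤ θ t) ∧ (∀ t, θ t ≤ |t|) ∧ (∀ t, |t| - 2 * ε ≤ θ t) ∧ ∀ t, |deriv θ t| ≤ 1 := by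
  -- ρ is a smoothed sign function: odd, zero on [-ε, ε] and ±1 beyond 2ε. Its primitive θ lags
  -- behind |t| by at most 2ε.
  set ρ : ℝ → ℝ := fun s => smoothTransition (s / ε - 1) - smoothTransition (-s / ε - 1) with hρ
  have hρs : ContDiff ℝ ((⊤ : ℕ∞) : WithTop ℕ∞) ρ :=
    (smoothTransition.contDiff.comp ((contDiff_id.div_const ε).sub contDiff_const)).sub
      (smoothTransition.contDiff.comp ((contDiff_neg.div_const ε).sub contDiff_const))
  have hρc : Continuous ρ := hρs.continuous
  have hi : ∀ a b, IntervalIntegrable ρ volume a b := fun a b => hρc.intervalIntegrable a b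
  set θ : ℝ → ℝ := fun t => ∫ s in (0 : ℝ)..t, ρ s with hθ
  have hd : ∀ t, HasDerivAt θ (ρ t) t := fun t =>
    intervalIntegral.integral_hasDerivAt_right (hi 0 t)
      (hρc.stronglyMeasurableAtFilter _ _) hρc.continuousAt
  have hder : deriv θ = ρ := funext fun t => (hd t).deriv
  have hodd : ∀ s, ρ (-s) = -ρ s := fun s => by
    simp only [hρ, neg_neg]; ring
  have heven : ∀ t, θ (-t) = θ t := fun t => by
    have h := intervalIntegral.integral_comp_neg (a := 0) (b := t) ρ
    rw [neg_zero, intervalIntegral.integral_symm 0 (-t)] at h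
    simp only [hodd, intervalIntegral.integral_neg] at h
    simp only [hθ]
    linarith
  have hpos : ∀ s, 0 ≤ s → 0 ≤ ρ s ∧ ρ s ≤ 1 := fun s hs => by
    have : smoothTransition (-s / ε - 1) = 0 := smoothTransition.zero_of_nonpos (by
      have : -s / ε ≤ 0 := div_nonpos_of_nonpos_of_nonneg (by linarith) hε.le
      linarith)
    simp only [hρ, this, sub_zero]
    exact ⟨smoothTransition.nonneg _, smoothTransition.le_one _⟩
  have hzero : ∀ s, 0 ≤ s → s ≤ ε → ρ s = 0 := fun s hs hsε => by
    have h1 : s / ε - 1 ≤ 0 := by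
      have : s / ε ≤ 1 := (div_le_one hε).2 hsε
      linarith
    have h2 : -s / ε - 1 ≤ 0 := by
      have : -s / ε ≤ 0 := div_nonpos_of_nonpos_of_nonneg (by linarith) hε.le
      linarith
    simp only [hρ, smoothTransition.zero_of_nonpos h1, smoothTransition.zero_of_nonpos h2, sub_zero]
  have hone : ∀ s, 2 * ε ≤ s → ρ s = 1 := fun s hs => by
    have h1 : 1 ≤ s / ε - 1 := by
      have : 2 ≤ s / ε := (le_div_iff₀ hε).2 hs
      linarith
    have h2 : -s / ε - 1 ≤ 0 := by
      have : -s / ε ≤ 0 := div_nonpos_of_nonpos_of_nonneg (by linarith) hε.le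
      linarith
    simp only [hρ, smoothTransition.one_of_one_le h1, smoothTransition.zero_of_nonpos h2, sub_zero]
  have nn : ∀ t, 0 ≤ t → 0 ≤ θ t := fun t ht =>
    intervalIntegral.integral_nonneg ht fun s hs => (hpos s hs.1).1
  have habs : ∀ {P : ℝ → ℝ → Prop}, (∀ t, 0 ≤ t → P t (θ t)) → ∀ t, P |t| (θ t) :=
    fun {P} h t => by
      rcases le_total 0 t with ht | ht
      · rw [abs_of_nonneg ht]; exact h t ht
      · rw [abs_of_nonpos ht, ← heven]; exact h (-t) (by linarith)
  refine ⟨θ, ?_, habs (P := fun t v => t ≤ ε → v = 0) fun t ht htε => ?_, heven,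
    habs (P := fun _ v => 0 ≤ v) nn, habs (P := fun t v => v ≤ t) fun t ht => ?_,
    habs (P := fun t v => t - 2 * ε ≤ v) fun t ht => ?_, fun t => ?_⟩
  · rw [contDiff_infty_iff_deriv, hder]
    exact ⟨fun t => (hd t).differentiableAt, hρs⟩
  · simp only [hθ]
    rw [intervalIntegral.integral_congr (g := fun _ => 0) fun s hs => ?_,
      intervalIntegral.integral_zero]
    rw [uIcc_of_le ht] at hs
    exact hzero s hs.1 (hs.2.trans htε)
  · have := intervalIntegral.integral_mono_on ht (hi 0 t) (intervalIntegrable_const (c := (1 : ℝ)))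
      fun s hs => (hpos s hs.1).2
    simpa using this
  · rcases le_total t (2 * ε) with h | h
    · linarith [nn t ht]
    · have h1 := intervalIntegral.integral_add_adjacent_intervals (hi 0 (2 * ε)) (hi (2 * ε) t)
      have h2 : ∫ s in (2 * ε)..t, ρ s = t - 2 * ε := by
        rw [intervalIntegral.integral_congr (g := fun _ => 1) fun s hs => ?_]
        · simp
        · rw [uIcc_of_le h] at hs
          exact hone s hs.1
      have h3 := nn (2 * ε) (by positivity)
      simp only [hθ] at h3 ⊢
      linarith
  · rw [hder, abs_le]
    have a1 := smoothTransition.nonneg (t / ε - 1)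
    have a2 := smoothTransition.le_one (t / ε - 1)
    have a3 := smoothTransition.nonneg (-t / ε - 1)
    have a4 := smoothTransition.le_one (-t / ε - 1)
    exact ⟨by simp only [hρ]; linarith, by simp only [hρ]; linarith⟩

/-- Composition with `θ`, restricted to the right half-plane. -/
noncomputable def rightHalf (θ : ℝ → ℝ) (φ : Plane → ℝ) (x : Plane) : ℝ :=
  if 0 < x 0 then θ (φ x) else 0

variable {θ : ℝ → ℝ} {φ : Plane → ℝ} {ε : ℝ}

lemma zero_of_odd (hodd : ∀ x, φ (reflX x) = -φ x) {x : Plane} (hx : x 0 = 0) : φ x = 0 := by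
  have : reflX x = x := by
    ext i; fin_cases i
    · change reflX x 0 = x 0
      rw [reflX_zero, hx, neg_zero]
    · rfl
  have h := hodd x
  rw [this] at h
  linarith

/-- An odd φ vanishes on the axis, so |φ| < ε near each axis point and θ ∘ φ is zero there. Cutting
along the axis therefore creates no singularity; this is why θ must vanish near 0. -/
lemma isTest_rightHalf (hθ : ContDiff ℝ ((⊤ : ℕ∞) : WithTop ℕ∞) θ) (hε : 0 < ε)
    (h0 : ∀ t, |t| ≤ ε → θ t = 0) (hφ : IsTest φ) (hodd : ∀ x, φ (reflX x) = -φ x) :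
    IsTest (rightHalf θ φ) := by
  have hz : θ 0 = 0 := h0 0 (by rw [abs_zero]; exact hε.le)
  refine ⟨contDiff_iff_contDiffAt.2 fun x => ?_, hφ.compact.mono' fun x hx => ?_⟩
  · have c0 := continuous_coord 0
    rcases lt_trichotomy (x 0) 0 with h | h | h
    · refine (contDiffAt_const (c := (0 : ℝ))).congr_of_eventuallyEq ?_
      filter_upwards [c0.continuousAt.eventually_lt continuousAt_const h] with y hy
      exact if_neg (not_lt.2 hy.le)
    · refine (contDiffAt_const (c := (0 : ℝ))).congr_of_eventuallyEq ?_
      have hx : |φ x| < ε := by rw [zero_of_odd hodd h, abs_zero]; exact hε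
      filter_upwards [hφ.continuous.abs.continuousAt.eventually_lt continuousAt_const hx] with y hy
      rw [rightHalf, h0 _ (le_of_lt hy), ite_self]
    · refine (hθ.comp hφ.smooth).contDiffAt.congr_of_eventuallyEq ?_
      filter_upwards [continuousAt_const.eventually_lt c0.continuousAt h] with y hy
      exact if_pos hy
  · refine subset_tsupport _ ?_
    by_contra hx'
    rw [Function.mem_support, not_not] at hx'
    refine hx ?_
    rw [rightHalf, hx', hz, ite_self]

lemma rightHalf_nonneg (h : ∀ t, 0 ≤ θ t) (x : Plane) : 0 ≤ rightHalf θ φ x := by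
  rw [rightHalf]; split_ifs
  · exact h _
  · exact le_rfl

lemma rightHalf_mul_refl (x : Plane) : rightHalf θ φ x * rightHalf θ φ (reflX x) = 0 := by
  rw [rightHalf, rightHalf, reflX_zero]
  split_ifs
  · linarith
  all_goals simp

lemma rightHalf_add_refl (hz : θ 0 = 0) (he : ∀ t, θ (-t) = θ t)
    (hodd : ∀ x, φ (reflX x) = -φ x) (x : Plane) :
    rightHalf θ φ x + rightHalf θ φ (reflX x) = θ (φ x) := by
  rw [rightHalf, rightHalf, reflX_zero, hodd, he]
  rcases lt_trichotomy (x 0) 0 with h | h | h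
  · rw [if_neg (by linarith), if_pos (by linarith), zero_add]
  · rw [if_neg (by linarith), if_neg (by linarith), zero_of_odd hodd h, hz, add_zero]
  · rw [if_pos h, if_neg (by linarith), add_zero]

lemma IsTest.comp_smooth (hφ : IsTest φ) (hθ : ContDiff ℝ ((⊤ : ℕ∞) : WithTop ℕ∞) θ)
    (hz : θ 0 = 0) : IsTest fun x => θ (φ x) :=
  ⟨hθ.comp hφ.smooth, hφ.compact.comp_left hz⟩

/-- Truncation raises the energy only slightly. -/
lemma robinEnergy_comp_le {Ω : Set Plane}
    [IsFiniteMeasureOnCompacts ((μH[1] : Measure Plane).restrict (frontier Ω))]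
    (hφ : IsTest φ) (hθ : ContDiff ℝ ((⊤ : ℕ∞) : WithTop ℕ∞) θ) (hn : ∀ t, 0 ≤ θ t)
    (hle : ∀ t, θ t ≤ |t|) (hge : ∀ t, |t| - 2 * ε ≤ θ t) (hder : ∀ t, |deriv θ t| ≤ 1)
    (hε : 0 < ε) {β : ℝ} (hβ : 0 < β) (lam : ℝ) :
    robinEnergy Ω β (fun x => θ (φ x)) - lam * (∫ x in Ω, θ (φ x) ^ 2) ≤
      robinEnergy Ω β φ - lam * (∫ x in Ω, φ x ^ 2) +
        ε * (4 * (β * (∫ x in frontier Ω, |φ x| ∂(μH[1] : Measure Plane)) +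
          |lam| * ∫ x in Ω, |φ x|)) := by
  have hz : θ 0 = 0 := le_antisymm ((hle 0).trans (by rw [abs_zero])) (hn 0)
  have t := hφ.comp_smooth hθ hz
  have hd : ∀ i x, pderivAt i (fun x => θ (φ x)) x = deriv θ (φ x) * pderivAt i φ x :=
    fun i x => pderivAt_comp ((hθ.differentiable (by simp) _).hasDerivAt) (hφ.differentiable x) i
  have h1 : ∀ i, ∫ x in Ω, pderivAt i (fun x => θ (φ x)) x ^ 2 ≤ ∫ x in Ω, pderivAt i φ x ^ 2 :=
    fun i => by
      refine integral_mono ((t.pderiv i).integrable_sq _) ((hφ.pderiv i).integrable_sq _)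
        fun x => ?_
      simp only [hd, mul_pow]
      refine mul_le_of_le_one_left (sq_nonneg _) ?_
      rw [← sq_abs]
      exact pow_le_one₀ (abs_nonneg _) (hder _)
  -- The difference t² - θ² factors into |t| - θ ≤ 2ε and |t| + θ ≤ 2|t|.
  have hsq : ∀ t, t ^ 2 - 4 * ε * |t| ≤ θ t ^ 2 ∧ θ t ^ 2 ≤ t ^ 2 := fun t => by
    have a1 := hn t
    have a2 := hle t
    have a3 := hge t
    rw [← sq_abs t]
    refine ⟨?_, pow_le_pow_left₀ a1 a2 2⟩
    nlinarith [abs_nonneg t]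
  have habs : ∀ (μ : Measure Plane) [IsFiniteMeasureOnCompacts μ],
      (∫ x, φ x ^ 2 ∂μ) - 4 * ε * (∫ x, |φ x| ∂μ) ≤ ∫ x, θ (φ x) ^ 2 ∂μ ∧
        ∫ x, θ (φ x) ^ 2 ∂μ ≤ ∫ x, φ x ^ 2 ∂μ := fun μ _ => by
    have i1 := hφ.integrable_sq μ
    have i2 : Integrable (fun x => |φ x|) μ :=
      (hφ.continuous.integrable_of_hasCompactSupport hφ.compact).abs
    refine ⟨?_, integral_mono (t.integrable_sq μ) i1 fun x => (hsq _).2⟩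
    rw [← integral_const_mul, ← integral_sub i1 (i2.const_mul _)]
    exact integral_mono (i1.sub (i2.const_mul _)) (t.integrable_sq μ) fun x => (hsq _).1
  obtain ⟨b1, b2⟩ := habs ((μH[1] : Measure Plane).restrict (frontier Ω))
  obtain ⟨d1, d2⟩ := habs (volume.restrict Ω)
  have hl : -lam * (∫ x in Ω, θ (φ x) ^ 2) ≤
      -lam * (∫ x in Ω, φ x ^ 2) + 4 * ε * (|lam| * ∫ x in Ω, |φ x|) := by
    have h2 : lam * ((∫ x in Ω, φ x ^ 2) - ∫ x in Ω, θ (φ x) ^ 2) ≤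
        |lam| * (4 * ε * ∫ x in Ω, |φ x|) :=
      (mul_le_mul_of_nonneg_right (le_abs_self _) (by linarith)).trans
        (mul_le_mul_of_nonneg_left (by linarith) (abs_nonneg _))
    linarith
  have hb := mul_le_mul_of_nonneg_left b1 hβ.le
  have g0 := h1 0
  have g1 := h1 1
  rw [robinEnergy, robinEnergy]
  linarith

end Truncation

/-! ### An odd ground state solves the equation after truncation -/

section WeakEquation

/-- The Laplacian of a test function. -/
noncomputable def testLaplacian (ζ : Plane → ℝ) (x : Plane) : ℝ :=
  pderivAt 0 (pderivAt 0 ζ) x + pderivAt 1 (pderivAt 1 ζ) x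

/-- Cauchy–Schwarz for the nonnegative form a - lam ⟨J·, J·⟩: the quadratic polynomial of p + t q in
t has nonpositive discriminant. -/
lemma sq_le_mul_of_form_nonneg {X H : Type*} [NormedAddCommGroup X] [NormedSpace ℝ X]
    [NormedAddCommGroup H] [InnerProductSpace ℝ H] (a : X →L[ℝ] X →L[ℝ] ℝ)
    (hs : ∀ p q, a p q = a q p) (J : X →L[ℝ] H) (V : Submodule ℝ X) {lam : ℝ}
    (h : ∀ p ∈ V, lam * ‖J p‖ ^ 2 ≤ a p p) {p q : X} (hp : p ∈ V) (hq : q ∈ V) :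
    (a p q - lam * ⟪J p, J q⟫) ^ 2 ≤
      (a p p - lam * ‖J p‖ ^ 2) * (a q q - lam * ‖J q‖ ^ 2) := by
  have key : ∀ t : ℝ, 0 ≤ (a q q - lam * ‖J q‖ ^ 2) * (t * t) +
      2 * (a p q - lam * ⟪J p, J q⟫) * t + (a p p - lam * ‖J p‖ ^ 2) := fun t => by
    have h1 := h ((1 : ℝ) • p + t • q) (V.add_mem (V.smul_mem _ hp) (V.smul_mem _ hq))
    rw [form_add_smul a hs, map_add, map_smul, map_smul, norm_add_sq_real, norm_smul, norm_smul,
      real_inner_smul_left, real_inner_smul_right, mul_pow, mul_pow, Real.norm_eq_abs,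
      Real.norm_eq_abs, sq_abs, sq_abs] at h1
    linarith
  have := discrim_le_zero key
  rw [discrim] at this
  linarith

variable {Ω : Set Plane} [IsFiniteMeasureOnCompacts ((μH[1] : Measure Plane).restrict (frontier Ω))]

/-- The boundary term vanishes because ζ is supported inside Ω, and two integrations by parts move
all derivatives onto ζ. Afterwards only L² convergence of g is needed to pass to a limit. -/
lemma form_test_eq (hΩ : IsOpen Ω) {g ζ : Plane → ℝ} (hg : IsTest g) (hζ : IsTest ζ)
    (hs : tsupport ζ ⊆ Ω) (β lam : ℝ) :
    robinCLM Ω β (hg.triple Ω) (hζ.triple Ω) -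
        lam * ⟪tripleFst Ω (hg.triple Ω), tripleFst Ω (hζ.triple Ω)⟫ =
      -∫ x in Ω, g x * (testLaplacian ζ x + lam * ζ x) := by
  have hsub : ∀ i, tsupport (pderivAt i ζ) ⊆ Ω := fun i =>
    (closure_minimal (fun x hx => by
      by_contra h
      exact hx (pderivAt_eq_zero_of_notMem h i)) (isClosed_tsupport ζ)).trans hs
  have hb : ∫ x in frontier Ω, g x * ζ x ∂(μH[1] : Measure Plane) = 0 := by
    refine setIntegral_eq_zero_of_forall_eq_zero fun x hx => ?_
    rw [hΩ.frontier_eq] at hx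
    rw [image_eq_zero_of_notMem_tsupport (fun hh => hx.2 (hs hh)), mul_zero]
  have hin : ⟪tripleFst Ω (hg.triple Ω), tripleFst Ω (hζ.triple Ω)⟫ = ∫ x in Ω, g x * ζ x :=
    hg.inner_triple (hζ.memLp Ω)
  rw [hg.robinCLM_triple hζ, hb, hin]
  have h0 := integral_mul_pderivAt hg (hζ.pderiv 0) (hsub 0) 0
  have h1 := integral_mul_pderivAt hg (hζ.pderiv 1) (hsub 1) 1
  have := integral_lincomb₃ (((hζ.pderiv 0).pderiv 0).integrable_mul hg.continuous
    (volume.restrict Ω)) (((hζ.pderiv 1).pderiv 1).integrable_mul hg.continuous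
    (volume.restrict Ω)) (hζ.integrable_mul hg.continuous (volume.restrict Ω)) 1 1 lam
  have e : ∫ x in Ω, g x * (testLaplacian ζ x + lam * ζ x) =
      ∫ x in Ω, (1 * (g x * pderivAt 0 (pderivAt 0 ζ) x) +
        1 * (g x * pderivAt 1 (pderivAt 1 ζ) x) + lam * (g x * ζ x)) := by
    refine integral_congr_ae (Eventually.of_forall fun x => ?_)
    simp only [testLaplacian]; ring
  rw [e, this]
  linarith

omit [IsFiniteMeasureOnCompacts ((μH[1] : Measure Plane).restrict (frontier Ω))] in
lemma integral_abs_sub_mul_le (u v : L2Dom Ω) {η : Plane → ℝ}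
    (hη : MemLp (fun x => |η x|) 2 (volume.restrict Ω)) :
    ∫ x in Ω, |u x - v x| * |η x| ≤ ‖u - v‖ * ‖hη.toLp _‖ := by
  have : ∫ x in Ω, |u x - v x| * |η x| = ⟪|u - v|, hη.toLp _⟫ := by
    rw [inner_toLp]
    refine integral_congr_ae ?_
    filter_upwards [Lp.coeFn_abs (u - v), Lp.coeFn_sub u v] with x h1 h2
    rw [h1, h2, Pi.sub_apply]
  rw [this]
  exact (real_inner_le_norm _ _).trans (by rw [norm_abs_eq_norm])

/-- The modulus of `u` on the right half of the domain. -/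
noncomputable def rightAbs (u : L2Dom Ω) (x : Plane) : ℝ := if 0 < x 0 then |u x| else 0

omit [IsFiniteMeasureOnCompacts ((μH[1] : Measure Plane).restrict (frontier Ω))] in
lemma memLp_rightAbs (u : L2Dom Ω) : MemLp (rightAbs u) 2 (volume.restrict Ω) := by
  have h1 : MemLp (fun x => |u x|) 2 (volume.restrict Ω) := (Lp.memLp u).abs
  exact h1.indicator (isOpen_lt continuous_const (continuous_coord 0)).measurableSet

omit [IsFiniteMeasureOnCompacts ((μH[1] : Measure Plane).restrict (frontier Ω))] in
-- Pointwise, θ(φ) differs from |u| by at most 2ε + |φ - u|. This lets the truncated test functions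
-- replace the modulus of the minimizer.
lemma abs_integral_rightAbs_sub_le (u : L2Dom Ω) {θ : ℝ → ℝ} {φ η : Plane → ℝ} {ε : ℝ}
    (hφ : IsTest φ) (hg : IsTest (rightHalf θ φ)) (hη : IsTest η) (hε : 0 < ε)
    (hle : ∀ t, θ t ≤ |t|) (hge : ∀ t, |t| - 2 * ε ≤ θ t)
    (hη' : MemLp (fun x => |η x|) 2 (volume.restrict Ω)) :
    |(∫ x in Ω, rightAbs u x * η x) - ∫ x in Ω, rightHalf θ φ x * η x| ≤
      2 * ε * (∫ x in Ω, |η x|) + ‖(hφ.memLp Ω).toLp φ - u‖ * ‖hη'.toLp _‖ := by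
  have i1 : Integrable (fun x => rightAbs u x * η x) (volume.restrict Ω) :=
    (memLp_rightAbs u).integrable_mul (hη.memLp Ω)
  have i2 : Integrable (fun x => rightHalf θ φ x * η x) (volume.restrict Ω) :=
    hη.integrable_mul hg.continuous _
  have i3 : Integrable (fun x => |η x|) (volume.restrict Ω) :=
    (integrable_of_continuous_compact hη.continuous hη.compact Ω).abs
  have i4 : Integrable (fun x => |(hφ.memLp Ω).toLp φ x - u x| * |η x|) (volume.restrict Ω) := by
    have : MemLp (fun x => |(hφ.memLp Ω).toLp φ x - u x|) 2 (volume.restrict Ω) :=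
      ((Lp.memLp ((hφ.memLp Ω).toLp φ)).sub (Lp.memLp u)).abs
    exact this.integrable_mul hη'
  rw [← integral_sub i1 i2]
  refine abs_integral_le_integral_abs.trans ?_
  have h1 : ∫ x in Ω, |rightAbs u x * η x - rightHalf θ φ x * η x| ≤
      ∫ x in Ω, (2 * ε * |η x| + |(hφ.memLp Ω).toLp φ x - u x| * |η x|) := by
    refine integral_mono_ae (i1.sub i2).abs ((i3.const_mul _).add i4) ?_
    filter_upwards [(hφ.memLp Ω).coeFn_toLp] with x hx
    rw [hx, ← sub_mul, abs_mul, ← add_mul]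
    refine mul_le_mul_of_nonneg_right ?_ (abs_nonneg _)
    rw [rightAbs, rightHalf]
    split_ifs
    · have a1 := hle (φ x)
      have a2 := hge (φ x)
      have a3 := abs_sub_abs_le_abs_sub (φ x) (u x)
      have a4 := abs_sub_abs_le_abs_sub (u x) (φ x)
      rw [abs_sub_comm] at a4
      rw [abs_le]
      constructor <;> linarith
    · rw [sub_zero, abs_zero]; positivity
  refine h1.trans ?_
  rw [integral_add (i3.const_mul _) i4, integral_const_mul]
  linarith [integral_abs_sub_mul_le ((hφ.memLp Ω).toLp φ) u hη']

end WeakEquation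

section OddGroundState

variable {ω : ℝ} (h0 : 0 < ω) (hπ : ω < π) {L : ℝ} (hL : 0 < L) {β : ℝ} (hβ : 0 < β)

include h0 hπ hL hβ

/-- If an odd function minimizes the Rayleigh quotient, then the modulus of its right half is a
weak solution of the eigenvalue equation. -/
theorem weak_equation_of_odd_minimizer {lam : ℝ}
    (hmin : ∀ p ∈ sobolevH1 (twoCornerDomain ω L), lam * ‖tripleFst _ p‖ ^ 2 ≤ robinCLM _ β p p)
    {e : Triple (twoCornerDomain ω L)}
    (he : e ∈ symmPart (sobolevH1 (twoCornerDomain ω L)) (reflTriple h0 hπ L) (-1))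
    (hlam : robinCLM _ β e e = lam * ‖tripleFst _ e‖ ^ 2) {ζ : Plane → ℝ} (hζ : IsTest ζ)
    (hs : tsupport ζ ⊆ twoCornerDomain ω L) :
    ∫ x in twoCornerDomain ω L, rightAbs e.1 x * (testLaplacian ζ x + lam * ζ x) = 0 := by
  have := isFiniteMeasureOnCompacts_frontier h0 hπ hL
  set Q : Triple (twoCornerDomain ω L) → ℝ := fun p => robinCLM _ β p p - lam * ‖tripleFst _ p‖ ^ 2 with hQ
  have hQc : Continuous Q := (continuous_form _).sub (by fun_prop)
  have hη : IsTest fun x => testLaplacian ζ x + lam * ζ x :=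
    ⟨(((hζ.pderiv 0).pderiv 0).smooth.add ((hζ.pderiv 1).pderiv 1).smooth).add
      (contDiff_const.mul hζ.smooth),
      (((hζ.pderiv 0).pderiv 0).compact.add ((hζ.pderiv 1).pderiv 1).compact).add
        hζ.compact.mul_left⟩
  set η : Plane → ℝ := fun x => testLaplacian ζ x + lam * ζ x with hηdef
  have hη' : MemLp (fun x => |η x|) 2 (volume.restrict (twoCornerDomain ω L)) := (hη.memLp _).abs
  set W := ∫ x in twoCornerDomain ω L, rightAbs e.1 x * η x with hW
  set M₁ := ∫ x in twoCornerDomain ω L, |η x|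
  set M₂ := ‖hη'.toLp _‖
  -- For odd φ let g be the right half of θ ∘ φ. Since θ ∘ φ is the sum of g and its reflection
  -- without interaction, Q(g) is half of Q(θ ∘ φ), hence at most (Q(φ) + εK)/2. Cauchy–Schwarz
  -- against ζ bounds the weak equation for g, and ε → 0 removes the truncation.
  have step : ∀ φ : Plane → ℝ, ∀ hφ : IsTest φ, (∀ x, φ (reflX x) = -φ x) →
      |W| ≤ √(1 / 2 * Q (hφ.triple _) * Q (hζ.triple _)) +
        ‖tripleFst _ (hφ.triple _) - tripleFst _ e‖ * M₂ := by
    intro φ hφ hodd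
    set K := 4 * (β * (∫ x in frontier (twoCornerDomain ω L), |φ x| ∂(μH[1] : Measure Plane)) +
          |lam| * ∫ x in twoCornerDomain ω L, |φ x|) with hK
    have hε : ∀ ε > 0, |W| ≤ √(1 / 2 * (Q (hφ.triple _) + ε * K) * Q (hζ.triple _)) +
        (2 * ε * M₁ + ‖tripleFst _ (hφ.triple _) - tripleFst _ e‖ * M₂) := by
      intro ε hε
      obtain ⟨θ, hθ, t0, te, tn, tle, tge, td⟩ := exists_smooth_abs hε
      have hz : θ 0 = 0 := t0 0 (by rw [abs_zero]; exact hε.le)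
      have hg := isTest_rightHalf hθ hε t0 hφ hodd
      have hθφ := hφ.comp_smooth hθ hz
      obtain ⟨f1, f2⟩ := hg.form_add_refl h0 hπ (L := L) (rightHalf_nonneg tn) rightHalf_mul_refl β
        (s := 1) (by norm_num)
      have hadd : IsTest fun x => rightHalf θ φ x + rightHalf θ φ (reflX x) := by
        simp only [rightHalf_add_refl hz te hodd]; exact hθφ
      rw [one_smul, ← hg.triple_add hg.reflX hadd] at f1 f2
      rw [hadd.robinCLM_triple_self] at f1
      rw [hadd.norm_sq_triple] at f2
      simp only [rightHalf_add_refl hz te hodd] at f1 f2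
      have hen := robinEnergy_comp_le (Ω := twoCornerDomain ω L) hφ hθ tn tle tge td hε hβ lam
      rw [f1, f2] at hen
      have hQg : Q (hg.triple _) ≤ 1 / 2 * (Q (hφ.triple _) + ε * K) := by
        simp only [hQ, hg.robinCLM_triple_self, hg.norm_sq_triple, hφ.robinCLM_triple_self,
          hφ.norm_sq_triple]
        linarith
      have hcs := sq_le_mul_of_form_nonneg (robinCLM _ β) (robinCLM_comm _ β) (tripleFst _)
        (sobolevH1 (twoCornerDomain ω L)) hmin hg.triple_mem hζ.triple_mem
      rw [form_test_eq (isOpen_twoCornerDomain hπ.le L) hg hζ hs, neg_sq] at hcs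
      have hQζ : 0 ≤ Q (hζ.triple _) := sub_nonneg.2 (hmin _ hζ.triple_mem)
      have h1 : |∫ x in twoCornerDomain ω L, rightHalf θ φ x * η x| ≤
          √(1 / 2 * (Q (hφ.triple _) + ε * K) * Q (hζ.triple _)) :=
        Real.abs_le_sqrt (hcs.trans (mul_le_mul_of_nonneg_right hQg hQζ))
      have h2 := abs_integral_rightAbs_sub_le e.1 hφ hg hη hε tle tge hη'
      have h3 := abs_sub_abs_le_abs_sub W (∫ x in twoCornerDomain ω L, rightHalf θ φ x * η x)
      have h4 : |W| ≤ |∫ x in twoCornerDomain ω L, rightHalf θ φ x * η x| +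
          |W - ∫ x in twoCornerDomain ω L, rightHalf θ φ x * η x| := by linarith
      exact h4.trans (add_le_add h1 h2)
    have hlim : Tendsto (fun ε => √(1 / 2 * (Q (hφ.triple _) + ε * K) * Q (hζ.triple _)) +
        (2 * ε * M₁ + ‖tripleFst _ (hφ.triple _) - tripleFst _ e‖ * M₂)) (𝓝[>] 0)
        (𝓝 (√(1 / 2 * (Q (hφ.triple _) + 0 * K) * Q (hζ.triple _)) +
        (2 * 0 * M₁ + ‖tripleFst _ (hφ.triple _) - tripleFst _ e‖ * M₂))) :=
      ((by fun_prop : Continuous fun ε : ℝ =>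
        √(1 / 2 * (Q (hφ.triple _) + ε * K) * Q (hζ.triple _)) +
        (2 * ε * M₁ + ‖tripleFst _ (hφ.triple _) - tripleFst _ e‖ * M₂)).tendsto 0).mono_left
          nhdsWithin_le_nhds
    have := ge_of_tendsto hlim (eventually_mem_nhdsWithin.mono fun ε hε' => hε ε hε')
    simpa using this
  -- The odd projection P makes the estimate for odd test functions into a closed condition on all
  -- triples. At e, where P e = e and Q(e) = 0, its right-hand side vanishes.
  set P : Triple (twoCornerDomain ω L) → Triple (twoCornerDomain ω L) := fun p => (1 / 2 : ℝ) • (p - reflTriple h0 hπ L p) with hP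
  have hPc : Continuous P := by fun_prop
  have hclosed : |W| ≤ √(1 / 2 * Q (P e) * Q (hζ.triple _)) +
      ‖tripleFst _ (P e) - tripleFst _ e‖ * M₂ := by
    refine sobolevH1_induction (P := fun p =>
      |W| ≤ √(1 / 2 * Q (P p) * Q (hζ.triple _)) + ‖tripleFst _ (P p) - tripleFst _ e‖ * M₂)
      (isClosed_le continuous_const ?_) (fun φ hφ => ?_) he.1
    · have := hQc.comp hPc
      have h2 : Continuous fun p => Q (P p) := this
      fun_prop
    · have hψ : IsTest fun x => 1 / 2 * φ x + -(1 / 2) * φ (reflX x) :=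
        ⟨(contDiff_const.mul hφ.smooth).add (contDiff_const.mul hφ.reflX.smooth),
          hφ.compact.mul_left.add hφ.reflX.compact.mul_left⟩
      have e1 : P (hφ.triple _) = hψ.triple _ := by
        have hc : ∀ c : ℝ, IsTest fun x => c * φ x := fun c =>
          IsTest.smooth_mul contDiff_const hφ
        have hcr : ∀ c : ℝ, IsTest fun x => c * φ (reflX x) := fun c =>
          IsTest.smooth_mul contDiff_const hφ.reflX
        rw [(hc (1 / 2)).triple_add (hcr (-(1 / 2))) hψ, hφ.triple_smul _ (hc (1 / 2)),
          hφ.reflX.triple_smul _ (hcr (-(1 / 2)))]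
        simp only [hP]
        rw [reflTriple_triple, smul_sub, neg_smul, sub_eq_add_neg]
      rw [e1]
      refine step _ hψ fun x => ?_
      simp only [reflX_reflX]
      ring
  have hPe : P e = e := by
    simp only [hP]
    rw [he.2, neg_one_smul, sub_neg_eq_add, ← two_smul ℝ e, smul_smul]
    norm_num
  have hQe : Q e = 0 := sub_eq_zero.2 hlam
  rw [hPe, hQe, sub_self, norm_zero, mul_zero, zero_mul, Real.sqrt_zero, zero_mul, add_zero]
    at hclosed
  exact abs_eq_zero.1 (le_antisymm hclosed (abs_nonneg _))

end OddGroundState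

/-! ### A strong maximum principle for weak solutions -/

section MaximumPrinciple

/-- A smooth barrier supported in the ball of radius `R` around `c`. -/
noncomputable def barrier (c : Plane) (τ R : ℝ) (x : Plane) : ℝ :=
  expNegInvGlue (τ * (R ^ 2 - ((x 0 - c 0) ^ 2 + (x 1 - c 1) ^ 2)))

lemma dist_sq_plane (x c : Plane) : dist x c ^ 2 = (x 0 - c 0) ^ 2 + (x 1 - c 1) ^ 2 := by
  rw [EuclideanSpace.dist_eq, Real.sq_sqrt (by positivity), Fin.sum_univ_two, Real.dist_eq,
    Real.dist_eq, sq_abs, sq_abs]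

lemma barrier_eq_zero {c x : Plane} {τ R : ℝ} (hτ : 0 < τ) (hR : 0 < R) (hx : R ≤ dist x c) :
    barrier c τ R x = 0 := by
  refine expNegInvGlue.zero_of_nonpos ?_
  rw [← dist_sq_plane]
  have : R ^ 2 ≤ dist x c ^ 2 := pow_le_pow_left₀ hR.le hx 2
  nlinarith

lemma tsupport_barrier_subset {c : Plane} {τ R : ℝ} (hτ : 0 < τ) (hR : 0 < R) :
    tsupport (barrier c τ R) ⊆ Metric.closedBall c R := by
  refine closure_minimal (fun x hx => ?_) Metric.isClosed_closedBall
  by_contra h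
  rw [Metric.mem_closedBall, not_le] at h
  exact hx (barrier_eq_zero hτ hR h.le)

lemma isTest_barrier {c : Plane} {τ R : ℝ} (hτ : 0 < τ) (hR : 0 < R) :
    IsTest (barrier c τ R) :=
  ⟨expNegInvGlue.contDiff.comp (contDiff_const.mul (contDiff_const.sub
    ((((contDiff_coord 0).sub contDiff_const).pow 2).add
      (((contDiff_coord 1).sub contDiff_const).pow 2)))),
    (isCompact_closedBall c R).of_isClosed_subset (isClosed_tsupport _)
      (tsupport_barrier_subset hτ hR)⟩

lemma hasDerivAt_expNegInvGlue (t : ℝ) :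
    HasDerivAt expNegInvGlue (t⁻¹ ^ 2 * expNegInvGlue t) t := by
  simpa using expNegInvGlue.hasDerivAt_polynomial_eval_inv_mul 1 t

lemma hasDerivAt_sq_mul_expNegInvGlue (t : ℝ) :
    HasDerivAt (fun t => t⁻¹ ^ 2 * expNegInvGlue t)
      ((t⁻¹ ^ 4 - 2 * t⁻¹ ^ 3) * expNegInvGlue t) t := by
  have h := expNegInvGlue.hasDerivAt_polynomial_eval_inv_mul (Polynomial.X ^ 2) t
  simp only [Polynomial.derivative_X_pow, Polynomial.eval_mul, Polynomial.eval_sub,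
    Polynomial.eval_pow, Polynomial.eval_X, Polynomial.eval_C] at h
  refine h.congr_deriv ?_
  norm_num
  left
  ring

/-- Chain rule for e^{-1/q} with q = τ(R² - d²), where |∇q|² = 4τ²d² and Δq = -4τ. The first and
second derivatives of e^{-1/t} bring the factors t⁻² and t⁻⁴ - 2t⁻³. -/
lemma testLaplacian_barrier (c : Plane) (τ R : ℝ) (x : Plane) :
    testLaplacian (barrier c τ R) x = barrier c τ R x *
      (((τ * (R ^ 2 - dist x c ^ 2))⁻¹ ^ 4 - 2 * (τ * (R ^ 2 - dist x c ^ 2))⁻¹ ^ 3) *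
        (4 * τ ^ 2 * dist x c ^ 2) - 4 * τ * (τ * (R ^ 2 - dist x c ^ 2))⁻¹ ^ 2) := by
  set q : Plane → ℝ := fun x => τ * (R ^ 2 - ((x 0 - c 0) ^ 2 + (x 1 - c 1) ^ 2)) with hq
  have pc : ∀ (i : Fin 2) (x : Plane), HasFDerivAt (fun x : Plane => x i - c i)
      (EuclideanSpace.proj i : Plane →L[ℝ] ℝ) x := fun i x =>
    (EuclideanSpace.proj i : Plane →L[ℝ] ℝ).hasFDerivAt.sub_const (c i)
  have hqd : ∀ x, HasFDerivAt q (τ • -((2 * (x 0 - c 0)) • (EuclideanSpace.proj 0 : Plane →L[ℝ] ℝ) +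
      (2 * (x 1 - c 1)) • (EuclideanSpace.proj 1 : Plane →L[ℝ] ℝ))) x := fun x => by
    refine (((((pc 0 x).pow 2).add ((pc 1 x).pow 2)).const_sub (R ^ 2)).const_mul τ).congr_fderiv ?_
    norm_num
  have hqi : ∀ i x, pderivAt i q x = -2 * τ * (x i - c i) := fun i x => by
    rw [pderivAt_eq_of_hasFDerivAt (hqd x)]
    fin_cases i <;> simp <;> ring
  have h1 : ∀ i, pderivAt i (barrier c τ R) =
      fun x => ((q x)⁻¹ ^ 2 * expNegInvGlue (q x)) * (-2 * τ * (x i - c i)) := fun i => by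
    ext x
    rw [← hqi]
    exact pderivAt_comp (hasDerivAt_expNegInvGlue (q x)) (hqd x).differentiableAt i
  have hlin : ∀ i x, HasFDerivAt (fun x : Plane => -2 * τ * (x i - c i))
      ((-2 * τ) • (EuclideanSpace.proj i : Plane →L[ℝ] ℝ)) x := fun i x =>
    (pc i x).const_mul (-2 * τ)
  have h2 : ∀ i x, pderivAt i (pderivAt i (barrier c τ R)) x =
      expNegInvGlue (q x) * (((q x)⁻¹ ^ 4 - 2 * (q x)⁻¹ ^ 3) * (4 * τ ^ 2 * (x i - c i) ^ 2) -
        2 * τ * (q x)⁻¹ ^ 2) := fun i x => by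
    have hf : DifferentiableAt ℝ (fun x => (q x)⁻¹ ^ 2 * expNegInvGlue (q x)) x :=
      ((hasDerivAt_sq_mul_expNegInvGlue (q x)).comp_hasFDerivAt x (hqd x)).differentiableAt
    have e1 := pderivAt_comp (hasDerivAt_sq_mul_expNegInvGlue (q x)) (hqd x).differentiableAt i
    have e2 : pderivAt i (fun x : Plane => -2 * τ * (x i - c i)) x = -2 * τ := by
      rw [pderivAt_eq_of_hasFDerivAt (hlin i x)]
      simp
    rw [h1, pderivAt_mul hf (hlin i x).differentiableAt, e1, e2, hqi]
    ring
  have hb : barrier c τ R x = expNegInvGlue (q x) := rfl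
  rw [testLaplacian, h2, h2, hb, dist_sq_plane]
  simp only [hq]
  ring

/-- Near the edge of the ball the term q⁻⁴ |∇q|² dominates, and a small τ extends this to the whole
annulus r ≤ d < R. There the barrier is a strict subsolution, whatever the sign of lam. -/
lemma exists_barrier_param {r R : ℝ} (hr : 0 < r) (hR : 0 < R) (lam : ℝ) :
    ∃ τ > 0, ∀ d, r ≤ d → d < R →
      0 < ((τ * (R ^ 2 - d ^ 2))⁻¹ ^ 4 - 2 * (τ * (R ^ 2 - d ^ 2))⁻¹ ^ 3) * (4 * τ ^ 2 * d ^ 2) -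
        4 * τ * (τ * (R ^ 2 - d ^ 2))⁻¹ ^ 2 + lam := by
  -- After multiplication by τ²m⁴ the leading term is 4d² ≥ 4r², and τK bounds all the others: 8R⁴
  -- and 4R⁴ come from the Laplacian, R⁸ from the zeroth-order term. The choice of τ gives τK ≤ r².
  set K := 12 * R ^ 4 + |lam| * R ^ 8 with hK
  have hK0 : 0 < K := by positivity
  set τ := r ^ 2 / (r ^ 2 + K) with hτdef
  have hτ : 0 < τ := by positivity
  have hτ1 : τ ≤ 1 := by rw [hτdef, div_le_one (by positivity)]; linarith
  have hτK : τ * K ≤ r ^ 2 := by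
    rw [hτdef, div_mul_eq_mul_div, div_le_iff₀ (by positivity)]
    nlinarith [sq_nonneg r, sq_nonneg (r ^ 2)]
  refine ⟨τ, hτ, fun d hd hdR => ?_⟩
  set m := R ^ 2 - d ^ 2 with hm
  have hd2 : r ^ 2 ≤ d ^ 2 := pow_le_pow_left₀ hr.le hd 2
  have hm0 : 0 < m := by
    have : d ^ 2 < R ^ 2 := pow_lt_pow_left₀ hdR (by linarith) two_ne_zero
    linarith
  have hmR : m ≤ R ^ 2 := by nlinarith [sq_nonneg d]
  have hdR2 : d ^ 2 ≤ R ^ 2 := by linarith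
  have e : ((τ * m)⁻¹ ^ 4 - 2 * (τ * m)⁻¹ ^ 3) * (4 * τ ^ 2 * d ^ 2) - 4 * τ * (τ * m)⁻¹ ^ 2 + lam =
      (4 * d ^ 2 * (1 - 2 * (τ * m)) - 4 * τ * m ^ 2 + lam * τ ^ 2 * m ^ 4) / (τ ^ 2 * m ^ 4) := by
    field_simp
  rw [e]
  refine div_pos ?_ (by positivity)
  have b1 : d ^ 2 * m ≤ R ^ 2 * R ^ 2 := mul_le_mul hdR2 hmR hm0.le (by positivity)
  have b2 : m ^ 2 ≤ (R ^ 2) ^ 2 := pow_le_pow_left₀ hm0.le hmR 2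
  have b3 : m ^ 4 ≤ (R ^ 2) ^ 4 := pow_le_pow_left₀ hm0.le hmR 4
  have b4 : -(τ * (|lam| * R ^ 8)) ≤ lam * τ ^ 2 * m ^ 4 := by
    have c1 : |lam * τ ^ 2 * m ^ 4| ≤ τ * (|lam| * R ^ 8) := by
      rw [abs_mul, abs_mul, abs_of_nonneg (by positivity : 0 ≤ τ ^ 2),
        abs_of_nonneg (by positivity : 0 ≤ m ^ 4)]
      have c2 : τ ^ 2 ≤ τ := by nlinarith
      calc |lam| * τ ^ 2 * m ^ 4 ≤ |lam| * τ * (R ^ 2) ^ 4 := by gcongr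
        _ = _ := by ring
    linarith [neg_abs_le (lam * τ ^ 2 * m ^ 4)]
  have b5 : 8 * τ * (d ^ 2 * m) ≤ 8 * τ * (R ^ 2 * R ^ 2) :=
    mul_le_mul_of_nonneg_left b1 (by positivity)
  have b6 : 4 * τ * m ^ 2 ≤ 4 * τ * (R ^ 2) ^ 2 := mul_le_mul_of_nonneg_left b2 (by positivity)
  have b7 : τ * K = 8 * τ * (R ^ 2 * R ^ 2) + 4 * τ * (R ^ 2) ^ 2 + τ * (|lam| * R ^ 8) := by
    rw [hK]; ring
  have b8 : 0 < r ^ 2 := by positivity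
  nlinarith

variable {Ω : Set Plane} {w : Plane → ℝ} {lam : ℝ}

/-- The zero set of a nonnegative weak solution spreads over balls. -/
lemma null_ball_of_null_ball (hΩ : IsOpen Ω) (hw : MemLp w 2 (volume.restrict Ω))
    (hn : ∀ x, 0 ≤ w x) (heq : ∀ ζ : Plane → ℝ, IsTest ζ → tsupport ζ ⊆ Ω →
      ∫ x in Ω, w x * (testLaplacian ζ x + lam * ζ x) = 0)
    {c : Plane} {r R : ℝ} (hr : 0 < r) (hR : Metric.closedBall c R ⊆ Ω)
    (h : volume ({x | w x ≠ 0} ∩ Metric.ball c r) = 0) :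
    volume ({x | w x ≠ 0} ∩ Metric.ball c R) = 0 := by
  rcases le_or_gt R r with hle | hlt
  · exact measure_mono_null (inter_subset_inter_right _ (Metric.ball_subset_ball hle)) h
  have hR0 : 0 < R := hr.trans hlt
  obtain ⟨τ, hτ, hpos⟩ := exists_barrier_param hr hR0 lam
  have hζ := isTest_barrier (c := c) hτ hR0
  have hzero := heq _ hζ ((tsupport_barrier_subset hτ hR0).trans hR)
  have hη : IsTest fun x => testLaplacian (barrier c τ R) x + lam * barrier c τ R x :=
    ⟨(((hζ.pderiv 0).pderiv 0).smooth.add ((hζ.pderiv 1).pderiv 1).smooth).add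
      (contDiff_const.mul hζ.smooth),
      (((hζ.pderiv 0).pderiv 0).compact.add ((hζ.pderiv 1).pderiv 1).compact).add
        hζ.compact.mul_left⟩
  have hform : ∀ x, testLaplacian (barrier c τ R) x + lam * barrier c τ R x =
      barrier c τ R x * (((τ * (R ^ 2 - dist x c ^ 2))⁻¹ ^ 4 -
        2 * (τ * (R ^ 2 - dist x c ^ 2))⁻¹ ^ 3) * (4 * τ ^ 2 * dist x c ^ 2) -
        4 * τ * (τ * (R ^ 2 - dist x c ^ 2))⁻¹ ^ 2 + lam) := fun x => by
    rw [testLaplacian_barrier]; ring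
  have hball : ∀ᵐ x, x ∉ {x | w x ≠ 0} ∩ Metric.ball c r := measure_eq_zero_iff_ae_notMem.1 h
  -- Tested against the barrier the integrand is nonnegative: w vanishes on the small ball, the
  -- barrier is a subsolution on the annulus and zero outside. As the integral is zero, w must
  -- vanish on the annulus, where the barrier factor is strictly positive.
  have hnn : 0 ≤ᵐ[volume.restrict Ω]
      fun x => w x * (testLaplacian (barrier c τ R) x + lam * barrier c τ R x) := by
    filter_upwards [ae_restrict_of_ae hball] with x hx
    simp only [Pi.zero_apply]
    rcases lt_or_ge (dist x c) r with h1 | h1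
    · have : w x = 0 := by
        by_contra hne
        exact hx ⟨hne, h1⟩
      rw [this, zero_mul]
    · rcases lt_or_ge (dist x c) R with h2 | h2
      · rw [hform]
        exact mul_nonneg (hn x) (mul_nonneg (expNegInvGlue.nonneg _) (hpos _ h1 h2).le)
      · rw [hform, barrier_eq_zero hτ hR0 h2, zero_mul, mul_zero]
  have hae := (integral_eq_zero_iff_of_nonneg_ae hnn (hw.integrable_mul (hη.memLp Ω))).1 hzero
  have hae' := (ae_restrict_iff' hΩ.measurableSet).1 hae
  refine measure_eq_zero_iff_ae_notMem.2 ?_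
  filter_upwards [hball, hae'] with x h1 h2 h3
  obtain ⟨h3, h4⟩ := h3
  have h4' : dist x c < R := h4
  have h5 : r ≤ dist x c := by
    by_contra! hlt'
    exact h1 ⟨h3, hlt'⟩
  have h6 := h2 (hR (Metric.ball_subset_closedBall h4))
  rw [hform, Pi.zero_apply] at h6
  refine (mul_ne_zero h3 (mul_ne_zero (ne_of_gt ?_) (hpos _ h5 h4').ne')) h6
  refine expNegInvGlue.pos_of_pos (mul_pos hτ ?_)
  rw [← dist_sq_plane, sub_pos]
  exact pow_lt_pow_left₀ h4' dist_nonneg two_ne_zero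

/-- A nonnegative weak solution on a connected domain that vanishes on a ball vanishes. -/
theorem null_of_null_ball (hΩ : IsOpen Ω) (hc : IsPreconnected Ω)
    (hw : MemLp w 2 (volume.restrict Ω))
    (hn : ∀ x, 0 ≤ w x) (heq : ∀ ζ : Plane → ℝ, IsTest ζ → tsupport ζ ⊆ Ω →
      ∫ x in Ω, w x * (testLaplacian ζ x + lam * ζ x) = 0)
    {c : Plane} (hcΩ : c ∈ Ω) {r : ℝ} (hr : 0 < r)
    (h : volume ({x | w x ≠ 0} ∩ Metric.ball c r) = 0) : volume ({x | w x ≠ 0} ∩ Ω) = 0 := by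
  set Z : Set Plane := {x | ∃ r > 0, volume ({x | w x ≠ 0} ∩ Metric.ball x r) = 0} with hZ
  have hZo : IsOpen Z := Metric.isOpen_iff.2 fun x ⟨r, hr, hx⟩ =>
    ⟨r / 2, by positivity, fun y hy => ⟨r / 2, by positivity, measure_mono_null
      (inter_subset_inter_right _ (Metric.ball_subset_ball' (by
        have : dist y x < r / 2 := hy
        linarith))) hx⟩⟩
  -- Z is open, and it is relatively closed in Ω: a null ball around a point y within ρ/4 of x grows
  -- to radius ρ/2 inside Ω and then contains a ball around x. Connectedness does the rest.
  have hsub : Ω ⊆ Z := by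
    refine hc.subset_of_closure_inter_subset hZo ⟨c, hcΩ, r, hr, h⟩ ?_
    rintro x ⟨hx, hxΩ⟩
    obtain ⟨ρ, hρ, hball⟩ := Metric.isOpen_iff.1 hΩ x hxΩ
    obtain ⟨y, ⟨s, hs, hy⟩, hxy⟩ := Metric.mem_closure_iff.1 hx (ρ / 4) (by positivity)
    have h1 := null_ball_of_null_ball hΩ hw hn heq (R := ρ / 2) hs (fun z hz => hball (by
      have h2 : dist z y ≤ ρ / 2 := hz
      have h3 := dist_triangle z y x
      rw [dist_comm y x] at h3
      rw [Metric.mem_ball]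
      linarith)) hy
    exact ⟨ρ / 4, by positivity, measure_mono_null
      (inter_subset_inter_right _ (Metric.ball_subset_ball' (by linarith))) h1⟩
  refine measure_null_of_locally_null _ fun x hx => ?_
  obtain ⟨r, hr, h⟩ := hsub hx.2
  exact ⟨_, inter_mem_nhdsWithin _ (Metric.ball_mem_nhds x hr), measure_mono_null
    (inter_subset_inter_left _ inter_subset_left) h⟩

end MaximumPrinciple

/-! ### The ground state is not odd. -/

section Parity

variable {ω : ℝ} (h0 : 0 < ω) (hπ : ω < π) {L : ℝ} (hL : 0 < L) {β : ℝ} (hβ : 0 < β)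

include h0 hπ hL hβ

/-- No nonzero odd function minimizes the Rayleigh quotient. -/
theorem eq_zero_of_odd_minimizer {lam : ℝ}
    (hmin : ∀ p ∈ sobolevH1 (twoCornerDomain ω L), lam * ‖tripleFst _ p‖ ^ 2 ≤ robinCLM _ β p p)
    {e : Triple (twoCornerDomain ω L)}
    (he : e ∈ symmPart (sobolevH1 (twoCornerDomain ω L)) (reflTriple h0 hπ L) (-1))
    (hlam : robinCLM _ β e e = lam * ‖tripleFst _ e‖ ^ 2) : tripleFst _ e = 0 := by
  have hs := sin_pos_of_pos_of_lt_pi h0 hπ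
  have hn : ∀ x, 0 ≤ rightAbs e.1 x := fun x => by
    rw [rightAbs]; split_ifs
    · exact abs_nonneg _
    · exact le_rfl
  have hΩ := isOpen_twoCornerDomain hπ.le L
  -- A point of the domain whose ball of radius L/2 lies in x₀ < 0, where the right modulus is zero
  -- by definition. This ball need not lie in the domain.
  have hmem : pt (-(L / 2)) (L * sin ω / 4) ∈ twoCornerDomain ω L := by
    rw [mem_twoCornerDomain_iff h0 hπ, pt_zero, pt_one, abs_neg, abs_of_pos (by positivity),
      halfWidth]
    refine ⟨by positivity, ?_⟩
    have : L * sin ω / 4 * (cos ω / sin ω) = L / 4 * cos ω := by field_simp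
    rw [this]
    nlinarith [cos_le_one ω]
  have hball : volume ({x | rightAbs e.1 x ≠ 0} ∩
      Metric.ball (pt (-(L / 2)) (L * sin ω / 4)) (L / 2)) = 0 := by
    have : {x | rightAbs e.1 x ≠ 0} ∩
        Metric.ball (pt (-(L / 2)) (L * sin ω / 4)) (L / 2) = ∅ := by
      refine eq_empty_of_forall_notMem fun x ⟨h1, h2⟩ => h1 ?_
      have h3 : dist x (pt (-(L / 2)) (L * sin ω / 4)) ^ 2 < (L / 2) ^ 2 :=
        pow_lt_pow_left₀ h2 dist_nonneg two_ne_zero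
      rw [dist_sq_plane, pt_zero, pt_one] at h3
      have h4 : ¬ 0 < x 0 := fun h => by
        nlinarith [sq_nonneg (x 1 - L * sin ω / 4)]
      exact if_neg h4
    rw [this, measure_empty]
  have hnull := null_of_null_ball hΩ (convex_twoCornerDomain h0 hπ L).isPreconnected
    (memLp_rightAbs e.1) hn
    (fun ζ hζ hsub => weak_equation_of_odd_minimizer h0 hπ hL hβ hmin he hlam hζ hsub)
    hmem (by positivity) hball
  have hright : ∀ᵐ x ∂(volume.restrict (twoCornerDomain ω L)), 0 < x 0 → e.1 x = 0 := by
    rw [ae_restrict_iff' hΩ.measurableSet]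
    filter_upwards [measure_eq_zero_iff_ae_notMem.1 hnull] with x hx hxΩ hx0
    by_contra hne
    refine hx ⟨?_, hxΩ⟩
    change rightAbs e.1 x ≠ 0
    rw [rightAbs, if_pos hx0]
    exact abs_ne_zero.2 hne
  have hq := (measurePreserving_reflX_domain h0 hπ L).quasiMeasurePreserving
  have hodd : ∀ᵐ x ∂(volume.restrict (twoCornerDomain ω L)), e.1 (reflX x) = -e.1 x := by
    have h1 : (reflTriple h0 hπ L e).1 =ᵐ[volume.restrict (twoCornerDomain ω L)]
        fun x => e.1 (reflX x) :=
      Lp.coeFn_compMeasurePreserving _ (measurePreserving_reflX_domain h0 hπ L)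
    have h2 : (reflTriple h0 hπ L e).1 = -e.1 := by
      rw [he.2, neg_one_smul]; rfl
    rw [h2] at h1
    filter_upwards [h1, Lp.coeFn_neg e.1] with x hx hx'
    rw [← hx, hx', Pi.neg_apply]
  have hmid : ∀ᵐ x ∂(volume.restrict (twoCornerDomain ω L)), x 0 ≠ 0 := by
    refine ae_restrict_of_ae ?_
    have := Measure.addHaar_submodule (volume : Measure Plane)
      (LinearMap.ker (EuclideanSpace.proj 0 : Plane →L[ℝ] ℝ).toLinearMap) (fun htop => by
        have h1 : pt 1 0 ∈ LinearMap.ker (EuclideanSpace.proj 0 : Plane →L[ℝ] ℝ).toLinearMap := by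
          rw [htop]; trivial
        exact one_ne_zero (α := ℝ) h1)
    filter_upwards [measure_eq_zero_iff_ae_notMem.1 this] with x hx hx0
    exact hx hx0
  refine Lp.ext ?_
  filter_upwards [hright, hq.ae hright, hodd, hmid,
    Lp.coeFn_zero ℝ 2 (volume.restrict (twoCornerDomain ω L))] with x h1 h2 h3 h4 h5
  rw [h5, Pi.zero_apply]
  rcases lt_or_gt_of_ne h4 with h | h
  · have := h2 (by rw [reflX_zero]; linarith)
    rw [h3] at this
    exact neg_eq_zero.1 this
  · exact h1 h

end Parity

/-! ### The two lowest eigenvalues of the Robin Laplacian -/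

section Spectrum

variable {ω : ℝ} (hω : ω ∈ Ioo 0 (π / 3) ∪ Ico (π / 2) π) {β : ℝ} (hβ : 0 < β)
include hω hβ

/-- For large `L` there are exactly two spectral points below a level above the sector energy. -/
theorem exists_twoLowEigenvalues : ∃ g > 0, ∃ C ≥ 0, ∃ L₀ > 0, ∀ L ≥ L₀, C / L < g ∧
    ∃ l₁ l₂ u₁ u₂, TwoLowEigenvalues (twoCornerRobin β ω L) (sectorEnergy β (ω / 2) + g)
      l₁ l₂ u₁ u₂ ∧ |l₁ - sectorEnergy β (ω / 2)| ≤ C / L ∧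
      |l₂ - sectorEnergy β (ω / 2)| ≤ C / L := by
  obtain ⟨g, hg, C, hC, D, hD, hlow⟩ := robinCLM_lower hω hβ
  obtain ⟨C', hC', htrial⟩ := exists_symmetric_trial hω hβ
  have h0 := (angle_bounds hω).1
  have hπ := (angle_bounds hω).2
  set E := sectorEnergy β (ω / 2)
  refine ⟨g / 2, by positivity, C + C', by positivity, 2 + 4 * (C + C') / g, by positivity,
    -- Half of g is given up to absorb the error C/L, and the choice of L₀ makes (C + C')/L smaller
    -- than the other half.
    fun L hL => ?_⟩
  have hL2 : 2 ≤ L := by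
    have : 0 ≤ 4 * (C + C') / g := by positivity
    linarith
  have hL1 : 1 ≤ L := by linarith
  have hL0 : 0 < L := by linarith
  have hCL : (C + C') / L < g / 2 := by
    rw [div_lt_iff₀ hL0]
    have h1 : 4 * (C + C') / g ≤ L := by linarith
    rw [div_le_iff₀ hg] at h1
    nlinarith
  have hsum : (C + C') / L = C / L + C' / L := by ring
  have hCL1 : 0 ≤ C / L := by positivity
  have hCL2 : 0 ≤ C' / L := by positivity
  refine ⟨hCL, ?_⟩
  obtain ⟨c, hc, K, hcoer⟩ := exists_coercive hω hβ hL1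
  have hlowL := hlow L hL1
  have := isFiniteMeasureOnCompacts_frontier h0 hπ hL0
  have ht := isTest_leftTrial hω (β := β) hL0
  obtain ⟨e, lam, he, horth, hmin, hperp⟩ := exists_symmetric_minimizers
    (robinCLM (twoCornerDomain ω L) β) (robinCLM_comm _ β) (tripleFst _)
    (sobolevH1 (twoCornerDomain ω L)) (isClosed_sobolevH1 _) (reflTriple h0 hπ L)
    (fun p hp => reflTriple_mem h0 hπ hp) (fun p hp => reflTriple_reflTriple h0 hπ hp)
    (robinCLM_reflTriple h0 hπ β) (inner_reflTriple h0 hπ)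
    (fun p => inner_reflTriple_toLp h0 hπ p (ht.memLp _) (ht.reflX.memLp _)) hc hD hcoer
    (μ := E + g / 2) (fun p hp => by
      have h1 := (hlowL p hp).1
      have h2 : (E + g / 2) * ‖tripleFst _ p‖ ^ 2 ≤ (E + g - C / L) * ‖tripleFst _ p‖ ^ 2 :=
        mul_le_mul_of_nonneg_right (by linarith) (sq_nonneg _)
      linarith)
    (fun s hs => by
      obtain ⟨p, hp, hp0, hpE⟩ := htrial L hL2 s hs
      refine ⟨p, hp, hpE.trans_lt ?_⟩
      exact mul_lt_mul_of_pos_right (by linarith) (by positivity))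
  have hself : ∀ s : ℝ, s ^ 2 = 1 →
      robinCLM _ β (e s) (e s) = lam s * ‖tripleFst _ (e s)‖ ^ 2 := fun s hs => by
    obtain ⟨h1, h2, h3, h4, h5⟩ := he s hs
    rw [h4 _ h1.1, real_inner_self_eq_norm_sq]
  have hbd : ∀ s : ℝ, s ^ 2 = 1 → |lam s - E| ≤ (C + C') / L := fun s hs => by
    obtain ⟨h1, h2, h3, h4, h5⟩ := he s hs
    obtain ⟨p, hp, hp0, hpE⟩ := htrial L hL2 s hs
    have h6 := (hlowL _ h1.1).2
    rw [hself s hs, h3, one_pow, mul_one, mul_one] at h6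
    have h7 : lam s ≤ E + C' / L :=
      le_of_mul_le_mul_right ((h5 p hp).trans hpE) (by positivity)
    rw [abs_le]
    constructor <;> linarith
  obtain ⟨a1, a2, a3, a4, a5⟩ := he 1 (by norm_num)
  obtain ⟨b1, b2, b3, b4, b5⟩ := he (-1) (by norm_num)
  -- Otherwise the odd level would be the minimum over the whole form domain and the odd minimizer
  -- would have to vanish, contrary to its normalization.
  have hlt : lam 1 < lam (-1) := by
    by_contra! hle
    rw [min_eq_right hle] at hmin
    have := eq_zero_of_odd_minimizer h0 hπ hL0 hβ hmin b1 (hself (-1) (by norm_num))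
    rw [this, norm_zero] at b3
    exact zero_ne_one b3
  exact ⟨lam 1, lam (-1), _, _, twoLowEigenvalues_of_form (robinCLM (twoCornerDomain ω L) β)
    (robinCLM_comm _ β) (tripleFst _) (sobolevH1 (twoCornerDomain ω L)) (isClosed_sobolevH1 _)
    hc hcoer (mem_robinLaplacian_graph_iff (isOpen_twoCornerDomain hπ.le L) β) a1.1 b1.1 hlt b2
    a3 b3 horth a4 b4 hperp, hbd 1 (by norm_num), hbd (-1) (by norm_num)⟩

end Spectrum

/-! ### Conclusion: reading off the four statements. -/

theorem mainTheorem3 (β : ℝ) (hβ : 0 < β) (ω : ℝ) (hω : ω ∈ Ioo 0 (π / 3) ∪ Ico (π / 2) π) :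
    -- for large `L` there are at least two eigenvalues below the essential spectrum
    (∀ᶠ L in atTop,
      IsOpEigenvalue (twoCornerRobin β ω L) (twoCornerEigenvalue β ω 1 L) ∧
      IsOpEigenvalue (twoCornerRobin β ω L) (twoCornerEigenvalue β ω 2 L) ∧
      twoCornerEigenvalue β ω 1 L < twoCornerEigenvalue β ω 2 L ∧
      (twoCornerEigenvalue β ω 2 L : EReal) <
        ⨅ x ∈ essentialSpectrum (twoCornerRobin β ω L), (x : EReal)) ∧
    -- both converge to `E_α`
    Tendsto (twoCornerEigenvalue β ω 1) atTop (𝓝 (sectorEnergy β (ω / 2))) ∧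
    Tendsto (twoCornerEigenvalue β ω 2) atTop (𝓝 (sectorEnergy β (ω / 2))) ∧
    -- the rest of the spectrum stays uniformly above `E_α`
    (sectorEnergy β (ω / 2) : EReal) < liminf (fun L : ℝ =>
      ⨅ x ∈ opSpectrum (twoCornerRobin β ω L) \
        {twoCornerEigenvalue β ω 1 L, twoCornerEigenvalue β ω 2 L}, (x : EReal)) atTop ∧
    -- exactly two eigenvalues, each of multiplicity one, in a fixed neighbourhood of `E_α`
    ∃ δ > 0, ∃ L₀ > 0, ∀ L ≥ L₀,
      opSpectrum (twoCornerRobin β ω L) ∩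
          Ioo (sectorEnergy β (ω / 2) - δ) (sectorEnergy β (ω / 2) + δ)
        = {twoCornerEigenvalue β ω 1 L, twoCornerEigenvalue β ω 2 L} ∧
      Module.finrank ℝ
        (opEigenspace (twoCornerRobin β ω L) (twoCornerEigenvalue β ω 1 L)) = 1 ∧
      Module.finrank ℝ
        (opEigenspace (twoCornerRobin β ω L) (twoCornerEigenvalue β ω 2 L)) = 1 := by
  obtain ⟨g, hg, C, hC, L₀, hL₀, h⟩ := exists_twoLowEigenvalues hω hβ
  set E := sectorEnergy β (ω / 2)
  have hlarge : ∀ᶠ L : ℝ in atTop, L₀ ≤ L := eventually_ge_atTop L₀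
  have hlim : Tendsto (fun L : ℝ => C / L) atTop (𝓝 0) := tendsto_const_nhds.div_atTop tendsto_id
  have hnear : ∀ L ≥ L₀, |twoCornerEigenvalue β ω 1 L - E| ≤ C / L ∧
      |twoCornerEigenvalue β ω 2 L - E| ≤ C / L := fun L hL => by
    obtain ⟨-, l₁, l₂, u₁, u₂, hA, b1, b2⟩ := h L hL
    rw [twoCornerEigenvalue, twoCornerEigenvalue, hA.nthEigenvalue_one, hA.nthEigenvalue_two]
    exact ⟨b1, b2⟩
  have hspec : ∀ L ≥ L₀, opSpectrum (twoCornerRobin β ω L) ∩ Iio (E + g) =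
      {twoCornerEigenvalue β ω 1 L, twoCornerEigenvalue β ω 2 L} := fun L hL => by
    obtain ⟨-, l₁, l₂, u₁, u₂, hA, -, -⟩ := h L hL
    rw [twoCornerEigenvalue, twoCornerEigenvalue, hA.nthEigenvalue_one, hA.nthEigenvalue_two]
    exact hA.spectrum_inter
  refine ⟨?_, ?_, ?_, ?_, g, hg, L₀, hL₀, fun L hL => ⟨?_, ?_⟩⟩
  · filter_upwards [hlarge] with L hL
    obtain ⟨-, l₁, l₂, u₁, u₂, hA, -, -⟩ := h L hL
    rw [twoCornerEigenvalue, twoCornerEigenvalue, hA.nthEigenvalue_one, hA.nthEigenvalue_two]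
    refine ⟨hA.isOpEigenvalue₁, hA.isOpEigenvalue₂, hA.lt₁₂, ?_⟩
    exact (EReal.coe_lt_coe_iff.2 hA.lt₂).trans_le (le_iInf₂ fun x hx =>
      EReal.coe_le_coe_iff.2 (hA.le_of_mem_essentialSpectrum hx))
  · refine tendsto_iff_norm_sub_tendsto_zero.2 (squeeze_zero' (Eventually.of_forall fun _ =>
      norm_nonneg _) ?_ hlim)
    filter_upwards [hlarge] with L hL using (hnear L hL).1
  · refine tendsto_iff_norm_sub_tendsto_zero.2 (squeeze_zero' (Eventually.of_forall fun _ =>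
      norm_nonneg _) ?_ hlim)
    filter_upwards [hlarge] with L hL using (hnear L hL).2
  · refine (EReal.coe_lt_coe_iff.2 (by linarith : E < E + g)).trans_le (le_liminf_of_le
      (by isBoundedDefault) ?_)
    filter_upwards [hlarge] with L hL
    refine le_iInf₂ fun x hx => EReal.coe_le_coe_iff.2 ?_
    by_contra! hlt
    exact hx.2 (hspec L hL ▸ ⟨hx.1, hlt⟩)
  -- With δ = g the upper end of the window is the threshold below which the spectrum is known. The
  -- inequality C/L < g places both eigenvalues above the lower end.
  · have hCg := (h L hL).1
    obtain ⟨n1, n2⟩ := hnear L hL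
    rw [abs_le] at n1 n2
    rw [← hspec L hL]
    refine Subset.antisymm (fun x hx => ⟨hx.1, hx.2.2⟩) fun x hx => ⟨hx.1, ?_, hx.2⟩
    rw [hspec L hL] at hx
    rcases hx with rfl | rfl
    · linarith
    · linarith
  · obtain ⟨-, l₁, l₂, u₁, u₂, hA, -, -⟩ := h L hL
    rw [twoCornerEigenvalue, twoCornerEigenvalue, hA.nthEigenvalue_one, hA.nthEigenvalue_two]
    exact ⟨hA.finrank₁, hA.finrank₂⟩
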